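/- All algebras and coalgebras are over $\mathbb{C}$. Let $A$ be a CQG Hopf $*$-algebra, i.e. a Hopf algebra with a $*$-structure such that $\Delta(a^*)=a_{(1)}^*\otimes a_{(2)}^*$, admitting a linear functional $\Phi$ with $(\mathrm{id}\otimes\Phi)\Delta(a)=\Phi(a)1=(\Phi\otimes\mathrm{id})\Delta(a)$, $\Phi(1)=1$ and $\Phi(a^*a)\ge 0$ for all $a\in A$; put $a^\dagger=S(a)^*$. Let $C$ be a coalgebra with an involutive, antilinear, anti-comultiplicative map $\dagger$ and a left $A$-module structure with $\Delta(ac)=a_{(1)}c_{(1)}\otimes a_{(2)}c_{(2)}$, $\varepsilon(ac)=\varepsilon(a)\varepsilon(c)$, $(ac)^\dagger=a^\dagger c^\dagger$, and let $\pi_C:A\to C$ be a surjective, left $A$-linear, $\dagger$-preserving coalgebra map. Let $B=\{b\in A : (\pi_C\otimes\mathrm{id})\Delta(b)=\pi_C(1)\otimes b\}$, a unital $*$-subalgebra of $A$ with $\Delta(B)\subseteq B\otimes A$; write $b_{(0)}\otimes b_{(1)}=\Delta(b)\in B\otimes A$ for $b\in B$. (This is a CQG Doi–Koppinen datum of coideal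 type.) Let $\mathscr{I}=\mathrm{Lin}(C,\mathbb{C})$ with convolution product $(xy)(c)=x(c_{(1)})y(c_{(2)})$ and involution $x^*(c)=\overline{x(c^\dagger)}$, put $(x\lhd a)(c)=x(ac)$ for $x\in\mathscr I$, $a\in A$, and let $\mathcal{I}=\{x\in\mathscr{I} : \mathscr{I}x\mathscr{I}\text{ is finite-dimensional}\}$ be the restricted dual. Let $\mathscr{D}(B,\mathscr{I})$ be the unital $*$-algebra generated by the unital $*$-algebras $B$ and $\mathscr{I}$ with relations $xb=b_{(0)}(x\lhd b_{(1)})$ for $x\in\mathscr I$, $b\in B$, and let $\mathcal{D}(B,\mathcal{I})=B\mathcal{I}\subseteq\mathscr{D}(B,\mathscr{I})$, which is a $*$-subalgebra. A $*$-representation of $\mathcal{D}(B,\mathcal{I})$ on a Hilbert space $H$ (by bounded operators) is non-degenerate if the linear span of $\pi_{\mathcal D}(\mathcal D(B,\mathcal I))H$ is dense in $H$. A unitary Doi–Koppinen module is a pre-Hilbert space $H_0$ (inner product antilinear in the first variable) with a counital right $C$-comodule structure $\delta(v)=v_{(0)}\otimes v_{(1)}$ and a unital left $B$-module structure $\pi_0$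 such that, for all $b\in B$ and $v,w\in H_0$: $\delta(bv)=b_{(0)}v_{(0)}\otimes b_{(1)}v_{(1)}$; $\langle v,bw\rangle=\langle b^*v,w\rangle$; and $\langle v,w_{(0)}\rangle w_{(1)}=\langle v_{(0)},w\rangle v_{(1)}^\dagger$. It is locally complete if for every finite-dimensional subcoalgebra $E\subseteq C$ the space $\{v\in H_0:\delta(v)\in H_0\otimes E\}$ is complete. Put $\hat\pi_0(x)v=v_{(0)}x(v_{(1)})$ for $x\in\mathscr I$. If $H_0$ is isometrically embedded in a Hilbert space $H$, we say that a $*$-representation $\pi_{\mathcal D}$ of $\mathcal D(B,\mathcal I)$ on $H$ satisfies $(\ast)$ if there are $*$-representations $\pi$ of $B$ (unital) and $\hat\pi$ of $\mathcal I$ on $H$ by bounded operators, extending $\pi_0$ and $\hat\pi_0|_{\mathcal I}$ respectively, such that $$\pi_{\mathcal D}(bx)=\pi(b)\hat\pi(x),\qquad b\in B,\ x\in\mathcal{I}.\tag{$\ast$}$$ Theorem. (1) For every unitary Doi–Koppinen module $H_0$ there is exactly one $*$-representation $\pi_{\mathcal D}$ of $\mathcal{D}(B,\mathcal{I})$ on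 the completion $H$ of $H_0$ satisfying $(\ast)$, and it is non-degenerate. (2) Conversely, if $\pi_{\mathcal D}$ is a non-degenerate $*$-representation of $\mathcal{D}(B,\mathcal{I})$ on a Hilbert space $H$, then the subspace $H_0:=\pi_{\mathcal D}(\mathcal{I})H$ (linear span) carries a unique structure of unitary Doi–Koppinen module such that $(\ast)$ holds. (3) These constructions set up a one-to-one correspondence between locally complete unitary Doi–Koppinen modules and non-degenerate $*$-representations of $\mathcal{D}(B,\mathcal{I})$. Precisely: for every Hilbert space $H$ they are mutually inverse bijections between the locally complete unitary Doi–Koppinen modules whose underlying pre-Hilbert space is a dense subspace of $H$ and the non-degenerate $*$-representations of $\mathcal{D}(B,\mathcal{I})$ on $H$; and two locally complete unitary Doi–Koppinen modules are related by a unitary isomorphism intertwining the $B$-actions and $C$-coactions if and only if the associated $*$-representations on their completions are unitarily equivalent. -/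

import Mathlib

universe u v w

open scoped TensorProduct ComplexOrder
open Coalgebra WithConv

/-! ### Hopf `*`-algebras, `†`-coalgebras and the datum -/

/-- A Hopf `*`-algebra: a complex Hopf algebra with a `*`-structure such that
`Δ(a^*) = a₍₁₎^* ⊗ a₍₂₎^*`. The `star` on the tensor product is `a ⊗ b ↦ a^* ⊗ b^*`. -/
class HopfStarAlgebra (A : Type*) [Ring A] [HopfAlgebra ℂ A] [StarRing A] [StarModule ℂ A] :
    Prop where
  comul_star : ∀ a : A, comul (R := ℂ) (star a) = star (comul (R := ℂ) a)

/-- A CQG Hopf `*`-algebra: a Hopf `*`-algebra admitting an invariant state. -/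
class CQGHopfStarAlgebra (A : Type*) [Ring A] [HopfAlgebra ℂ A] [StarRing A] [StarModule ℂ A] :
    Prop extends HopfStarAlgebra A where
  exists_invariant_state : ∃ Φ : A →ₗ[ℂ] ℂ,
    (∀ a : A, TensorProduct.rid ℂ A (Φ.lTensor A (comul (R := ℂ) a)) = Φ a • (1 : A)) ∧
    (∀ a : A, TensorProduct.lid ℂ A (Φ.rTensor A (comul (R := ℂ) a)) = Φ a • (1 : A)) ∧
    Φ 1 = 1 ∧ ∀ a : A, 0 ≤ Φ (star a * a)

/-- A `†`-coalgebra: a complex coalgebra with an involutive, antilinear, anti-comultiplicative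
map `†`. The involution `c ↦ c^†` is written `star c`; it is involutive and additive by
`StarAddMonoid C` and antilinear by `StarModule ℂ C`. -/
class DagCoalgebra (C : Type*) [AddCommGroup C] [Module ℂ C] [Coalgebra ℂ C]
    [StarAddMonoid C] [StarModule ℂ C] : Prop where
  comul_dag : ∀ c : C, comul (R := ℂ) (star c) =
    TensorProduct.comm ℂ C C (star (comul (R := ℂ) c))

/-- The action `a ↦ (c ↦ a • c)` of `A` on a module `C`, as a `ℂ`-bilinear map. -/
noncomputable def moduleMap (A C : Type*) [Ring A] [Algebra ℂ A] [AddCommGroup C] [Module ℂ C]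
    [Module A C] [IsScalarTower ℂ A C] : A →ₗ[ℂ] C →ₗ[ℂ] C :=
  (Algebra.lsmul ℂ ℂ C).toLinearMap

/-- A left `A`-module `†`-coalgebra: `C` is a left `A`-module such that
`Δ(a c) = a₍₁₎ c₍₁₎ ⊗ a₍₂₎ c₍₂₎`, `ε(a c) = ε(a) ε(c)` and `(a c)^† = a^† c^†`,
where `a^† = S(a)^*` is the canonical `†`-structure of `A`. -/
class ModuleDagCoalgebra (A C : Type*) [Ring A] [HopfAlgebra ℂ A] [StarRing A]
    [AddCommGroup C] [Module ℂ C] [Coalgebra ℂ C] [StarAddMonoid C] [StarModule ℂ C]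
    [DagCoalgebra C] [Module A C] [IsScalarTower ℂ A C] : Prop where
  comul_smul : ∀ (a : A) (c : C), comul (R := ℂ) (a • c) =
    TensorProduct.map₂ (moduleMap A C) (moduleMap A C) (comul (R := ℂ) a) (comul (R := ℂ) c)
  counit_smul : ∀ (a : A) (c : C),
    counit (R := ℂ) (a • c) = counit (R := ℂ) a * counit (R := ℂ) c
  dag_smul : ∀ (a : A) (c : C), star (a • c) = star (HopfAlgebra.antipode ℂ a) • star c

/-- A CQG Doi–Koppinen datum of coideal type: a CQG Hopf `*`-algebra `A` together with a quotient
left `A`-module `†`-coalgebra `π_C : A → C`. The third ingredient `B = {}^C A` is determined by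
these, see `CQGCoidealDatum.B`. -/
structure CQGCoidealDatum (A C : Type*) [Ring A] [HopfAlgebra ℂ A] [StarRing A] [StarModule ℂ A]
    [CQGHopfStarAlgebra A]
    [AddCommGroup C] [Module ℂ C] [Coalgebra ℂ C] [StarAddMonoid C] [StarModule ℂ C]
    [DagCoalgebra C] [Module A C] [IsScalarTower ℂ A C] [ModuleDagCoalgebra A C] where
  /-- the coalgebra map `π_C` -/
  proj : A →ₗc[ℂ] C
  proj_surjective : Function.Surjective proj
  proj_mul : ∀ a a' : A, proj (a * a') = a • proj a'
  proj_dag : ∀ a : A, proj (star (HopfAlgebra.antipode ℂ a)) = star (proj a)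

section HopfStar

variable {A : Type*} [Ring A] [HopfAlgebra ℂ A] [StarRing A] [StarModule ℂ A] [HopfStarAlgebra A]

/-- If `Δ(a) = ∑ l ⊗ r` then `Δ(a^*) = ∑ l^* ⊗ r^*`. -/
noncomputable def starRepr {ι : Type*} {a : A} (𝓡 : Coalgebra.Repr ℂ a ι) :
    Coalgebra.Repr ℂ (star a) ι where
  index := 𝓡.index
  left i := star (𝓡.left i)
  right i := star (𝓡.right i)
  eq := by
    rw [HopfStarAlgebra.comul_star, ← 𝓡.eq, star_sum]; rfl

theorem counit_star (a : A) : counit (R := ℂ) (star a) = star (counit (R := ℂ) a) := by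
  have h1 := congrArg (fun x => counit (R := ℂ) (star x)) (sum_counit_smul (ℛ ℂ a))
  have h2 := congrArg (fun x => counit (R := ℂ) (star (TensorProduct.rid ℂ A x)))
    (sum_tmul_counit_eq (starRepr (ℛ ℂ a)))
  simp only [star_sum, star_smul, map_sum, map_smul, star_star, smul_eq_mul, one_smul,
    TensorProduct.rid_tmul, starRepr] at h1 h2
  have h3 := congrArg star h2
  rw [← h1, ← h3, star_sum]
  exact Finset.sum_congr rfl fun _ _ => by simp [mul_comm]

/-- The map `a ↦ S(a^*)^*`, which is the inverse of the antipode `S`. -/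
noncomputable def antipodeInv (A : Type*) [Ring A] [HopfAlgebra ℂ A] [StarRing A]
    [StarModule ℂ A] : A →ₗ[ℂ] A where
  toFun a := star (HopfAlgebra.antipode ℂ (star a))
  map_add' := by simp
  map_smul' := by simp

theorem sum_antipodeInv_mul {ι : Type*} {a : A} (𝓡 : Coalgebra.Repr ℂ a ι) :
    ∑ i ∈ 𝓡.index, antipodeInv A (𝓡.right i) * 𝓡.left i = counit (R := ℂ) a • (1 : A) := by
  have h := congrArg star (HopfAlgebra.sum_mul_antipode_eq_smul (starRepr 𝓡))
  rw [counit_star] at h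
  simpa [starRepr, antipodeInv, star_sum] using h

theorem antipode_antipodeInv (a : A) : HopfAlgebra.antipode ℂ (antipodeInv A a) = a := by
  have h : toConv (HopfAlgebra.antipode ℂ (A := A)) *
      toConv (HopfAlgebra.antipode ℂ (A := A) ∘ₗ antipodeInv A) = 1 := by
    ext a
    rw [(ℛ ℂ a).convMul_apply]
    have := congrArg (HopfAlgebra.antipode ℂ) (sum_antipodeInv_mul (ℛ ℂ a))
    simpa [map_sum, HopfAlgebra.antipode_mul_antidistrib, Algebra.algebraMap_eq_smul_one]
      using this
  have h' := left_inv_eq_right_inv (LinearMap.id_mul_antipode (R := ℂ) (C := A)) h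
  exact (LinearMap.congr_fun (congrArg ofConv h') a).symm

end HopfStar

namespace CQGCoidealDatum

variable {A C : Type*} [Ring A] [HopfAlgebra ℂ A] [StarRing A] [StarModule ℂ A]
  [CQGHopfStarAlgebra A]
  [AddCommGroup C] [Module ℂ C] [Coalgebra ℂ C] [StarAddMonoid C] [StarModule ℂ C]
  [DagCoalgebra C] [Module A C] [IsScalarTower ℂ A C] [ModuleDagCoalgebra A C]
  (D : CQGCoidealDatum A C)

theorem rTensor_proj_mul (t s : A ⊗[ℂ] A) :
    D.proj.toLinearMap.rTensor A (t * s) =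
      TensorProduct.map₂ (moduleMap A C) (LinearMap.mul ℂ A) t
        (D.proj.toLinearMap.rTensor A s) := by
  induction t with
  | zero => simp
  | add x y hx hy => simp only [add_mul, map_add, LinearMap.add_apply, hx, hy]
  | tmul p q =>
    induction s with
    | zero => simp
    | add x y hx hy => simp only [mul_add, map_add, hx, hy]
    | tmul p' q' => simp [moduleMap, D.proj_mul]

theorem map₂_proj_one (t : A ⊗[ℂ] A) (b : A) :
    TensorProduct.map₂ (moduleMap A C) (LinearMap.mul ℂ A) t (D.proj 1 ⊗ₜ[ℂ] b) =
      (LinearMap.mulRight ℂ b).lTensor C (D.proj.toLinearMap.rTensor A t) := by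
  induction t with
  | zero => simp
  | add x y hx hy => simp [hx, hy]
  | tmul p q => simp [moduleMap, ← D.proj_mul]

theorem mul_mem_aux {b b' : A}
    (hb : D.proj.toLinearMap.rTensor A (comul (R := ℂ) b) = D.proj 1 ⊗ₜ[ℂ] b)
    (hb' : D.proj.toLinearMap.rTensor A (comul (R := ℂ) b') = D.proj 1 ⊗ₜ[ℂ] b') :
    D.proj.toLinearMap.rTensor A (comul (R := ℂ) (b * b')) = D.proj 1 ⊗ₜ[ℂ] (b * b') := by
  rw [Bialgebra.comul_mul, rTensor_proj_mul, hb', map₂_proj_one, hb]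
  simp

/-- `(π_C ⊗ id ⊗ id)(Δ ⊗ id)Δ(b) = π_C(1) ⊗ Δ(b)` for `b ∈ B`. -/
theorem coassoc_aux {b : A}
    (hb : D.proj.toLinearMap.rTensor A (comul (R := ℂ) b) = D.proj 1 ⊗ₜ[ℂ] b) :
    D.proj.toLinearMap.rTensor (A ⊗[ℂ] A) (TensorProduct.assoc ℂ A A A
      ((comul (R := ℂ)).rTensor A (comul (R := ℂ) b))) = D.proj 1 ⊗ₜ[ℂ] comul (R := ℂ) b := by
  rw [coassoc_apply]
  have := congrArg ((comul (R := ℂ) (A := A)).lTensor C) hb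
  rw [LinearMap.lTensor_tmul] at this
  rw [← this]
  rw [← LinearMap.comp_apply (LinearMap.rTensor _ _), ← LinearMap.comp_apply (LinearMap.lTensor _ _),
    LinearMap.lTensor_comp_rTensor, LinearMap.rTensor_comp_lTensor]

theorem proj_star (a : A) : D.proj (star a) = star (D.proj (antipodeInv A a)) := by
  rw [← D.proj_dag, antipode_antipodeInv]

theorem star_mem_aux {b : A}
    (hb : D.proj.toLinearMap.rTensor A (comul (R := ℂ) b) = D.proj 1 ⊗ₜ[ℂ] b) :
    D.proj.toLinearMap.rTensor A (comul (R := ℂ) (star b)) = D.proj 1 ⊗ₜ[ℂ] star b := by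
  have h1 : ∀ t : A ⊗[ℂ] A, D.proj.toLinearMap.rTensor A (star t) =
      star ((D.proj.toLinearMap ∘ₗ antipodeInv A).rTensor A t) := by
    intro t
    induction t with
    | zero => simp
    | add x y hx hy => simp only [star_add, map_add, hx, hy]
    | tmul p q => simp [D.proj_star]
  have hone : star (D.proj 1) = D.proj 1 := by
    rw [← D.proj_dag]; simp
  let Ψ : C ⊗[ℂ] (A ⊗[ℂ] A) →ₗ[ℂ] C ⊗[ℂ] A :=
    ((TensorProduct.lift (moduleMap A C ∘ₗ antipodeInv A)).rTensor A) ∘ₗ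
      (TensorProduct.assoc ℂ A C A).symm.toLinearMap ∘ₗ
      (TensorProduct.leftComm ℂ C A A).toLinearMap
  have hΨ : ∀ (c : C) (p q : A), Ψ (c ⊗ₜ (p ⊗ₜ q)) = (antipodeInv A p • c) ⊗ₜ q := by
    intro c p q; simp [Ψ, moduleMap]
  have h2 : ∀ t : A ⊗[ℂ] A, Ψ (D.proj 1 ⊗ₜ t) =
      (D.proj.toLinearMap ∘ₗ antipodeInv A).rTensor A t := by
    intro t
    induction t with
    | zero => simp
    | add x y hx hy => rw [TensorProduct.tmul_add, map_add, map_add, hx, hy]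
    | tmul p q => simp [hΨ, ← D.proj_mul]
  have h3 : ∀ t : A ⊗[ℂ] A, Ψ (D.proj.toLinearMap.rTensor (A ⊗[ℂ] A) (TensorProduct.assoc ℂ A A A
      ((comul (R := ℂ)).rTensor A t))) =
      D.proj 1 ⊗ₜ TensorProduct.lid ℂ A ((counit (R := ℂ)).rTensor A t) := by
    intro t
    induction t with
    | zero => simp
    | add x y hx hy => simp only [map_add, hx, hy, TensorProduct.tmul_add]
    | tmul p q =>
      rw [LinearMap.rTensor_tmul, ← (ℛ ℂ p).eq]
      simp only [TensorProduct.sum_tmul, map_sum, TensorProduct.assoc_tmul, LinearMap.rTensor_tmul,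
        hΨ, TensorProduct.lid_tmul]
      rw [← TensorProduct.sum_tmul]
      have := congrArg D.proj (sum_antipodeInv_mul (ℛ ℂ p))
      simp only [map_sum, D.proj_mul, map_smul] at this
      simp [this, TensorProduct.smul_tmul]
  have h4 := h3 (comul (R := ℂ) b)
  rw [D.coassoc_aux hb, h2, rTensor_counit_comul] at h4
  rw [HopfStarAlgebra.comul_star, h1, h4]
  simp [hone]

/-- The unital `*`-subalgebra `B = {}^C A = {b ∈ A ∣ (π_C ⊗ id)Δ(b) = π_C(1) ⊗ b}` of `A`. -/
noncomputable def B : StarSubalgebra ℂ A where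
  carrier := {b | D.proj.toLinearMap.rTensor A (comul (R := ℂ) b) = D.proj 1 ⊗ₜ[ℂ] b}
  mul_mem' hb hb' := D.mul_mem_aux hb hb'
  add_mem' {b b'} hb hb' := by
    change D.proj.toLinearMap.rTensor A (comul (R := ℂ) (b + b')) = _
    rw [map_add, map_add, hb, hb', TensorProduct.tmul_add]
  algebraMap_mem' r := by
    simp [Algebra.algebraMap_eq_smul_one, Algebra.TensorProduct.one_def]
  star_mem' hb := D.star_mem_aux hb

theorem mem_B {b : A} : b ∈ D.B ↔
    D.proj.toLinearMap.rTensor A (comul (R := ℂ) b) = D.proj 1 ⊗ₜ[ℂ] b := Iff.rfl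

/-- The inclusion of `B` in `A`, as a linear map. -/
noncomputable def inclB : D.B →ₗ[ℂ] A := D.B.toSubalgebra.toSubmodule.subtype

theorem rTensor_inclB_injective : Function.Injective (D.inclB.rTensor A) :=
  Module.Flat.rTensor_preserves_injective_linearMap _ Subtype.val_injective

/-- `B` is a right coideal: `Δ(B) ⊆ B ⊗ A`. -/
theorem comul_mem_range (b : D.B) :
    comul (R := ℂ) (b : A) ∈ LinearMap.range (D.inclB.rTensor A) := by
  let f : A →ₗ[ℂ] C ⊗[ℂ] A :=
    D.proj.toLinearMap.rTensor A ∘ₗ comul - TensorProduct.mk ℂ C A (D.proj 1)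
  have hex : Function.Exact D.inclB f := by
    intro a
    simp only [f, LinearMap.sub_apply, sub_eq_zero]
    exact ⟨fun h => ⟨⟨a, h⟩, rfl⟩, by rintro ⟨b, rfl⟩; exact b.2⟩
  have hex' := Module.Flat.rTensor_exact A hex
  refine (hex' _).1 ?_
  have h := D.coassoc_aux b.2
  have hf : f.rTensor A = (D.proj.toLinearMap.rTensor A).rTensor A ∘ₗ (comul (R := ℂ)).rTensor A -
      (TensorProduct.mk ℂ C A (D.proj 1)).rTensor A := by
    simp only [f, LinearMap.rTensor_sub, LinearMap.rTensor_comp]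
  have e1 : ∀ t : (A ⊗[ℂ] A) ⊗[ℂ] A, TensorProduct.assoc ℂ C A A
      ((D.proj.toLinearMap.rTensor A).rTensor A t) =
      D.proj.toLinearMap.rTensor (A ⊗[ℂ] A) (TensorProduct.assoc ℂ A A A t) := by
    intro t
    simp [LinearMap.rTensor_tensor]
  have e2 : ∀ t : A ⊗[ℂ] A, TensorProduct.assoc ℂ C A A
      ((TensorProduct.mk ℂ C A (D.proj 1)).rTensor A t) = D.proj 1 ⊗ₜ t := by
    intro t
    induction t with
    | zero => simp
    | add x y hx hy => simp only [map_add, hx, hy, TensorProduct.tmul_add]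
    | tmul p q => simp
  apply (TensorProduct.assoc ℂ C A A).injective
  rw [map_zero, hf, LinearMap.sub_apply, map_sub, LinearMap.comp_apply, e1, e2, h, sub_self]

/-- The right coaction `δ_B : B → B ⊗ A`, the restriction of `Δ` to `B`
(see `rTensor_inclB_coactB`). -/
noncomputable def coactB : D.B →ₗ[ℂ] D.B ⊗[ℂ] A :=
  (LinearEquiv.ofInjective _ D.rTensor_inclB_injective).symm.toLinearMap ∘ₗ
    LinearMap.codRestrict _ (comul ∘ₗ D.inclB) D.comul_mem_range

theorem rTensor_inclB_coactB (b : D.B) :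
    D.inclB.rTensor A (D.coactB b) = comul (R := ℂ) (b : A) := by
  have := (LinearEquiv.ofInjective _ D.rTensor_inclB_injective).apply_symm_apply
    ⟨_, D.comul_mem_range b⟩
  exact congrArg Subtype.val this

end CQGCoidealDatum

/-! ### The full dual and the restricted dual of a `†`-coalgebra -/

section Dual

variable {C : Type*} [AddCommGroup C] [Module ℂ C]

/-- The full linear dual of `C`, with the convolution product
`(x y)(c) = x(c₍₁₎) y(c₍₂₎)` and the unit `ε`. -/
abbrev FullDual (C : Type*) [AddCommGroup C] [Module ℂ C] : Type _ := WithConv (C →ₗ[ℂ] ℂ)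

section

variable {A : Type*} [Ring A] [Algebra ℂ A] [Module A C] [IsScalarTower ℂ A C]

/-- The right action of `A` on the full dual of `C`: `(x ◁ a)(c) = x(a c)`. -/
noncomputable def rightAct (x : FullDual C) : A →ₗ[ℂ] FullDual C where
  toFun a := toConv (x.ofConv ∘ₗ moduleMap A C a)
  map_add' a a' := by ext c; simp
  map_smul' r a := by ext c; simp

@[simp] theorem rightAct_apply (x : FullDual C) (a : A) (c : C) :
    (rightAct x a).ofConv c = x.ofConv (a • c) := rfl

theorem rightAct_rightAct (x : FullDual C) (a b : A) :
    rightAct (rightAct x a) b = rightAct x (a * b) := by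
  ext c; simp [mul_smul]

theorem rightAct_one (x : FullDual C) : rightAct x (1 : A) = x := by
  ext c; simp

variable (A) in
/-- The map `x ↦ x ◁ a`, as a linear map. -/
noncomputable def rightActBy (a : A) : FullDual C →ₗ[ℂ] FullDual C where
  toFun x := rightAct x a
  map_add' _ _ := by ext c; simp
  map_smul' _ _ := by ext c; simp

end

variable [Coalgebra ℂ C]

/-- The linear span `𝓘_full x 𝓘_full` of all `z x y` with `z`, `y` in the full dual. -/
def twoSidedSpan (x : FullDual C) : Submodule ℂ (FullDual C) :=
  Submodule.span ℂ {w | ∃ z y : FullDual C, w = z * x * y}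

theorem finiteDimensional_twoSidedSpan_of_le {x : FullDual C} {W : Submodule ℂ (FullDual C)}
    [FiniteDimensional ℂ W] (h : ∀ z y : FullDual C, z * x * y ∈ W) :
    FiniteDimensional ℂ (twoSidedSpan x) := by
  have hle : twoSidedSpan x ≤ W := Submodule.span_le.2 (by rintro _ ⟨z, y, rfl⟩; exact h z y)
  exact Submodule.finiteDimensional_of_le hle

theorem mul_mul_mem_twoSidedSpan (x z y : FullDual C) : z * x * y ∈ twoSidedSpan x :=
  Submodule.subset_span ⟨z, y, rfl⟩

variable [StarAddMonoid C] [StarModule ℂ C] [DagCoalgebra C]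

/-- The full dual of a `†`-coalgebra is a `*`-algebra with `x^*(c) = conj (x (c^†))`
(see `fullDual_star_apply`). -/
noncomputable instance instStarRingFullDual : StarRing (FullDual C) :=
  LinearMap.convIntrinsicStarRing (by
    ext c
    have h : ∀ t : C ⊗[ℂ] C, star (TensorProduct.comm ℂ C C t) =
        TensorProduct.comm ℂ C C (star t) := by
      intro t
      induction t with
      | zero => simp
      | add x y hx hy => simp only [map_add, star_add, hx, hy]
      | tmul p q => simp
    change star (comul (R := ℂ) (star c)) = TensorProduct.comm ℂ C C (comul (R := ℂ) c)
    rw [DagCoalgebra.comul_dag, h, star_star])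

noncomputable instance instStarFullDual : Star (FullDual C) :=
  instStarRingFullDual.toStarMul.toInvolutiveStar.toStar

theorem fullDual_star_apply (x : FullDual C) (c : C) :
    (star x).ofConv c = star (x.ofConv (star c)) := rfl

instance instStarModuleFullDual : StarModule ℂ (FullDual C) :=
  ⟨fun r x => by ext c; simp⟩

/-- The restricted dual `𝓘 = {x ∈ 𝓘_full ∣ 𝓘_full x 𝓘_full is finite-dimensional}`, as a (possibly
non-unital) `*`-subalgebra of the full dual. -/
def restrictedDual (C : Type*) [AddCommGroup C] [Module ℂ C] [Coalgebra ℂ C] [StarAddMonoid C]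
    [StarModule ℂ C] [DagCoalgebra C] : NonUnitalStarSubalgebra ℂ (FullDual C) where
  carrier := {x | FiniteDimensional ℂ (twoSidedSpan x)}
  add_mem' {x x'} (hx : FiniteDimensional ℂ _) (hx' : FiniteDimensional ℂ _) :=
    finiteDimensional_twoSidedSpan_of_le (W := twoSidedSpan x ⊔ twoSidedSpan x') fun z y => by
      rw [mul_add, add_mul]
      exact add_mem (Submodule.mem_sup_left (mul_mul_mem_twoSidedSpan x z y))
        (Submodule.mem_sup_right (mul_mul_mem_twoSidedSpan x' z y))
  zero_mem' := finiteDimensional_twoSidedSpan_of_le (W := ⊥) (by simp)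
  mul_mem' {x x'} (hx : FiniteDimensional ℂ _) _ :=
    finiteDimensional_twoSidedSpan_of_le (W := twoSidedSpan x) fun z y => by
      rw [← mul_assoc z, mul_assoc]
      exact mul_mul_mem_twoSidedSpan x z _
  smul_mem' r x (hx : FiniteDimensional ℂ _) :=
    finiteDimensional_twoSidedSpan_of_le (W := twoSidedSpan x) fun z y => by
      rw [mul_smul_comm, smul_mul_assoc]
      exact Submodule.smul_mem _ r (mul_mul_mem_twoSidedSpan x z y)
  star_mem' {x} (hx : FiniteDimensional ℂ _) :=
    finiteDimensional_twoSidedSpan_of_le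
      (W := (twoSidedSpan x).map (starLinearEquiv ℂ (A := FullDual C)).toLinearMap) fun z y =>
        ⟨star y * x * star z, mul_mul_mem_twoSidedSpan x _ _, by simp [mul_assoc]⟩

theorem mem_restrictedDual {x : FullDual C} :
    x ∈ restrictedDual C ↔ FiniteDimensional ℂ (twoSidedSpan x) := Iff.rfl

variable {A : Type*} [Ring A] [HopfAlgebra ℂ A] [StarRing A] [Module A C] [IsScalarTower ℂ A C]
  [ModuleDagCoalgebra A C]

theorem mul_rightAct {ι : Type*} (x y : FullDual C) {a : A} (𝓡 : Coalgebra.Repr ℂ a ι) :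
    rightAct (x * y) a = ∑ i ∈ 𝓡.index, rightAct x (𝓡.left i) * rightAct y (𝓡.right i) := by
  ext c
  rw [rightAct_apply]
  change (x * y) (a • c) = _
  rw [LinearMap.convMul_apply, ModuleDagCoalgebra.comul_smul, ← 𝓡.eq, ofConv_sum,
    LinearMap.sum_apply]
  simp only [map_sum, LinearMap.sum_apply]
  refine Finset.sum_congr rfl fun i _ => ?_
  rw [LinearMap.convMul_apply]
  induction comul (R := ℂ) c with
  | zero => simp
  | add s t hs ht => simp only [map_add, hs, ht]
  | tmul p q => simp [moduleMap]

theorem mul_rightAct_left (z x : FullDual C) (a : A) :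
    z * rightAct x a = ∑ i ∈ (ℛ ℂ a).index,
      rightAct (rightAct z (HopfAlgebra.antipode ℂ ((ℛ ℂ a).left i)) * x) ((ℛ ℂ a).right i) := by
  let F : A ⊗[ℂ] (A ⊗[ℂ] A) →ₗ[ℂ] FullDual C :=
    LinearMap.mul' ℂ (FullDual C) ∘ₗ
      TensorProduct.map (rightAct z ∘ₗ LinearMap.mul' ℂ A ∘ₗ
        (HopfAlgebra.antipode ℂ (A := A)).rTensor A) (rightAct x) ∘ₗ
      (TensorProduct.assoc ℂ A A A).symm.toLinearMap
  have hF : ∀ p q r, F (p ⊗ₜ (q ⊗ₜ r)) =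
      rightAct z (HopfAlgebra.antipode ℂ p * q) * rightAct x r := by
    intro p q r; simp [F]
  have h := congrArg F (sum_tmul_tmul_eq (ℛ ℂ a) (fun i => ℛ ℂ ((ℛ ℂ a).left i))
    (fun i => ℛ ℂ ((ℛ ℂ a).right i)))
  simp only [map_sum, hF] at h
  simp only [fun i => mul_rightAct (rightAct z (HopfAlgebra.antipode ℂ ((ℛ ℂ a).left i))) x
    (ℛ ℂ ((ℛ ℂ a).right i)), rightAct_rightAct]
  rw [← h]
  simp only [← Finset.sum_mul, ← map_sum, HopfAlgebra.sum_antipode_mul_eq_smul]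
  conv_lhs => rw [← sum_counit_smul (ℛ ℂ a)]
  simp [Finset.mul_sum, rightAct_one]

theorem mul_rightAct_right [StarModule ℂ A] [HopfStarAlgebra A] (x y : FullDual C) (a : A) :
    rightAct x a * y = ∑ i ∈ (ℛ ℂ a).index,
      rightAct (x * rightAct y (antipodeInv A ((ℛ ℂ a).right i))) ((ℛ ℂ a).left i) := by
  let F : A ⊗[ℂ] (A ⊗[ℂ] A) →ₗ[ℂ] FullDual C :=
    LinearMap.mul' ℂ (FullDual C) ∘ₗ
      TensorProduct.map (rightAct x) (rightAct y ∘ₗ LinearMap.mul' ℂ A ∘ₗ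
        (antipodeInv A).rTensor A ∘ₗ (TensorProduct.comm ℂ A A).toLinearMap)
  have hF : ∀ p q r, F (p ⊗ₜ (q ⊗ₜ r)) =
      rightAct x p * rightAct y (antipodeInv A r * q) := by
    intro p q r; simp [F]
  have h := congrArg F (sum_tmul_tmul_eq (ℛ ℂ a) (fun i => ℛ ℂ ((ℛ ℂ a).left i))
    (fun i => ℛ ℂ ((ℛ ℂ a).right i)))
  simp only [map_sum, hF] at h
  simp only [fun i => mul_rightAct x (rightAct y (antipodeInv A ((ℛ ℂ a).right i)))
    (ℛ ℂ ((ℛ ℂ a).left i)), rightAct_rightAct]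
  rw [h]
  simp only [← Finset.mul_sum, ← map_sum, sum_antipodeInv_mul]
  have h2 := congrArg (TensorProduct.rid ℂ A) (sum_tmul_counit_eq (ℛ ℂ a))
  simp only [map_sum, TensorProduct.rid_tmul, one_smul] at h2
  conv_lhs => rw [← h2]
  simp [Finset.sum_mul, rightAct_one]

/-- The restricted dual is stable under the action of `A`. -/
theorem rightAct_mem_restrictedDual [StarModule ℂ A] [HopfStarAlgebra A] {x : FullDual C}
    (hx : x ∈ restrictedDual C) (a : A) : rightAct x a ∈ restrictedDual C := by
  rw [mem_restrictedDual] at hx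
  let W : A → Submodule ℂ (FullDual C) := fun l => (twoSidedSpan x).map (rightActBy A l)
  let J : Finset ((A × A) × (A × A)) := (ℛ ℂ a).index.sigma
    (fun i => (ℛ ℂ ((ℛ ℂ a).right i)).index) |>.map (Equiv.sigmaEquivProd _ _).toEmbedding
  refine finiteDimensional_twoSidedSpan_of_le
    (W := J.sup fun j => W ((ℛ ℂ ((ℛ ℂ a).right j.1)).left j.2)) fun z y => ?_
  rw [mul_rightAct_left, Finset.sum_mul]
  refine Submodule.sum_mem _ fun i hi => ?_
  rw [mul_rightAct_right]
  refine Submodule.sum_mem _ fun j hj => ?_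
  have hij : (i, j) ∈ J := by
    simp only [J, Finset.mem_map]
    exact ⟨⟨i, j⟩, Finset.mem_sigma.2 ⟨hi, hj⟩, rfl⟩
  exact Finset.le_sup (f := fun j : (A × A) × (A × A) =>
    W ((ℛ ℂ ((ℛ ℂ a).right j.1)).left j.2)) hij
    ⟨_, mul_mul_mem_twoSidedSpan x _ _, rfl⟩

end Dual

/-! ### The Drinfeld doubles `𝒟(B, 𝓘_full)` and `𝓓(B, 𝓘)` -/

namespace CQGCoidealDatum

variable {A C : Type*} [Ring A] [HopfAlgebra ℂ A] [StarRing A] [StarModule ℂ A]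
  [CQGHopfStarAlgebra A]
  [AddCommGroup C] [Module ℂ C] [Coalgebra ℂ C] [StarAddMonoid C] [StarModule ℂ C]
  [DagCoalgebra C] [Module A C] [IsScalarTower ℂ A C] [ModuleDagCoalgebra A C]
  (D : CQGCoidealDatum A C)

/-- The free unital complex algebra on the disjoint union of `B` and the full dual of `C`. -/
abbrev FreeDouble : Type _ := FreeAlgebra ℂ (D.B ⊕ FullDual C)

/-- The generator of the free algebra associated with `b ∈ B`. -/
noncomputable def genB (b : D.B) : D.FreeDouble := FreeAlgebra.ι ℂ (Sum.inl b)

/-- The generator of the free algebra associated with an element `x` of the full dual. -/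
noncomputable def genI (x : FullDual C) : D.FreeDouble := FreeAlgebra.ι ℂ (Sum.inr x)

/-- The defining relations of `𝒟(B, 𝓘_full)`: the maps from `B` and from `𝓘_full` are homomorphisms
of unital algebras, and `x b = b₍₀₎ (x ◁ b₍₁₎)`, together with the adjoint
`b^* x^* = (x ◁ b₍₁₎)^* b₍₀₎^*` of this interchange relation. -/
inductive DoubleRel : D.FreeDouble → D.FreeDouble → Prop
  | B_add (b b' : D.B) : DoubleRel (D.genB (b + b')) (D.genB b + D.genB b')
  | B_smul (r : ℂ) (b : D.B) : DoubleRel (D.genB (r • b)) (r • D.genB b)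
  | B_mul (b b' : D.B) : DoubleRel (D.genB (b * b')) (D.genB b * D.genB b')
  | B_one : DoubleRel (D.genB 1) 1
  | I_add (x y : FullDual C) : DoubleRel (D.genI (x + y)) (D.genI x + D.genI y)
  | I_smul (r : ℂ) (x : FullDual C) : DoubleRel (D.genI (r • x)) (r • D.genI x)
  | I_mul (x y : FullDual C) : DoubleRel (D.genI (x * y)) (D.genI x * D.genI y)
  | I_one : DoubleRel (D.genI 1) 1
  | interchange (x : FullDual C) (b : D.B) (n : ℕ) (b₀ : Fin n → D.B) (b₁ : Fin n → A)
      (h : D.coactB b = ∑ i, b₀ i ⊗ₜ[ℂ] b₁ i) :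
      DoubleRel (D.genI x * D.genB b) (∑ i, D.genB (b₀ i) * D.genI (rightAct x (b₁ i)))
  | interchange_star (x : FullDual C) (b : D.B) (n : ℕ) (b₀ : Fin n → D.B) (b₁ : Fin n → A)
      (h : D.coactB b = ∑ i, b₀ i ⊗ₜ[ℂ] b₁ i) :
      DoubleRel (D.genB (star b) * D.genI (star x))
        (∑ i, D.genI (star (rightAct x (b₁ i))) * D.genB (star (b₀ i)))

/-- The unital `*`-algebra `𝒟(B, 𝓘_full)` generated by `B` and the full dual of `C`, with
interchange relation `x b = b₍₀₎ (x ◁ b₍₁₎)`. The `*`-structure is constructed below. -/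
def FullDouble : Type _ := RingQuot D.DoubleRel

noncomputable instance : Ring D.FullDouble := inferInstanceAs (Ring (RingQuot D.DoubleRel))

noncomputable instance : Algebra ℂ D.FullDouble :=
  inferInstanceAs (Algebra ℂ (RingQuot D.DoubleRel))

/-- The quotient map from the free algebra. -/
noncomputable def toFullDouble : D.FreeDouble →ₐ[ℂ] D.FullDouble :=
  RingQuot.mkAlgHom ℂ D.DoubleRel

theorem toFullDouble_surjective : Function.Surjective D.toFullDouble :=
  RingQuot.mkAlgHom_surjective ℂ D.DoubleRel

theorem toFullDouble_rel {s t : D.FreeDouble} (h : D.DoubleRel s t) :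
    D.toFullDouble s = D.toFullDouble t :=
  RingQuot.mkAlgHom_rel ℂ h

/-- The canonical unital homomorphism `B → 𝒟(B, 𝓘_full)`. -/
noncomputable def ofB : D.B →ₐ[ℂ] D.FullDouble :=
  AlgHom.ofLinearMap
    { toFun := fun b => D.toFullDouble (D.genB b)
      map_add' := fun b b' => by rw [D.toFullDouble_rel (.B_add b b'), map_add]
      map_smul' := fun r b => by rw [D.toFullDouble_rel (.B_smul r b), map_smul]; rfl }
    (by simpa using D.toFullDouble_rel .B_one)
    (fun b b' => by simpa using D.toFullDouble_rel (.B_mul b b'))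

/-- The canonical unital homomorphism `𝓘_full → 𝒟(B, 𝓘_full)`. -/
noncomputable def ofI : FullDual C →ₐ[ℂ] D.FullDouble :=
  AlgHom.ofLinearMap
    { toFun := fun x => D.toFullDouble (D.genI x)
      map_add' := fun x y => by rw [D.toFullDouble_rel (.I_add x y), map_add]
      map_smul' := fun r x => by rw [D.toFullDouble_rel (.I_smul r x), map_smul]; rfl }
    (by simpa using D.toFullDouble_rel .I_one)
    (fun x y => by simpa using D.toFullDouble_rel (.I_mul x y))

theorem toFullDouble_genB (b : D.B) : D.toFullDouble (D.genB b) = D.ofB b := rfl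

theorem toFullDouble_genI (x : FullDual C) : D.toFullDouble (D.genI x) = D.ofI x := rfl

theorem ofI_mul_ofB (x : FullDual C) (b : D.B) (n : ℕ) (b₀ : Fin n → D.B) (b₁ : Fin n → A)
    (h : D.coactB b = ∑ i, b₀ i ⊗ₜ[ℂ] b₁ i) :
    D.ofI x * D.ofB b = ∑ i, D.ofB (b₀ i) * D.ofI (rightAct x (b₁ i)) := by
  simpa [toFullDouble_genB, toFullDouble_genI] using
    D.toFullDouble_rel (.interchange x b n b₀ b₁ h)

theorem ofB_star_mul_ofI_star (x : FullDual C) (b : D.B) (n : ℕ) (b₀ : Fin n → D.B)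
    (b₁ : Fin n → A) (h : D.coactB b = ∑ i, b₀ i ⊗ₜ[ℂ] b₁ i) :
    D.ofB (star b) * D.ofI (star x) =
      ∑ i, D.ofI (star (rightAct x (b₁ i))) * D.ofB (star (b₀ i)) := by
  simpa [toFullDouble_genB, toFullDouble_genI] using
    D.toFullDouble_rel (.interchange_star x b n b₀ b₁ h)

/-- The opposite algebra of `𝒟(B, 𝓘_full)` with the conjugate complex structure. -/
def ConjOp : Type _ := D.FullDoubleᵐᵒᵖ

noncomputable instance : Ring D.ConjOp := inferInstanceAs (Ring D.FullDoubleᵐᵒᵖ)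

noncomputable instance : Algebra ℂ D.ConjOp :=
  RingHom.toAlgebra' (R := ℂ) (S := D.FullDoubleᵐᵒᵖ)
    ((algebraMap ℂ D.FullDoubleᵐᵒᵖ).comp (starRingEnd ℂ)) fun r x =>
      Algebra.commutes (A := D.FullDoubleᵐᵒᵖ) (starRingEnd ℂ r) x

/-- The identity map from `𝒟(B, 𝓘_full)` to its conjugate opposite. -/
noncomputable def toConjOp : D.FullDouble ≃+ D.ConjOp := MulOpposite.opAddEquiv

theorem toConjOp_mul (s t : D.FullDouble) :
    D.toConjOp (s * t) = D.toConjOp t * D.toConjOp s := rfl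

theorem toConjOp_one : D.toConjOp 1 = 1 := rfl

theorem toConjOp_smul (r : ℂ) (s : D.FullDouble) :
    D.toConjOp (star r • s) = r • D.toConjOp s := by
  rw [Algebra.smul_def, Algebra.smul_def, toConjOp_mul]
  exact (Algebra.commutes (A := D.ConjOp) r (D.toConjOp s)).symm

/-- The unique unital homomorphism from the free algebra to the conjugate opposite of
`𝒟(B, 𝓘_full)` sending `b` to `b^*` and `x` to `x^*`. -/
noncomputable def starFree : D.FreeDouble →ₐ[ℂ] D.ConjOp :=
  FreeAlgebra.lift ℂ (Sum.elim (fun b => D.toConjOp (D.ofB (star b)))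
    (fun x => D.toConjOp (D.ofI (star x))))

theorem starFree_genB (b : D.B) : D.starFree (D.genB b) = D.toConjOp (D.ofB (star b)) := by
  simp [starFree, genB]

theorem starFree_genI (x : FullDual C) :
    D.starFree (D.genI x) = D.toConjOp (D.ofI (star x)) := by
  simp [starFree, genI]

theorem starFree_rel {s t : D.FreeDouble} (h : D.DoubleRel s t) :
    D.starFree s = D.starFree t := by
  induction h with
  | B_add b b' => simp [starFree_genB]
  | B_smul r b =>
    rw [map_smul, starFree_genB, starFree_genB, ← toConjOp_smul, star_smul, map_smul]
  | B_mul b b' => simp [starFree_genB, toConjOp_mul]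
  | B_one => simp [starFree_genB, toConjOp_one]
  | I_add x y => simp [starFree_genI]
  | I_smul r x =>
    rw [map_smul, starFree_genI, starFree_genI, ← toConjOp_smul, star_smul, map_smul]
  | I_mul x y => rw [map_mul, starFree_genI, starFree_genI, starFree_genI, star_mul, map_mul,
      toConjOp_mul]
  | I_one => simp [starFree_genI, toConjOp_one]
  | interchange x b n b₀ b₁ h =>
    simp only [map_mul, map_sum, starFree_genB, starFree_genI, ← toConjOp_mul]
    rw [D.ofB_star_mul_ofI_star x b n b₀ b₁ h, map_sum]
  | interchange_star x b n b₀ b₁ h =>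
    simp only [map_mul, map_sum, starFree_genB, starFree_genI, ← toConjOp_mul, star_star]
    rw [D.ofI_mul_ofB x b n b₀ b₁ h, map_sum]

/-- The involution of `𝒟(B, 𝓘_full)`, as a homomorphism to the conjugate opposite. -/
noncomputable def starHom : D.FullDouble →ₐ[ℂ] D.ConjOp :=
  RingQuot.liftAlgHom ℂ ⟨D.starFree, fun _ _ h => D.starFree_rel h⟩

theorem starHom_toFullDouble (s : D.FreeDouble) :
    D.starHom (D.toFullDouble s) = D.starFree s :=
  RingQuot.liftAlgHom_mkAlgHom_apply ℂ _ _ _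

noncomputable instance : Star D.FullDouble := ⟨fun s => D.toConjOp.symm (D.starHom s)⟩

theorem star_def (s : D.FullDouble) : star s = D.toConjOp.symm (D.starHom s) := rfl

@[simp] theorem star_ofB (b : D.B) : star (D.ofB b) = D.ofB (star b) := by
  rw [star_def, ← toFullDouble_genB, starHom_toFullDouble, starFree_genB,
    AddEquiv.symm_apply_apply]

@[simp] theorem star_ofI (x : FullDual C) : star (D.ofI x) = D.ofI (star x) := by
  rw [star_def, ← toFullDouble_genI, starHom_toFullDouble, starFree_genI,
    AddEquiv.symm_apply_apply]

theorem fullDouble_star_mul (s t : D.FullDouble) : star (s * t) = star t * star s := by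
  apply D.toConjOp.injective
  rw [toConjOp_mul]
  simp [star_def]

theorem fullDouble_star_add (s t : D.FullDouble) : star (s + t) = star s + star t := by
  simp [star_def]

theorem fullDouble_star_smul (r : ℂ) (s : D.FullDouble) : star (r • s) = star r • star s := by
  apply D.toConjOp.injective
  have := D.toConjOp_smul r (star s)
  rw [this]
  simp [star_def]

theorem fullDouble_star_star (s : D.FullDouble) : star (star s) = s := by
  obtain ⟨s, rfl⟩ := D.toFullDouble_surjective s
  induction s using FreeAlgebra.induction with
  | grade0 r =>
    have h1 : star (1 : D.FullDouble) = 1 := by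
      apply D.toConjOp.injective
      simp [star_def, toConjOp_one]
    rw [Algebra.algebraMap_eq_smul_one, map_smul, map_one, fullDouble_star_smul,
      fullDouble_star_smul, h1, h1, star_star]
  | grade1 x =>
    rcases x with b | x
    · change star (star (D.ofB b)) = D.ofB b
      simp
    · change star (star (D.ofI x)) = D.ofI x
      simp
  | mul s t hs ht => rw [map_mul, fullDouble_star_mul, fullDouble_star_mul, hs, ht]
  | add s t hs ht => rw [map_add, fullDouble_star_add, fullDouble_star_add, hs, ht]

noncomputable instance : StarRing D.FullDouble where
  star_involutive := D.fullDouble_star_star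
  star_mul := D.fullDouble_star_mul
  star_add := D.fullDouble_star_add

instance : StarModule ℂ D.FullDouble := ⟨D.fullDouble_star_smul⟩

/-- The linear span `B 𝓘` of the products `b x` in `𝒟(B, 𝓘_full)`, `b ∈ B`, `x ∈ 𝓘`. -/
noncomputable def spanBI : Submodule ℂ D.FullDouble :=
  Submodule.span ℂ {d | ∃ b : D.B, ∃ x ∈ restrictedDual C, d = D.ofB b * D.ofI x}

theorem ofB_mul_ofI_mem (b : D.B) {x : FullDual C} (hx : x ∈ restrictedDual C) :
    D.ofB b * D.ofI x ∈ D.spanBI :=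
  Submodule.subset_span ⟨b, x, hx, rfl⟩

theorem exists_coactB_eq_sum (b : D.B) : ∃ (n : ℕ) (b₀ : Fin n → D.B) (b₁ : Fin n → A),
    D.coactB b = ∑ i, b₀ i ⊗ₜ[ℂ] b₁ i := by
  obtain ⟨S, hS⟩ := TensorProduct.exists_finset (D.coactB b)
  refine ⟨S.card, fun i => (S.equivFin.symm i).1.1, fun i => (S.equivFin.symm i).1.2, ?_⟩
  rw [hS, ← Finset.sum_coe_sort]
  exact (Equiv.sum_comp S.equivFin.symm (fun i : S => i.1.1 ⊗ₜ[ℂ] i.1.2)).symm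

theorem ofI_mul_ofB_mem {x : FullDual C} (hx : x ∈ restrictedDual C) (b : D.B) :
    D.ofI x * D.ofB b ∈ D.spanBI := by
  obtain ⟨n, b₀, b₁, h⟩ := D.exists_coactB_eq_sum b
  rw [D.ofI_mul_ofB x b n b₀ b₁ h]
  exact Submodule.sum_mem _ fun i _ => D.ofB_mul_ofI_mem _ (rightAct_mem_restrictedDual hx _)

theorem ofB_mul_mem (b : D.B) {d : D.FullDouble} (hd : d ∈ D.spanBI) : D.ofB b * d ∈ D.spanBI := by
  induction hd using Submodule.span_induction with
  | mem d h =>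
    obtain ⟨b', x, hx, rfl⟩ := h
    rw [← mul_assoc, ← map_mul]
    exact D.ofB_mul_ofI_mem _ hx
  | zero => simp
  | add d d' _ _ h h' => rw [mul_add]; exact add_mem h h'
  | smul r d _ h => rw [mul_smul_comm]; exact Submodule.smul_mem _ r h

theorem mul_ofI_mem {x : FullDual C} (hx : x ∈ restrictedDual C) {d : D.FullDouble}
    (hd : d ∈ D.spanBI) : d * D.ofI x ∈ D.spanBI := by
  induction hd using Submodule.span_induction with
  | mem d h =>
    obtain ⟨b', x', hx', rfl⟩ := h
    rw [mul_assoc, ← map_mul]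
    exact D.ofB_mul_ofI_mem _ (mul_mem hx' hx)
  | zero => simp
  | add d d' _ _ h h' => rw [add_mul]; exact add_mem h h'
  | smul r d _ h => rw [smul_mul_assoc]; exact Submodule.smul_mem _ r h

theorem spanBI_mul_mem {d d' : D.FullDouble} (hd : d ∈ D.spanBI) (hd' : d' ∈ D.spanBI) :
    d * d' ∈ D.spanBI := by
  induction hd using Submodule.span_induction with
  | mem d h =>
    obtain ⟨b, x, hx, rfl⟩ := h
    induction hd' using Submodule.span_induction with
    | mem d' h' =>
      obtain ⟨b', x', hx', rfl⟩ := h'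
      rw [mul_assoc, ← mul_assoc (D.ofI x)]
      exact D.ofB_mul_mem b (D.mul_ofI_mem hx' (D.ofI_mul_ofB_mem hx b'))
    | zero => simp
    | add d d' _ _ h h' => rw [mul_add]; exact add_mem h h'
    | smul r d _ h => rw [mul_smul_comm]; exact Submodule.smul_mem _ r h
  | zero => simp
  | add d d' _ _ h h' => rw [add_mul]; exact add_mem h h'
  | smul r d _ h => rw [smul_mul_assoc]; exact Submodule.smul_mem _ r h

theorem spanBI_star_mem {d : D.FullDouble} (hd : d ∈ D.spanBI) : star d ∈ D.spanBI := by
  induction hd using Submodule.span_induction with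
  | mem d h =>
    obtain ⟨b, x, hx, rfl⟩ := h
    rw [star_mul, star_ofB, star_ofI]
    exact D.ofI_mul_ofB_mem (star_mem hx) _
  | zero => simp
  | add d d' _ _ h h' => rw [star_add]; exact add_mem h h'
  | smul r d _ h => rw [star_smul]; exact Submodule.smul_mem _ _ h

/-- The Drinfeld double `𝓓(B, 𝓘) = B 𝓘`, as a `*`-subalgebra of `𝒟(B, 𝓘_full)`. -/
noncomputable def double : NonUnitalStarSubalgebra ℂ D.FullDouble where
  carrier := D.spanBI
  add_mem' := add_mem
  zero_mem' := zero_mem _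
  mul_mem' := D.spanBI_mul_mem
  smul_mem' r _ h := Submodule.smul_mem _ r h
  star_mem' := D.spanBI_star_mem

/-- The element `b x` of `𝓓(B, 𝓘)`, for `b ∈ B` and `x ∈ 𝓘`. -/
noncomputable def mulBI (b : D.B) (x : restrictedDual C) : D.double :=
  ⟨D.ofB b * D.ofI x, D.ofB_mul_ofI_mem b x.2⟩

/-- The element `x ∈ 𝓘`, seen in `𝓓(B, 𝓘)`. -/
noncomputable def inclI (x : restrictedDual C) : D.double :=
  ⟨D.ofI x, by simpa using! D.ofB_mul_ofI_mem 1 x.2⟩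

end CQGCoidealDatum

/-! ### Unitary Doi–Koppinen modules -/

/-- A subcoalgebra of `C`: a subspace `E` with `Δ(E) ⊆ E ⊗ E`. -/
def IsSubcoalgebra {C : Type*} [AddCommGroup C] [Module ℂ C] [Coalgebra ℂ C]
    (E : Submodule ℂ C) : Prop :=
  ∀ c ∈ E, comul (R := ℂ) c ∈ LinearMap.range (TensorProduct.map E.subtype E.subtype)

section Modules

variable {A C : Type*} [Ring A] [HopfAlgebra ℂ A] [StarRing A] [StarModule ℂ A]
  [CQGHopfStarAlgebra A]
  [AddCommGroup C] [Module ℂ C] [Coalgebra ℂ C] [StarAddMonoid C] [StarModule ℂ C]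
  [DagCoalgebra C] [Module A C] [IsScalarTower ℂ A C] [ModuleDagCoalgebra A C]

/-- The element `⟨v, t₍₀₎⟩ t₍₁₎` of `C`, for `v ∈ V` and `t = t₍₀₎ ⊗ t₍₁₎ ∈ V ⊗ C`. -/
noncomputable def innerContract {V C : Type*} [NormedAddCommGroup V] [InnerProductSpace ℂ V]
    [AddCommGroup C] [Module ℂ C] (v : V) : V ⊗[ℂ] C →ₗ[ℂ] C :=
  (TensorProduct.lid ℂ C).toLinearMap ∘ₗ (innerₛₗ ℂ v).rTensor C

/-- The structure of a unitary Doi–Koppinen module for the datum `D` on a pre-Hilbert space `V`.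
The inner product is antilinear in the first variable. -/
@[ext]
structure UnitaryDKModule (D : CQGCoidealDatum A C) (V : Type*) [NormedAddCommGroup V]
    [InnerProductSpace ℂ V] where
  /-- the right coaction `δ(v) = v₍₀₎ ⊗ v₍₁₎` of `C` -/
  coact : V →ₗ[ℂ] V ⊗[ℂ] C
  coassoc : ∀ v, TensorProduct.assoc ℂ V C C (coact.rTensor C (coact v)) =
    (comul (R := ℂ) (A := C)).lTensor V (coact v)
  counital : ∀ v, TensorProduct.rid ℂ V ((counit (R := ℂ) (A := C)).lTensor V (coact v)) = v
  /-- the unital left `B`-module structure -/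
  act : D.B →ₐ[ℂ] Module.End ℂ V
  /-- `δ(b v) = (π ⊗ id)(δ_B(b)) δ(v)` -/
  coact_act : ∀ b v, coact (act b v) =
    TensorProduct.map₂ act.toLinearMap (moduleMap A C) (D.coactB b) (coact v)
  /-- `B` acts by a `*`-representation -/
  inner_act : ∀ b v w, inner ℂ v (act b w) = inner ℂ (act (star b) v) w
  /-- the coaction is unitary: `⟨v, w₍₀₎⟩ w₍₁₎ = ⟨v₍₀₎, w⟩ v₍₁₎^†`. Since `†` is antilinear, the right
  hand side is `(⟨w, v₍₀₎⟩ v₍₁₎)^†`. -/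
  unitary : ∀ v w, innerContract v (coact w) = star (innerContract w (coact v))

namespace UnitaryDKModule

variable {D : CQGCoidealDatum A C} {V : Type*} [NormedAddCommGroup V] [InnerProductSpace ℂ V]
  (M : UnitaryDKModule D V)

/-- The action `π̂₀(x) v = (id ⊗ x) δ(v)` of the full dual of `C`. -/
noncomputable def dualAct (x : FullDual C) : V →ₗ[ℂ] V :=
  (TensorProduct.rid ℂ V).toLinearMap ∘ₗ x.ofConv.lTensor V ∘ₗ M.coact

/-- `M` is locally complete: for every finite-dimensional subcoalgebra `E` of `C`, the space
`{v ∣ δ(v) ∈ V ⊗ E}` is complete. -/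
def IsLocallyComplete : Prop :=
  ∀ E : Submodule ℂ C, FiniteDimensional ℂ E → IsSubcoalgebra E →
    IsComplete {v : V | M.coact v ∈ LinearMap.range (E.subtype.lTensor V)}

/-- Let `ι : V → H` be an isometric embedding of `V` in a Hilbert space `H` (in the applications
with dense range, so that `H` is the completion of `V`). `M.Integrates ι ρ` says that the actions
of `B` and of `𝓘` on `V` extend to `*`-representations `π` and `π̂` by bounded operators on `H`, and
that `ρ(b x) = π(b) π̂(x)` for all `b ∈ B`, `x ∈ 𝓘`. -/
def Integrates {H : Type*} [NormedAddCommGroup H] [InnerProductSpace ℂ H] [CompleteSpace H]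
    (ι : V →ₗᵢ[ℂ] H) (ρ : D.double →⋆ₙₐ[ℂ] (H →L[ℂ] H)) : Prop :=
  ∃ (π : D.B →⋆ₐ[ℂ] (H →L[ℂ] H)) (πhat : restrictedDual C →⋆ₙₐ[ℂ] (H →L[ℂ] H)),
    (∀ b v, π b (ι v) = ι (M.act b v)) ∧
    (∀ x v, πhat x (ι v) = ι (M.dualAct (x : FullDual C) v)) ∧
    ∀ b x, ρ (D.mulBI b x) = π b * πhat x

/-- A unitary intertwiner between two unitary Doi–Koppinen modules. -/
def IsUnitaryIntertwiner {V' : Type*} [NormedAddCommGroup V'] [InnerProductSpace ℂ V']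
    (M' : UnitaryDKModule D V') (T : V ≃ₗᵢ[ℂ] V') : Prop :=
  (∀ b v, T (M.act b v) = M'.act b (T v)) ∧
    ∀ v, T.toLinearEquiv.toLinearMap.rTensor C (M.coact v) = M'.coact (T v)

end UnitaryDKModule

/-- A locally complete unitary Doi–Koppinen module whose underlying pre-Hilbert space is a dense
subspace of the Hilbert space `H`; in other words, a locally complete unitary Doi–Koppinen module
together with an identification of its completion with `H`. -/
structure DenseLCModule (D : CQGCoidealDatum A C) (H : Type*) [NormedAddCommGroup H]
    [InnerProductSpace ℂ H] where
  space : Submodule ℂ H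
  dense_space : Dense (space : Set H)
  dkModule : UnitaryDKModule D space
  isLocallyComplete : dkModule.IsLocallyComplete

namespace CQGCoidealDatum

variable (D : CQGCoidealDatum A C) {H : Type*} [NormedAddCommGroup H] [InnerProductSpace ℂ H]
  [CompleteSpace H]

/-- A `*`-representation `ρ` of `𝓓(B, 𝓘)` on `H` is non-degenerate if `ρ(𝓓(B, 𝓘)) H` is dense. -/
def IsNondegenerate (ρ : D.double →⋆ₙₐ[ℂ] (H →L[ℂ] H)) : Prop :=
  Dense (Submodule.span ℂ {h : H | ∃ d k, h = ρ d k} : Set H)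

/-- The subspace `ρ(𝓘) H` of `H`, the linear span of the vectors `ρ(x) k`, `x ∈ 𝓘`, `k ∈ H`. -/
noncomputable def regularSpace (ρ : D.double →⋆ₙₐ[ℂ] (H →L[ℂ] H)) : Submodule ℂ H :=
  Submodule.span ℂ {h : H | ∃ (x : restrictedDual C) (k : H), h = ρ (D.inclI x) k}

end CQGCoidealDatum

end Modules

/-! A right `C`-comodule is the same as a module over the full dual whose action is "rational", i.e.
given by slicing a tensor in `V ⊗ C`. Under this dictionary coassociativity becomes
multiplicativity, unitarity of the coaction becomes the `*`-property, and compatibility with `B`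
becomes the interchange relation. A unitary Doi–Koppinen module is therefore a rational
`*`-representation of the full double on a pre-Hilbert space, and the theorem compares these with
bounded representations of the ideal `B𝓘`.

From modules to representations, boundedness is needed. For `b ∈ B`, the slices of `Δ(b)` span a
finite-dimensional right coideal; for an orthonormal basis `w_j` with respect to the invariant
state, `∑ w_j w_j^*` is a scalar, so the `w_j^*`, and hence `B`, act boundedly
(`sum_mul_star_eq_smul_one`, `exists_bound_act`). For `x ∈ 𝓘`, the element `x^* x` is algebraic and
acts symmetrically and locally finitely, so its eigenvalues lie among the roots of one polynomial
(`exists_bound_of_mem_restrictedDual`). Everything then extends to the completion.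

The second ingredient is that `𝓘` has local units: some `e ∈ 𝓘` agrees with `ε` on any given
finite-dimensional subspace of `C` (`exists_local_unit`). Such an `e` comes from splitting a
finite-dimensional subcoalgebra off `C`, by orthogonal projection in `A` for the invariant state.
Local units give nondegeneracy, and they allow the `B`-action and the coaction to be recovered from
the operators of `B𝓘`.

Conversely, `B𝓘` is a two-sided ideal of the full double, so a nondegenerate representation extends
to an action of the full double on `ρ(B𝓘)H`. The relation `B𝓘 = 𝓘B` identifies this space with
`ρ(𝓘)H`, and the finite rank of `c ↦ c₍₁₎ x(c₍₂₎)` for `x ∈ 𝓘` makes the action of the dual rational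
(`exists_dkModule_integrates`).

Finally, `ρ(x)` with `x ∈ 𝓘` maps `V` into the spectral subspace of one finite-dimensional
subcoalgebra. If that subspace is complete, it is closed in `H` and contains `ρ(x)H`. Thus local
completeness means exactly `V = ρ(𝓘)H`, which makes the two constructions mutually inverse. -/

/-! ### Slices of tensors -/

section Slices

variable {M N M' N' : Type*} [AddCommGroup M] [Module ℂ M] [AddCommGroup N] [Module ℂ N]
  [AddCommGroup M'] [Module ℂ M'] [AddCommGroup N'] [Module ℂ N']

/-- The slice map `m ⊗ n ↦ f(n) m`. -/
noncomputable def sliceR (f : N →ₗ[ℂ] ℂ) : M ⊗[ℂ] N →ₗ[ℂ] M :=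
  (TensorProduct.rid ℂ M).toLinearMap ∘ₗ f.lTensor M

/-- The slice map `m ⊗ n ↦ f(m) n`. -/
noncomputable def sliceL (f : M →ₗ[ℂ] ℂ) : M ⊗[ℂ] N →ₗ[ℂ] N :=
  (TensorProduct.lid ℂ N).toLinearMap ∘ₗ f.rTensor N

@[simp] theorem sliceR_tmul (f : N →ₗ[ℂ] ℂ) (m : M) (n : N) : sliceR f (m ⊗ₜ[ℂ] n) = f n • m := by
  simp [sliceR]

@[simp] theorem sliceL_tmul (f : M →ₗ[ℂ] ℂ) (m : M) (n : N) : sliceL f (m ⊗ₜ[ℂ] n) = f m • n := by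
  simp [sliceL]

theorem sliceR_add (f g : N →ₗ[ℂ] ℂ) (t : M ⊗[ℂ] N) :
    sliceR (f + g) t = sliceR f t + sliceR g t := by
  simp [sliceR, LinearMap.lTensor_add]

theorem sliceR_smul (r : ℂ) (f : N →ₗ[ℂ] ℂ) (t : M ⊗[ℂ] N) :
    sliceR (r • f) t = r • sliceR f t := by
  simp [sliceR, LinearMap.lTensor_smul]

theorem sliceR_map (p : M →ₗ[ℂ] M') (q : N →ₗ[ℂ] N') (f : N' →ₗ[ℂ] ℂ) (t : M ⊗[ℂ] N) :
    sliceR f (TensorProduct.map p q t) = p (sliceR (f ∘ₗ q) t) := by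
  induction t with
  | zero => simp
  | add s t hs ht => simp only [map_add, hs, ht]
  | tmul m n => simp

theorem sliceL_map (p : M →ₗ[ℂ] M') (q : N →ₗ[ℂ] N') (f : M' →ₗ[ℂ] ℂ) (t : M ⊗[ℂ] N) :
    sliceL f (TensorProduct.map p q t) = q (sliceL (f ∘ₗ p) t) := by
  induction t with
  | zero => simp
  | add s t hs ht => simp only [map_add, hs, ht]
  | tmul m n => simp

theorem sliceR_comm (f : M →ₗ[ℂ] ℂ) (t : M ⊗[ℂ] N) :
    sliceR f (TensorProduct.comm ℂ M N t) = sliceL f t := by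
  induction t with
  | zero => simp
  | add s t hs ht => simp only [map_add, hs, ht]
  | tmul m n => simp

theorem sliceL_sliceR (f : M →ₗ[ℂ] ℂ) (g : N →ₗ[ℂ] ℂ) (t : M ⊗[ℂ] N) :
    g (sliceL f t) = f (sliceR g t) := by
  induction t with
  | zero => simp
  | add s t hs ht => simp only [map_add, hs, ht]
  | tmul m n => simp [mul_comm]

/-- Slicing with the coordinate functionals of a basis of `N` gives the coefficients of a tensor.
All later identities in `V ⊗ C` are checked through this criterion. -/
theorem ext_sliceR {s t : M ⊗[ℂ] N} (h : ∀ f : N →ₗ[ℂ] ℂ, sliceR f s = sliceR f t) : s = t := by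
  classical
  apply (TensorProduct.equivFinsuppOfBasisRight (M := M) (Module.Basis.ofVectorSpace ℂ N)).injective
  ext i
  rw [TensorProduct.equivFinsuppOfBasisRight_apply, TensorProduct.equivFinsuppOfBasisRight_apply]
  exact h _

theorem mem_range_rTensor_of_sliceR {U : Submodule ℂ M} {t : M ⊗[ℂ] N}
    (h : ∀ f : N →ₗ[ℂ] ℂ, sliceR f t ∈ U) : t ∈ LinearMap.range (U.subtype.rTensor N) := by
  classical
  let b := Module.Basis.ofVectorSpace ℂ N
  let e := TensorProduct.equivFinsuppOfBasisRight (M := M) b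
  rw [← e.symm_apply_apply t, TensorProduct.equivFinsuppOfBasisRight_symm_apply]
  refine Submodule.sum_mem _ fun i _ => ?_
  refine ⟨⟨e t i, ?_⟩ ⊗ₜ b i, by simp⟩
  rw [TensorProduct.equivFinsuppOfBasisRight_apply]
  exact h _

theorem mem_range_lTensor_of_sliceL {U : Submodule ℂ N} {t : M ⊗[ℂ] N}
    (h : ∀ f : M →ₗ[ℂ] ℂ, sliceL f t ∈ U) : t ∈ LinearMap.range (U.subtype.lTensor M) := by
  obtain ⟨s, hs⟩ := mem_range_rTensor_of_sliceR (U := U) (t := TensorProduct.comm ℂ M N t)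
    fun f => by rw [sliceR_comm]; exact h f
  refine ⟨TensorProduct.comm ℂ U M s, ?_⟩
  apply (TensorProduct.comm ℂ M N).injective
  rw [← hs]
  exact (LinearMap.congr_fun (LinearMap.comm_comp_lTensor_comp_comm_eq (Q := M) U.subtype)
    s)

theorem mem_range_map_of_slices {U : Submodule ℂ M} {W : Submodule ℂ N} {t : M ⊗[ℂ] N}
    (h : ∀ f : N →ₗ[ℂ] ℂ, sliceR f t ∈ U) (h' : ∀ f : M →ₗ[ℂ] ℂ, sliceL f t ∈ W) :
    t ∈ LinearMap.range (TensorProduct.map U.subtype W.subtype) := by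
  obtain ⟨s, rfl⟩ := mem_range_rTensor_of_sliceR h
  obtain ⟨r, rfl⟩ := mem_range_lTensor_of_sliceL (U := W) (t := s) fun f => by
    obtain ⟨g, rfl⟩ := LinearMap.exists_extend f
    have := h' g
    rwa [LinearMap.rTensor, sliceL_map] at this
  exact ⟨r, by rw [← LinearMap.rTensor_comp_lTensor]; rfl⟩

/-- A tensor lies in `M ⊗ U` if it is killed by all functionals vanishing on `U`. -/
theorem mem_range_lTensor_of_sliceR_eq_zero {U : Submodule ℂ N} {t : M ⊗[ℂ] N}
    (h : ∀ f : N →ₗ[ℂ] ℂ, (∀ n ∈ U, f n = 0) → sliceR f t = 0) :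
    t ∈ LinearMap.range (U.subtype.lTensor M) := by
  refine mem_range_lTensor_of_sliceL fun f => ?_
  by_contra hn
  -- If a left slice were outside `U`, a functional `g` vanishing on `U` would detect it; exchanging
  -- the order of slicing contradicts the vanishing of the right slice along `g`.
  obtain ⟨g, hg, hU⟩ := Submodule.exists_le_ker_of_notMem hn
  exact hg (by rw [sliceL_sliceR, h g fun n hn => hU hn, map_zero])

theorem sliceR_lTensor_subtype {U : Submodule ℂ N} {t : M ⊗[ℂ] N}
    (ht : t ∈ LinearMap.range (U.subtype.lTensor M)) {f g : N →ₗ[ℂ] ℂ}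
    (h : ∀ n ∈ U, f n = g n) : sliceR f t = sliceR g t := by
  obtain ⟨s, rfl⟩ := ht
  rw [LinearMap.lTensor, sliceR_map, sliceR_map]
  have hfg : f ∘ₗ U.subtype = g ∘ₗ U.subtype := by
    ext n
    exact h n n.2
  rw [hfg]

/-- All slices of a tensor lie in a common finite-dimensional subspace. -/
theorem finiteDimensional_range_sliceR (t : M ⊗[ℂ] N) :
    ∃ U : Submodule ℂ M, FiniteDimensional ℂ U ∧ ∀ f : N →ₗ[ℂ] ℂ, sliceR f t ∈ U := by
  obtain ⟨S, hS⟩ := TensorProduct.exists_finset t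
  classical
  refine ⟨Submodule.span ℂ (S.image Prod.fst), inferInstance, fun f => ?_⟩
  rw [hS, map_sum]
  refine Submodule.sum_mem _ fun i hi => ?_
  rw [sliceR_tmul]
  exact Submodule.smul_mem _ _ (Submodule.subset_span (Finset.mem_coe.2
    (Finset.mem_image_of_mem _ hi)))

theorem finiteDimensional_range_sliceL (t : M ⊗[ℂ] N) :
    ∃ U : Submodule ℂ N, FiniteDimensional ℂ U ∧ ∀ f : M →ₗ[ℂ] ℂ, sliceL f t ∈ U := by
  obtain ⟨U, hU, h⟩ := finiteDimensional_range_sliceR (TensorProduct.comm ℂ M N t)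
  exact ⟨U, hU, fun f => by rw [← sliceR_comm]; exact h f⟩

end Slices

/-! ### Comodules as modules over the full dual -/

section Comodules

variable {C V : Type*} [AddCommGroup C] [Module ℂ C] [Coalgebra ℂ C] [AddCommGroup V] [Module ℂ V]

theorem fullDual_mul_apply (x y : FullDual C) (c : C) :
    (x * y).ofConv c = LinearMap.mul' ℂ ℂ (TensorProduct.map x.ofConv y.ofConv (comul c)) := rfl

theorem fullDual_one_ofConv : (1 : FullDual C).ofConv = counit := by
  ext c
  change (1 : FullDual C) c = _
  rw [LinearMap.convOne_apply]
  rfl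

omit [Coalgebra ℂ C] in
theorem map_mul_eq_sliceR (x y : C →ₗ[ℂ] ℂ) (t : C ⊗[ℂ] C) :
    LinearMap.mul' ℂ ℂ (TensorProduct.map x y t) = x (sliceR y t) := by
  induction t with
  | zero => simp
  | add s t hs ht => simp only [map_add, hs, ht]
  | tmul m n => simp [mul_comm]

theorem fullDual_mul_apply' (x y : FullDual C) (c : C) :
    (x * y).ofConv c = x.ofConv (sliceR y.ofConv (comul c)) := by
  rw [fullDual_mul_apply, map_mul_eq_sliceR]

theorem fullDual_mul_apply'' (x y : FullDual C) (c : C) :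
    (x * y).ofConv c = y.ofConv (sliceL x.ofConv (comul c)) := by
  rw [fullDual_mul_apply', sliceL_sliceR]

/-- Coassociativity, evaluated at `x ⊗ y` on the two factors `C`, says that slicing is an action of
the convolution algebra. -/
theorem sliceR_coact_sliceR (δ : V →ₗ[ℂ] V ⊗[ℂ] C) {v : V}
    (h : TensorProduct.assoc ℂ V C C (δ.rTensor C (δ v)) = (comul (R := ℂ)).lTensor V (δ v))
    (x y : FullDual C) :
    sliceR x.ofConv (δ (sliceR y.ofConv (δ v))) = sliceR (x * y).ofConv (δ v) := by
  let F : V ⊗[ℂ] (C ⊗[ℂ] C) →ₗ[ℂ] V :=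
    sliceR (LinearMap.mul' ℂ ℂ ∘ₗ TensorProduct.map x.ofConv y.ofConv)
  have h1 : ∀ t : V ⊗[ℂ] C, F (TensorProduct.assoc ℂ V C C (δ.rTensor C t)) =
      sliceR x.ofConv (δ (sliceR y.ofConv t)) := by
    intro t
    induction t with
    | zero => simp
    | add s t hs ht => simp only [map_add, hs, ht]
    | tmul v c =>
      simp only [LinearMap.rTensor_tmul, sliceR_tmul, map_smul]
      induction δ v with
      | zero => simp
      | add s t hs ht => simp only [map_add, hs, ht, TensorProduct.add_tmul, smul_add]
      | tmul m n => simp [F, smul_smul, mul_comm]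
  rw [← h1, h, LinearMap.lTensor, sliceR_map]
  rfl

/-- Converse of `sliceR_coact_sliceR`: elements of `V ⊗ C ⊗ C` are separated by iterated slices, so
multiplicativity of the action forces coassociativity. -/
theorem coassoc_of_sliceR (δ : V →ₗ[ℂ] V ⊗[ℂ] C) {v : V}
    (h : ∀ x y : FullDual C,
      sliceR x.ofConv (δ (sliceR y.ofConv (δ v))) = sliceR (x * y).ofConv (δ v)) :
    TensorProduct.assoc ℂ V C C (δ.rTensor C (δ v)) = (comul (R := ℂ)).lTensor V (δ v) := by
  apply (TensorProduct.assoc ℂ V C C).symm.injective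
  rw [LinearEquiv.symm_apply_apply]
  refine ext_sliceR fun y => ext_sliceR fun x => ?_
  have h1 : ∀ t : V ⊗[ℂ] C, sliceR x (sliceR y (δ.rTensor C t)) = sliceR x (δ (sliceR y t)) := by
    intro t
    rw [LinearMap.rTensor, sliceR_map]
    rfl
  have h2 : ∀ t : V ⊗[ℂ] (C ⊗[ℂ] C), sliceR x (sliceR y ((TensorProduct.assoc ℂ V C C).symm t)) =
      sliceR (LinearMap.mul' ℂ ℂ ∘ₗ TensorProduct.map x y) t := by
    intro t
    induction t with
    | zero => simp
    | add s t hs ht => simp only [map_add, hs, ht]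
    | tmul v c =>
      induction c with
      | zero => simp
      | add s t hs ht => simp only [map_add, hs, ht, TensorProduct.tmul_add]
      | tmul m n => simp [smul_smul, mul_comm]
  rw [h1, h2, LinearMap.lTensor, sliceR_map]
  exact h (toConv x) (toConv y)

/-- The operator `c ↦ c₍₁₎ x(c₍₂₎)`. -/
noncomputable def actR (x : FullDual C) : C →ₗ[ℂ] C := sliceR x.ofConv ∘ₗ comul

/-- The operator `c ↦ x(c₍₁₎) c₍₂₎`. -/
noncomputable def actL (x : FullDual C) : C →ₗ[ℂ] C := sliceL x.ofConv ∘ₗ comul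

theorem actR_apply (x : FullDual C) (c : C) : actR x c = sliceR x.ofConv (comul c) := rfl

theorem ofConv_actR (x y : FullDual C) (c : C) : x.ofConv (actR y c) = (x * y).ofConv c :=
  (fullDual_mul_apply' x y c).symm

theorem ofConv_actL (x y : FullDual C) (c : C) : x.ofConv (actL y c) = (y * x).ofConv c :=
  (fullDual_mul_apply'' y x c).symm

omit [Coalgebra ℂ C] in
theorem ext_fullDual {c d : C} (h : ∀ x : FullDual C, x.ofConv c = x.ofConv d) : c = d :=
  sub_eq_zero.1 ((Module.forall_dual_apply_eq_zero_iff ℂ _).1 fun f => by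
    rw [map_sub, sub_eq_zero]
    exact h (toConv f))

/-- Functionals separate the points of `C`, so this and the next identities reduce to associativity
and the unit laws of convolution. -/
theorem actR_actR (x y : FullDual C) (c : C) : actR x (actR y c) = actR (x * y) c :=
  ext_fullDual fun z => by simp only [ofConv_actR, mul_assoc]

theorem actL_actL (x y : FullDual C) (c : C) : actL x (actL y c) = actL (y * x) c :=
  ext_fullDual fun z => by simp only [ofConv_actL, mul_assoc]

theorem actL_actR (x y : FullDual C) (c : C) : actL x (actR y c) = actR y (actL x c) :=
  ext_fullDual fun z => by simp only [ofConv_actL, ofConv_actR, mul_assoc]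

theorem actR_one (c : C) : actR 1 c = c :=
  ext_fullDual fun z => by simp only [ofConv_actR, mul_one]

theorem actL_one (c : C) : actL 1 c = c :=
  ext_fullDual fun z => by simp only [ofConv_actL, one_mul]

theorem isSubcoalgebra_of_actR_of_actL {E : Submodule ℂ C}
    (hR : ∀ (x : FullDual C), ∀ c ∈ E, actR x c ∈ E)
    (hL : ∀ (x : FullDual C), ∀ c ∈ E, actL x c ∈ E) : IsSubcoalgebra E := fun c hc =>
  mem_range_map_of_slices (fun f => hR (toConv f) c hc) fun f => hL (toConv f) c hc

/-- Every finite-dimensional subspace of a coalgebra lies in a finite-dimensional subspace that is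
stable under both actions of the dual. -/
theorem exists_finiteDimensional_stable (W : Submodule ℂ C) [FiniteDimensional ℂ W] :
    ∃ E : Submodule ℂ C, FiniteDimensional ℂ E ∧ W ≤ E ∧
      (∀ (x : FullDual C), ∀ c ∈ E, actR x c ∈ E) ∧ ∀ (x : FullDual C), ∀ c ∈ E, actL x c ∈ E := by
  -- The orbit of a finite-dimensional space is controlled by the orbits of finitely many
  -- generators, each of which lies in a fixed finite-dimensional space because a tensor has only
  -- finitely many terms.
  have key : ∀ (T : FullDual C → C →ₗ[ℂ] C), (∀ c, ∃ U : Submodule ℂ C, FiniteDimensional ℂ U ∧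
      ∀ x, T x c ∈ U) → ∀ W : Submodule ℂ C, FiniteDimensional ℂ W →
      FiniteDimensional ℂ (Submodule.span ℂ {d | ∃ x, ∃ c ∈ W, d = T x c}) := by
    intro T hT W hW
    obtain ⟨s, hs⟩ := (Submodule.fg_iff_finiteDimensional W).2 hW
    choose U hU hTU using hT
    have : Submodule.span ℂ {d | ∃ x, ∃ c ∈ W, d = T x c} ≤ s.sup U := by
      refine Submodule.span_le.2 ?_
      rintro _ ⟨x, c, hc, rfl⟩
      rw [← hs] at hc
      have : Submodule.span ℂ (s : Set C) ≤ (s.sup U).comap (T x) :=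
        Submodule.span_le.2 fun d hd => Finset.le_sup (f := U) hd (hTU d x)
      exact this hc
    have : FiniteDimensional ℂ (s.sup U : Submodule ℂ C) := inferInstance
    exact Submodule.finiteDimensional_of_le ‹_ ≤ _›
  let W₁ : Submodule ℂ C := Submodule.span ℂ {d | ∃ x, ∃ c ∈ W, d = actR x c}
  have hW₁ : FiniteDimensional ℂ W₁ := key actR (fun c => by
    obtain ⟨U, hU, h⟩ := finiteDimensional_range_sliceR (comul (R := ℂ) c)
    exact ⟨U, hU, fun x => h _⟩) W inferInstance
  -- Saturating `W₁` under the second action does not destroy stability under the first, because the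
  -- two actions commute.
  let W₂ : Submodule ℂ C := Submodule.span ℂ {d | ∃ x, ∃ c ∈ W₁, d = actL x c}
  have hW₂ : FiniteDimensional ℂ W₂ := key actL (fun c => by
    obtain ⟨U, hU, h⟩ := finiteDimensional_range_sliceL (comul (R := ℂ) c)
    exact ⟨U, hU, fun x => h _⟩) W₁ hW₁
  have h1 : ∀ (x : FullDual C), ∀ c ∈ W₁, actR x c ∈ W₁ := fun x c hc => by
    have : W₁ ≤ W₁.comap (actR x) := Submodule.span_le.2 (by
      rintro _ ⟨y, d, hd, rfl⟩
      exact Submodule.subset_span ⟨x * y, d, hd, actR_actR _ _ _⟩)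
    exact this hc
  refine ⟨W₂, hW₂, fun c hc => Submodule.subset_span ⟨1, c, Submodule.subset_span
    ⟨1, c, hc, (actR_one c).symm⟩, (actL_one c).symm⟩, fun x c hc => ?_, fun x c hc => ?_⟩
  · have : W₂ ≤ W₂.comap (actR x) := Submodule.span_le.2 (by
      rintro _ ⟨y, d, hd, rfl⟩
      exact Submodule.subset_span ⟨y, actR x d, h1 x d hd, (actL_actR _ _ _).symm⟩)
    exact this hc
  · have : W₂ ≤ W₂.comap (actL x) := Submodule.span_le.2 (by
      rintro _ ⟨y, d, hd, rfl⟩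
      exact Submodule.subset_span ⟨y * x, d, hd, actL_actL _ _ _⟩)
    exact this hc

/-- For `x` in the restricted dual, the operator `c ↦ c₍₁₎ x(c₍₂₎)` has finite rank. -/
theorem finiteDimensional_range_actR {x : FullDual C} (hx : FiniteDimensional ℂ (twoSidedSpan x)) :
    FiniteDimensional ℂ (LinearMap.range (actR x)) := by
  -- If every element of `𝓘_full x 𝓘_full` vanishes at `c`, then so does `z * x` for every `z`,
  -- hence `actR x c = 0`. So `actR x` factors through the quotient by the kernel of this
  -- evaluation, which embeds in a finite-dimensional dual.
  let ev : C →ₗ[ℂ] Module.Dual ℂ (twoSidedSpan x) :=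
    { toFun := fun c =>
        { toFun := fun z => z.1.ofConv c
          map_add' := by simp
          map_smul' := by simp }
      map_add' := fun c d => LinearMap.ext fun z => map_add z.1.ofConv c d
      map_smul' := fun r c => LinearMap.ext fun z => map_smul z.1.ofConv r c }
  have hker : LinearMap.ker ev ≤ LinearMap.ker (actR x) := by
    intro c hc
    rw [LinearMap.mem_ker] at hc ⊢
    refine ext_fullDual fun z => ?_
    rw [ofConv_actR, map_zero]
    exact LinearMap.congr_fun hc ⟨z * x, by simpa using mul_mul_mem_twoSidedSpan x z 1⟩
  have : FiniteDimensional ℂ (C ⧸ LinearMap.ker ev) :=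
    Module.Finite.equiv ev.quotKerEquivRange.symm
  have h2 : LinearMap.range (actR x) = LinearMap.range ((LinearMap.ker ev).liftQ (actR x) hker) :=
    (Submodule.range_liftQ _ _ _).symm
  rw [h2]
  infer_instance

end Comodules

/-! ### The involution `†` and finite-dimensional `†`-stable subcoalgebras. -/

section DagComodules

variable {C : Type*} [AddCommGroup C] [Module ℂ C] [Coalgebra ℂ C] [StarAddMonoid C]
  [StarModule ℂ C] [DagCoalgebra C]

theorem ofConv_star (x : FullDual C) (c : C) :
    x.ofConv (star c) = star ((star x).ofConv c) := by
  rw [fullDual_star_apply, star_star]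

/-- Since `†` reverses the comultiplication, it exchanges the two actions of the dual. Consequently
`E + E^†` is stable under both actions as soon as `E` is. -/
theorem star_actR (x : FullDual C) (c : C) : star (actR x c) = actL (star x) (star c) :=
  ext_fullDual fun z => by
    rw [ofConv_actL, ofConv_star, ofConv_star, ofConv_actR, star_mul, star_star]

theorem star_actL (x : FullDual C) (c : C) : star (actL x c) = actR (star x) (star c) :=
  ext_fullDual fun z => by
    rw [ofConv_actR, ofConv_star, ofConv_star, ofConv_actL, star_mul, star_star]

/-- Every finite-dimensional subspace of a `†`-coalgebra lies in a finite-dimensional `†`-stable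
subspace that is stable under both actions of the dual. -/
theorem exists_finiteDimensional_star_stable (W : Submodule ℂ C) [FiniteDimensional ℂ W] :
    ∃ E : Submodule ℂ C, FiniteDimensional ℂ E ∧ W ≤ E ∧
      (∀ (x : FullDual C), ∀ c ∈ E, actR x c ∈ E) ∧ (∀ (x : FullDual C), ∀ c ∈ E, actL x c ∈ E) ∧
      ∀ c ∈ E, star c ∈ E := by
  obtain ⟨E, hE, hWE, hR, hL⟩ := exists_finiteDimensional_stable W
  let E' : Submodule ℂ C := E.map (starLinearEquiv ℂ (A := C)).toLinearMap
  have hE' : ∀ c, c ∈ E' ↔ star c ∈ E := fun c =>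
    ⟨by rintro ⟨d, hd, rfl⟩; simpa using hd, fun h => ⟨star c, h, by simp⟩⟩
  have key : ∀ T : C →ₗ[ℂ] C, (∀ c ∈ E, T c ∈ E) → (∀ c ∈ E', T c ∈ E') →
      ∀ c ∈ E ⊔ E', T c ∈ E ⊔ E' := by
    intro T h h' c hc
    obtain ⟨p, hp, q, hq, rfl⟩ := Submodule.mem_sup.1 hc
    rw [map_add]
    exact add_mem (Submodule.mem_sup_left (h p hp)) (Submodule.mem_sup_right (h' q hq))
  refine ⟨E ⊔ E', inferInstance, hWE.trans le_sup_left, fun x => key _ (hR x) fun c hc => ?_,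
    fun x => key _ (hL x) fun c hc => ?_, fun c hc => ?_⟩
  · rw [hE', star_actR]
    exact hL _ _ ((hE' c).1 hc)
  · rw [hE', star_actL]
    exact hR _ _ ((hE' c).1 hc)
  · obtain ⟨p, hp, q, hq, rfl⟩ := Submodule.mem_sup.1 hc
    rw [star_add, add_comm]
    exact add_mem (Submodule.mem_sup_left ((hE' q).1 hq))
      (Submodule.mem_sup_right ((hE' _).2 (by rwa [star_star])))

end DagComodules

/-! ### The invariant state and its GNS inner product -/

section Haar

variable (A : Type*) [Ring A] [HopfAlgebra ℂ A] [StarRing A] [StarModule ℂ A]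
  [CQGHopfStarAlgebra A]

/-- The invariant state of a CQG Hopf `*`-algebra. -/
noncomputable def haarState : A →ₗ[ℂ] ℂ :=
  (CQGHopfStarAlgebra.exists_invariant_state (A := A)).choose

variable {A}

theorem haarState_left (a : A) :
    sliceL (haarState A) (comul (R := ℂ) a) = haarState A a • (1 : A) :=
  (CQGHopfStarAlgebra.exists_invariant_state (A := A)).choose_spec.2.1 a

theorem haarState_one : haarState A 1 = 1 :=
  (CQGHopfStarAlgebra.exists_invariant_state (A := A)).choose_spec.2.2.1

theorem haarState_nonneg (a : A) : 0 ≤ haarState A (star a * a) :=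
  (CQGHopfStarAlgebra.exists_invariant_state (A := A)).choose_spec.2.2.2 a

/-- A positive functional on a unital `*`-algebra is hermitian: expanding the real numbers `Φ(x^*
x)` for `x = 1 + a` and `x = 1 + i a` gives the imaginary and the real part of the claim. -/
theorem haarState_star (a : A) : haarState A (star a) = star (haarState A a) := by
  have him : ∀ x : A, (haarState A (star x * x)).im = 0 := fun x =>
    (Complex.nonneg_iff.1 (haarState_nonneg x)).2.symm
  have h1 := him (1 + a)
  have h2 := him (1 + Complex.I • a)
  have h3 := him a
  have h4 := him (1 : A)
  simp only [star_add, star_one, star_smul, mul_add, add_mul, one_mul, mul_one, map_add,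
    smul_mul_assoc, mul_smul_comm, map_smul, smul_eq_mul, Complex.add_im, Complex.mul_im,
    Complex.I_re, Complex.I_im, Complex.mul_re, Complex.star_def, Complex.conj_I, Complex.neg_re,
    Complex.neg_im, h3] at h1 h2 h4
  apply Complex.ext
  · simp only [Complex.star_def, Complex.conj_re]
    linarith
  · simp only [Complex.star_def, Complex.conj_im]
    linarith

/-- Strong invariance: `Φ(c b₍₁₎) b₍₂₎ = Φ(c₍₁₎ b) S⁻¹(c₍₂₎)`. -/
theorem haarState_strong (c b : A) :
    sliceL (haarState A ∘ₗ LinearMap.mulLeft ℂ c) (comul (R := ℂ) b) =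
      antipodeInv A (sliceL (haarState A ∘ₗ LinearMap.mulRight ℂ b) (comul (R := ℂ) c)) := by
  let m : A →ₗ[ℂ] A := TensorProduct.lid ℂ A ∘ₗ
    (haarState A).rTensor A ∘ₗ LinearMap.mulRight ℂ (comul (R := ℂ) b) ∘ₗ
      (TensorProduct.mk ℂ A A).flip 1
  have hm : ∀ p, m p = sliceL (haarState A ∘ₗ LinearMap.mulLeft ℂ p) (comul (R := ℂ) b) := by
    intro p
    change sliceL (haarState A) (p ⊗ₜ 1 * comul (R := ℂ) b) = _
    induction comul (R := ℂ) b with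
    | zero => simp
    | add s t hs ht => simp only [mul_add, map_add, hs, ht]
    | tmul m n => simp
  have hm2 : ∀ p q, q * m p = sliceL (haarState A) (p ⊗ₜ q * comul (R := ℂ) b) := by
    intro p q
    rw [hm]
    induction comul (R := ℂ) b with
    | zero => simp
    | add s t hs ht => simp only [mul_add, map_add, hs, ht]
    | tmul m n => simp
  -- The map is `p ⊗ q ⊗ r ↦ S⁻¹(r) q Φ(p b₍₁₎) b₍₂₎`, evaluated on `c₍₁₎ ⊗ c₍₂₎ ⊗ c₍₃₎` in two
  -- ways. Grouping the first two legs, invariance of `Φ` applied to `Δ(c₍₁₎ b)` leaves `Φ(c₍₁₎ b)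
  -- S⁻¹(c₍₂₎)`; grouping the last two, `S⁻¹(c₍₃₎) c₍₂₎` collapses to the counit and leaves `Φ(c
  -- b₍₁₎) b₍₂₎`.
  let F : A ⊗[ℂ] (A ⊗[ℂ] A) →ₗ[ℂ] A := LinearMap.mul' ℂ A ∘ₗ TensorProduct.map
    (LinearMap.mul' ℂ A ∘ₗ (antipodeInv A).rTensor A ∘ₗ (TensorProduct.comm ℂ A A).toLinearMap) m ∘ₗ
    (TensorProduct.comm ℂ A (A ⊗[ℂ] A)).toLinearMap
  have hF : ∀ p q r, F (p ⊗ₜ (q ⊗ₜ r)) = antipodeInv A r * q * m p := by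
    intro p q r; simp [F]
  have h1 : ∀ t : A ⊗[ℂ] A, F (TensorProduct.assoc ℂ A A A ((comul (R := ℂ)).rTensor A t)) =
      antipodeInv A (sliceL (haarState A ∘ₗ LinearMap.mulRight ℂ b) t) := by
    intro t
    induction t with
    | zero => simp
    | add s t hs ht => simp only [map_add, hs, ht]
    | tmul p r =>
      have h2 : ∀ s : A ⊗[ℂ] A, F (TensorProduct.assoc ℂ A A A (s ⊗ₜ r)) =
          antipodeInv A r * sliceL (haarState A) (s * comul (R := ℂ) b) := by
        intro s
        induction s with
        | zero => simp
        | add s t hs ht => simp only [TensorProduct.add_tmul, map_add, hs, ht, add_mul, mul_add]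
        | tmul p q => rw [TensorProduct.assoc_tmul, hF, mul_assoc, hm2]
      rw [LinearMap.rTensor_tmul, h2, ← Bialgebra.comul_mul, haarState_left]
      simp
  have h2 : ∀ t : A ⊗[ℂ] A, F ((comul (R := ℂ)).lTensor A t) = m (sliceR (counit (R := ℂ)) t) := by
    intro t
    induction t with
    | zero => simp
    | add s t hs ht => simp only [map_add, hs, ht]
    | tmul p q =>
      rw [LinearMap.lTensor_tmul, ← (ℛ ℂ q).eq]
      simp only [TensorProduct.tmul_sum, map_sum, hF, ← Finset.sum_mul, sum_antipodeInv_mul]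
      simp
  rw [← h1, coassoc_apply, h2, ← hm]
  congr 1
  change _ = TensorProduct.rid ℂ A ((counit (R := ℂ)).lTensor A (comul (R := ℂ) c))
  simp

/-- Strong invariance turns slicing `Δ(b)` by `f` into slicing `Δ(a)` by the adjoint functional
`f'`. This makes the action of a dual on `A` a `*`-action for the inner product `Φ(a^* b)`. -/
theorem haarState_adjoint {f f' : A →ₗ[ℂ] ℂ}
    (h : ∀ q, f' q = star (f (star (HopfAlgebra.antipode ℂ q)))) (a b : A) :
    haarState A (star a * sliceR f (comul (R := ℂ) b)) =
      haarState A (star (sliceR f' (comul (R := ℂ) a)) * b) := by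
  have h1 : haarState A (star a * sliceR f (comul (R := ℂ) b)) =
      f (sliceL (haarState A ∘ₗ LinearMap.mulLeft ℂ (star a)) (comul (R := ℂ) b)) := by
    rw [sliceL_sliceR]; rfl
  rw [h1, haarState_strong, HopfStarAlgebra.comul_star]
  induction comul (R := ℂ) a with
  | zero => simp
  | add s t hs ht => simp only [map_add, star_add, add_mul, hs, ht]
  | tmul p q => simp [h, antipodeInv, mul_comm]

/-- The null space `N` is a right coideal in the sense needed here: by strong invariance all right
slices of `Δ(a)` lie in `N`, so `Δ(a) ∈ N ⊗ A`. Then `Φ(S⁻¹(a₍₂₎) a₍₁₎) a₍₃₎` is zero since its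
first leg lies in `N`, while the antipode identity and `Φ(1) = 1` evaluate it to `a`. -/
theorem haarState_faithful {a : A} (h : ∀ c, haarState A (c * a) = 0) : a = 0 := by
  let N : Submodule ℂ A :=
    { carrier := {p | ∀ c, haarState A (c * p) = 0}
      add_mem' := fun hp hq c => by rw [mul_add, map_add, hp, hq, add_zero]
      zero_mem' := by simp
      smul_mem' := fun r p hp c => by rw [mul_smul_comm, map_smul, hp, smul_zero] }
  obtain ⟨t, ht⟩ := mem_range_rTensor_of_sliceR (U := N) (t := comul (R := ℂ) a) fun f c => by
    have h1 : haarState A (c * sliceR f (comul (R := ℂ) a)) =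
      f (sliceL (haarState A ∘ₗ LinearMap.mulLeft ℂ c) (comul (R := ℂ) a)) := by
      rw [sliceL_sliceR]; rfl
    have h2 : haarState A ∘ₗ LinearMap.mulRight ℂ a = 0 := by
      ext p
      exact h p
    rw [h1, haarState_strong, h2]
    simp [sliceL]
  let Ψ : A ⊗[ℂ] (A ⊗[ℂ] A) →ₗ[ℂ] A := TensorProduct.lid ℂ A ∘ₗ
    (haarState A ∘ₗ LinearMap.mul' ℂ A ∘ₗ (antipodeInv A).rTensor A ∘ₗ
      (TensorProduct.comm ℂ A A).toLinearMap).rTensor A ∘ₗ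
    (TensorProduct.assoc ℂ A A A).symm.toLinearMap
  have hΨ : ∀ p q r, Ψ (p ⊗ₜ (q ⊗ₜ r)) = haarState A (antipodeInv A q * p) • r := by
    intro p q r; simp [Ψ]
  have h1 : ∀ s : N ⊗[ℂ] A, Ψ ((comul (R := ℂ)).lTensor A (N.subtype.rTensor A s)) = 0 := by
    intro s
    induction s with
    | zero => simp
    | add s t hs ht => simp only [map_add, hs, ht, add_zero]
    | tmul p q =>
      rw [LinearMap.rTensor_tmul, LinearMap.lTensor_tmul]
      induction comul (R := ℂ) q with
      | zero => simp
      | add s t hs ht => simp only [TensorProduct.tmul_add, map_add, hs, ht, add_zero]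
      | tmul q r =>
        have := p.2 (antipodeInv A q)
        rw [hΨ, Submodule.subtype_apply, this, zero_smul]
  have h2 : ∀ s : A ⊗[ℂ] A, Ψ (TensorProduct.assoc ℂ A A A ((comul (R := ℂ)).rTensor A s)) =
      sliceL (counit (R := ℂ)) s := by
    intro s
    induction s with
    | zero => simp
    | add s t hs ht => simp only [map_add, hs, ht]
    | tmul p r =>
      rw [LinearMap.rTensor_tmul, ← (ℛ ℂ p).eq]
      simp only [TensorProduct.sum_tmul, map_sum, TensorProduct.assoc_tmul, hΨ]
      rw [← Finset.sum_smul, ← map_sum, sum_antipodeInv_mul]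
      simp [haarState_one]
  have h3 := h1 t
  rw [ht, ← coassoc_apply, h2] at h3
  rw [← h3]
  change _ = TensorProduct.lid ℂ A ((counit (R := ℂ)).rTensor A (comul (R := ℂ) a))
  simp

/-- A copy of the algebra `A`, with the inner product given by the invariant state. -/
def GNS (A : Type*) : Type _ := A

/-- The identity map from `A` to its copy. -/
def toGNS (A : Type*) : A ≃ GNS A := Equiv.refl _

instance : AddCommGroup (GNS A) := inferInstanceAs (AddCommGroup A)

instance : Module ℂ (GNS A) := inferInstanceAs (Module ℂ A)

/-- The pre-inner product `⟨a, b⟩ = Φ(a^* b)`. -/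
@[reducible]
noncomputable def gnsPreCore : PreInnerProductSpace.Core ℂ (GNS A) where
  inner a b := haarState A (star ((toGNS A).symm a) * (toGNS A).symm b)
  conj_inner_symm a b := by
    change star _ = _
    rw [← haarState_star, star_mul, star_star]
  re_inner_nonneg a := (Complex.nonneg_iff.1 (haarState_nonneg _)).1
  add_left a b c := by
    change haarState A (star ((toGNS A).symm a + (toGNS A).symm b) * _) = _
    rw [star_add, add_mul, map_add]
  smul_left a b r := by
    change haarState A (star (r • (toGNS A).symm a) * _) = _
    rw [star_smul, smul_mul_assoc, map_smul]; rfl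

noncomputable instance gnsCore : InnerProductSpace.Core ℂ (GNS A) where
  __ := gnsPreCore
  definite a ha := by
    -- By Cauchy–Schwarz for the semi-inner product, `⟨a, a⟩ = 0` forces `Φ(c a) = ⟨c^*, a⟩ = 0` for
    -- every `c`.
    refine haarState_faithful (A := A) fun c => ?_
    let := gnsPreCore (A := A)
    let : Inner ℂ (GNS A) := this.toInner
    have h := InnerProductSpace.Core.inner_mul_inner_self_le (𝕜 := ℂ) (F := GNS A)
      (toGNS A (star c)) a
    have h0 : inner ℂ a a = 0 := ha
    rw [h0, map_zero, mul_zero] at h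
    have h1 : haarState A (c * (toGNS A).symm a) = inner ℂ (toGNS A (star c)) a := by
      change _ = haarState A (star (star c) * _)
      rw [star_star]
    have h2 : ‖inner ℂ (toGNS A (star c)) a‖ = ‖inner ℂ a (toGNS A (star c))‖ :=
      InnerProductSpace.Core.norm_inner_symm _ _
    rw [← h2] at h
    exact h1.trans (norm_eq_zero.1 (mul_self_eq_zero.1 (le_antisymm h (mul_self_nonneg _))))

noncomputable instance : NormedAddCommGroup (GNS A) :=
  InnerProductSpace.Core.toNormedAddCommGroup (𝕜 := ℂ) (cd := gnsCore)

noncomputable instance : InnerProductSpace ℂ (GNS A) := InnerProductSpace.ofCore gnsCore.toCore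

/-- The identity map from `A` to its copy, as a linear equivalence. -/
noncomputable def gnsEquiv (A : Type*) [Ring A] [HopfAlgebra ℂ A] [StarRing A] [StarModule ℂ A]
    [CQGHopfStarAlgebra A] : A ≃ₗ[ℂ] GNS A :=
  { toGNS A with
    map_add' := fun _ _ => rfl
    map_smul' := fun _ _ => rfl }

theorem inner_gnsEquiv (a b : A) :
    inner ℂ (gnsEquiv A a) (gnsEquiv A b) = haarState A (star a * b) := rfl

end Haar

/-! ### Boundedness of the coideal `B` -/

section Unitarity

variable {A : Type*} [Ring A] [HopfAlgebra ℂ A] [StarRing A] [StarModule ℂ A]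
  [CQGHopfStarAlgebra A]

theorem sliceR_counit_comul {C : Type*} [AddCommGroup C] [Module ℂ C] [Coalgebra ℂ C] (c : C) :
    sliceR (counit (R := ℂ)) (comul (R := ℂ) c) = c := by
  change TensorProduct.rid ℂ C ((counit (R := ℂ)).lTensor C (comul (R := ℂ) c)) = c
  simp

theorem sliceL_counit_comul {C : Type*} [AddCommGroup C] [Module ℂ C] [Coalgebra ℂ C] (c : C) :
    sliceL (counit (R := ℂ)) (comul (R := ℂ) c) = c := by
  change TensorProduct.lid ℂ C ((counit (R := ℂ)).rTensor C (comul (R := ℂ) c)) = c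
  simp

/-- If `w` is an orthonormal basis of a right coideal, then `∑ w_j w_j^*` is a scalar. -/
theorem sum_mul_star_eq_smul_one {n : ℕ} (w : Fin n → A)
    (horth : ∀ k l, haarState A (star (w k) * w l) = if k = l then 1 else 0)
    (hstable : ∀ (f : A →ₗ[ℂ] ℂ) (l : Fin n), sliceR f (comul (R := ℂ) (w l)) =
      ∑ k, haarState A (star (w k) * sliceR f (comul (R := ℂ) (w l))) • w k) :
    ∃ c : ℂ, ∑ j, w j * star (w j) = c • (1 : A) := by
  -- The elements `u k l` are the matrix coefficients of the coideal in the basis `w`: `Δ(w_l) = ∑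
  -- w_k ⊗ u_{kl}`.
  let g : Fin n → A →ₗ[ℂ] ℂ := fun k => haarState A ∘ₗ LinearMap.mulLeft ℂ (star (w k))
  let u : Fin n → Fin n → A := fun k l => sliceL (g k) (comul (R := ℂ) (w l))
  have h1 : ∀ l, comul (R := ℂ) (w l) = ∑ k, w k ⊗ₜ[ℂ] u k l := by
    intro l
    refine ext_sliceR fun f => ?_
    rw [hstable, map_sum]
    refine Finset.sum_congr rfl fun k _ => ?_
    rw [sliceR_tmul, sliceL_sliceR]
    rfl
  have h2 : ∀ k l, comul (R := ℂ) (u k l) = ∑ j, u k j ⊗ₜ[ℂ] u j l := by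
    intro k l
    have e1 : comul (R := ℂ) (u k l) =
        sliceL (g k) ((comul (R := ℂ)).lTensor A (comul (R := ℂ) (w l))) := by
      rw [LinearMap.lTensor, sliceL_map]; rfl
    have e2 : ∀ (t : A ⊗[ℂ] A) (a : A), sliceL (g k) (TensorProduct.assoc ℂ A A A (t ⊗ₜ a)) =
        sliceL (g k) t ⊗ₜ a := by
      intro t a
      induction t with
      | zero => simp
      | add s t hs ht => simp only [TensorProduct.add_tmul, map_add, hs, ht]
      | tmul p q => simp [TensorProduct.smul_tmul']
    rw [e1, ← coassoc_apply, h1 l]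
    simp only [map_sum, LinearMap.rTensor_tmul, e2]
    rfl
  have h3 : ∀ k l, counit (R := ℂ) (u k l) = if k = l then 1 else 0 := by
    intro k l
    rw [← horth, sliceL_sliceR, sliceR_counit_comul]
    rfl
  -- Orthonormality with respect to the invariant state makes the corepresentation unitary; strong
  -- invariance gives `u_{kj}^* = S(u_{jk})`.
  have h4 : ∀ k j, star (u k j) = HopfAlgebra.antipode ℂ (u j k) := by
    intro k j
    have e : ∀ t : A ⊗[ℂ] A, star (sliceL (haarState A ∘ₗ LinearMap.mulRight ℂ (w j)) (star t)) =
        sliceL (g j) t := by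
      intro t
      induction t with
      | zero => simp
      | add s t hs ht => simp only [star_add, map_add, hs, ht]
      | tmul p q => simp [g, ← haarState_star]
    change star (sliceL (haarState A ∘ₗ LinearMap.mulLeft ℂ (star (w k))) _) = _
    rw [haarState_strong, HopfStarAlgebra.comul_star]
    change star (star (HopfAlgebra.antipode ℂ (star _))) = _
    rw [e, star_star]
  have h5 : ∀ k l, ∑ j, u k j * star (u l j) = if k = l then 1 else 0 := by
    intro k l
    have := HopfAlgebra.mul_antipode_lTensor_comul_apply (R := ℂ) (u k l)
    rw [h2, h3] at this
    simp only [map_sum, LinearMap.lTensor_tmul, LinearMap.mul'_apply, ← h4] at this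
    rw [this]
    split_ifs <;> simp
  refine ⟨counit (R := ℂ) (∑ j, w j * star (w j)), ?_⟩
  -- By unitarity of `u` the mixed terms cancel, so `∑ w_j w_j^*` is coinvariant; applying `ε ⊗ id`
  -- shows that it is a multiple of `1`.
  have h6 : comul (R := ℂ) (∑ j, w j * star (w j)) = (∑ j, w j * star (w j)) ⊗ₜ[ℂ] (1 : A) := by
    have e : ∀ j, comul (R := ℂ) (w j * star (w j)) =
        ∑ k, ∑ l, (w k * star (w l)) ⊗ₜ[ℂ] (u k j * star (u l j)) := by
      intro j
      rw [Bialgebra.comul_mul, HopfStarAlgebra.comul_star, h1, star_sum, Finset.sum_mul_sum]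
      simp
    rw [map_sum, Finset.sum_congr rfl fun j _ => e j, Finset.sum_comm, TensorProduct.sum_tmul]
    refine Finset.sum_congr rfl fun k _ => ?_
    rw [Finset.sum_comm]
    simp only [← TensorProduct.tmul_sum, h5]
    rw [Finset.sum_eq_single k]
    · simp
    · intro l _ hl
      simp [hl.symm]
    · simp
  conv_lhs => rw [← sliceL_counit_comul (∑ j, w j * star (w j)), h6, sliceL_tmul]

end Unitarity

namespace CQGCoidealDatum

variable {A C : Type*} [Ring A] [HopfAlgebra ℂ A] [StarRing A] [StarModule ℂ A]
  [CQGHopfStarAlgebra A]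
  [AddCommGroup C] [Module ℂ C] [Coalgebra ℂ C] [StarAddMonoid C] [StarModule ℂ C]
  [DagCoalgebra C] [Module A C] [IsScalarTower ℂ A C] [ModuleDagCoalgebra A C]
  (D : CQGCoidealDatum A C)

theorem sliceR_comul_mem_B (b : D.B) (f : A →ₗ[ℂ] ℂ) :
    sliceR f (comul (R := ℂ) (b : A)) ∈ D.B := by
  rw [← D.rTensor_inclB_coactB, LinearMap.rTensor, sliceR_map]
  exact Subtype.property _

/-- The right slices of `Δ(b)` span a finite-dimensional right coideal that lies in `B` and contains
`b` (slice by the counit). The `w_j` form an orthonormal basis of it for the invariant state, and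
the `r_j` are the coordinates of `b`. -/
theorem exists_sum_mul_star_eq (b : D.B) : ∃ (n : ℕ) (w : Fin n → D.B) (r : Fin n → ℂ) (c : ℂ),
    ∑ j, w j * star (w j) = c • (1 : D.B) ∧ b = ∑ j, r j • w j := by
  let φ : (A →ₗ[ℂ] ℂ) →ₗ[ℂ] A :=
    { toFun := fun f => sliceR f (comul (R := ℂ) (b : A))
      map_add' := fun f g => sliceR_add f g _
      map_smul' := fun r f => sliceR_smul r f _ }
  let W : Submodule ℂ A := LinearMap.range φ
  have hW : FiniteDimensional ℂ W := by
    obtain ⟨U, hU, h⟩ := finiteDimensional_range_sliceR (comul (R := ℂ) (b : A))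
    have : W ≤ U := by
      rintro _ ⟨f, rfl⟩
      exact h f
    exact Submodule.finiteDimensional_of_le this
  have hWB : ∀ a ∈ W, a ∈ D.B := by
    rintro _ ⟨f, rfl⟩
    exact D.sliceR_comul_mem_B b f
  have hWs : ∀ a ∈ W, ∀ f : A →ₗ[ℂ] ℂ, sliceR f (comul (R := ℂ) a) ∈ W := by
    rintro _ ⟨g, rfl⟩ f
    exact ⟨(toConv f * toConv g).ofConv,
      (sliceR_coact_sliceR comul (coassoc_apply (b : A)) (toConv f) (toConv g)).symm⟩
  have hbW : (b : A) ∈ W := ⟨counit, sliceR_counit_comul _⟩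
  let W' : Submodule ℂ (GNS A) := W.map (gnsEquiv A).toLinearMap
  have hW' : ∀ a, a ∈ W ↔ gnsEquiv A a ∈ W' := fun a =>
    ⟨fun h => ⟨a, h, rfl⟩, by rintro ⟨a', h, he⟩; rwa [← (gnsEquiv A).injective he]⟩
  let e := stdOrthonormalBasis ℂ W'
  let w : Fin (Module.finrank ℂ W') → A := fun k => (gnsEquiv A).symm (e k : GNS A)
  have hwW : ∀ k, w k ∈ W := fun k => by
    rw [hW']
    simp only [w, LinearEquiv.apply_symm_apply]
    exact (e k).2
  have hexp : ∀ a ∈ W, a = ∑ k, haarState A (star (w k) * a) • w k := by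
    intro a ha
    have h := congrArg (fun x : W' => (gnsEquiv A).symm (x : GNS A))
      (e.sum_repr' ⟨gnsEquiv A a, (hW' a).1 ha⟩)
    simp only [Submodule.coe_sum, map_sum, Submodule.coe_smul, map_smul, Submodule.coe_inner,
      LinearEquiv.symm_apply_apply] at h
    rw [← h]
    refine Finset.sum_congr rfl fun k _ => ?_
    congr 1
    rw [h, ← inner_gnsEquiv]
    simp [w]
  obtain ⟨c, hc⟩ := sum_mul_star_eq_smul_one w (fun k l => by
    rw [← inner_gnsEquiv]
    simp only [w, LinearEquiv.apply_symm_apply]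
    rw [← Submodule.coe_inner]
    exact orthonormal_iff_ite.1 e.orthonormal k l) fun f l => hexp _ (hWs _ (hwW l) f)
  refine ⟨_, fun k => ⟨w k, hWB _ (hwW k)⟩, fun k => haarState A (star (w k) * b), c, ?_, ?_⟩
  · apply Subtype.ext
    simpa using hc
  · apply Subtype.ext
    simpa using hexp _ hbW

/-- In every `*`-representation of `B` on a pre-Hilbert space, `B` acts by bounded operators. -/
theorem exists_bound_act {V : Type*} [NormedAddCommGroup V] [InnerProductSpace ℂ V]
    (act : D.B →ₐ[ℂ] Module.End ℂ V)
    (hact : ∀ b v w, inner ℂ v (act b w) = inner ℂ (act (star b) v) w) (b : D.B) :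
    ∃ K : ℝ, ∀ v, ‖act b v‖ ≤ K * ‖v‖ := by
  -- The identity `∑ w_j w_j^* = c` controls `w_j^*` rather than `w_j`, since `∑ ‖w_j^* v‖² = ⟨v, ∑
  -- w_j w_j^* v⟩ = c ‖v‖²`. Expanding `b^*` in the `w_j` makes `b` a combination of the `w_j^*`.
  obtain ⟨n, w, r, c, hc, hb⟩ := D.exists_sum_mul_star_eq (star b)
  have hb' : b = ∑ j, star (r j) • star (w j) := by
    rw [← star_star b, hb, star_sum]
    simp only [star_smul]
  have h1 : ∀ j v, ‖act (star (w j)) v‖ ≤ Real.sqrt ‖c‖ * ‖v‖ := by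
    intro j v
    have e : ∑ j, ((‖act (star (w j)) v‖ ^ 2 : ℝ) : ℂ) = c * ((‖v‖ ^ 2 : ℝ) : ℂ) := by
      have := congrArg (fun x => inner ℂ v (act x v)) hc
      simp only [map_sum, map_mul, LinearMap.sum_apply, inner_sum, Module.End.mul_apply,
        map_smul, map_one, LinearMap.smul_apply, inner_smul_right, Module.End.one_apply] at this
      rw [inner_self_eq_norm_sq_to_K] at this
      rw [Complex.ofReal_pow]
      refine Eq.trans (Finset.sum_congr rfl fun j _ => ?_) this
      rw [hact, inner_self_eq_norm_sq_to_K, Complex.ofReal_pow]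
      rfl
    rw [← Complex.ofReal_sum] at e
    have e2 : ∑ j, ‖act (star (w j)) v‖ ^ 2 = ‖c‖ * ‖v‖ ^ 2 := by
      have := congrArg norm e
      rw [norm_mul, Complex.norm_real, Complex.norm_real, Real.norm_of_nonneg (by positivity),
        Real.norm_of_nonneg (by positivity)] at this
      exact this
    have e3 : ‖act (star (w j)) v‖ ^ 2 ≤ ‖c‖ * ‖v‖ ^ 2 := by
      rw [← e2]
      exact Finset.single_le_sum (f := fun j => ‖act (star (w j)) v‖ ^ 2)
        (fun i _ => by positivity) (Finset.mem_univ j)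
    refine abs_le_of_sq_le_sq' ?_ (by positivity) |>.2
    rwa [mul_pow, Real.sq_sqrt (norm_nonneg c)]
  refine ⟨∑ j, ‖r j‖ * Real.sqrt ‖c‖, fun v => ?_⟩
  conv_lhs => rw [hb']
  rw [map_sum, LinearMap.sum_apply, Finset.sum_mul]
  refine (norm_sum_le _ _).trans (Finset.sum_le_sum fun j _ => ?_)
  rw [map_smul, LinearMap.smul_apply, norm_smul, norm_star, mul_assoc]
  exact mul_le_mul_of_nonneg_left (h1 j v) (norm_nonneg _)

end CQGCoidealDatum

/-! ### Boundedness of the restricted dual -/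

section Bounded

variable {V : Type*} [NormedAddCommGroup V] [InnerProductSpace ℂ V]

/-- An algebraic locally finite symmetric operator on a pre-Hilbert space is bounded. -/
theorem LinearMap.IsSymmetric.exists_bound_of_aeval_eq_zero {Y : V →ₗ[ℂ] V} (hY : Y.IsSymmetric)
    {q : Polynomial ℂ} (hq : q ≠ 0)
    (h : ∀ v, Polynomial.aeval (R := ℂ) (A := Module.End ℂ V) Y q v = 0)
    (hfin : ∀ v, ∃ U : Submodule ℂ V, FiniteDimensional ℂ U ∧ v ∈ U ∧ ∀ u ∈ U, Y u ∈ U) :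
    ∃ K : ℝ, 0 ≤ K ∧ ∀ v, ‖Y v‖ ≤ K * ‖v‖ := by
  -- Every eigenvalue of `Y` is a root of `q`, so this bound does not depend on the
  -- finite-dimensional invariant subspace in which the spectral theorem is applied.
  let K : ℝ := ∑ r ∈ q.roots.toFinset, ‖r‖
  have hK : 0 ≤ K := Finset.sum_nonneg fun _ _ => norm_nonneg _
  refine ⟨K, hK, fun v => ?_⟩
  obtain ⟨U, hU, hv, hYU⟩ := hfin v
  have hS : (Y.restrict hYU).IsSymmetric := hY.restrict_invariant hYU
  let b := hS.eigenvectorBasis rfl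
  have hev : ∀ i, ‖(hS.eigenvalues rfl i : ℂ)‖ ≤ K := by
    intro i
    have h1 := hS.hasEigenvector_eigenvectorBasis rfl i
    have h2 : Module.End.HasEigenvector (Y : Module.End ℂ V) (hS.eigenvalues rfl i : ℂ)
        (hS.eigenvectorBasis rfl i : V) := by
      refine ⟨Module.End.mem_eigenspace_iff.2 ?_, fun h0 => h1.2 (Subtype.ext h0)⟩
      exact congrArg Subtype.val (Module.End.mem_eigenspace_iff.1 h1.1)
    have h3 := Module.End.aeval_apply_of_hasEigenvector (p := q) h2
    rw [h, eq_comm, smul_eq_zero] at h3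
    have h4 := h3.resolve_right h2.2
    refine Finset.single_le_sum (f := fun r : ℂ => ‖r‖) (fun _ _ => norm_nonneg _) ?_
    simpa [hq] using h4
  have h1 : ∀ u : U, ‖(Y.restrict hYU) u‖ ^ 2 ≤ (K * ‖u‖) ^ 2 := by
    intro u
    rw [← b.sum_sq_norm_inner_right, mul_pow, ← b.sum_sq_norm_inner_right u, Finset.mul_sum]
    refine Finset.sum_le_sum fun i _ => ?_
    have := hS.eigenvectorBasis_apply_self_apply rfl u i
    rw [OrthonormalBasis.repr_apply_apply, OrthonormalBasis.repr_apply_apply] at this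
    change ‖inner ℂ (hS.eigenvectorBasis rfl i) _‖ ^ 2 ≤ _
    rw [this, norm_mul, mul_pow]
    exact mul_le_mul_of_nonneg_right (pow_le_pow_left₀ (norm_nonneg _) (hev i) 2) (by positivity)
  exact abs_le_of_sq_le_sq' (h1 ⟨v, hv⟩) (by positivity) |>.2

variable {C : Type*} [AddCommGroup C] [Module ℂ C] [Coalgebra ℂ C]

theorem mul_mem_twoSidedSpan {x : FullDual C} (y : FullDual C) {z : FullDual C}
    (hz : z ∈ twoSidedSpan x) : y * z ∈ twoSidedSpan x := by
  induction hz using Submodule.span_induction with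
  | mem z h =>
    obtain ⟨z, w, rfl⟩ := h
    rw [← mul_assoc, ← mul_assoc]
    exact mul_mul_mem_twoSidedSpan x _ _
  | zero => simp
  | add a b _ _ ha hb => rw [mul_add]; exact add_mem ha hb
  | smul r a _ ha => rw [mul_smul_comm]; exact Submodule.smul_mem _ r ha

variable [StarAddMonoid C] [StarModule ℂ C] [DagCoalgebra C]

/-- In every `*`-representation of the full dual on a pre-Hilbert space, the restricted dual acts by
bounded operators. -/
theorem exists_bound_of_mem_restrictedDual (T : FullDual C →ₐ[ℂ] Module.End ℂ V)
    (hT : ∀ x v w, inner ℂ v (T x w) = inner ℂ (T (star x) v) w) {x : FullDual C}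
    (hx : x ∈ restrictedDual C) : ∃ K : ℝ, ∀ v, ‖T x v‖ ≤ K * ‖v‖ := by
  -- Passing to `x^* x` gives a symmetric operator. All products `p(y) y` lie in a
  -- finite-dimensional space, so some nonzero `q` satisfies `q(y) y = 0`.
  let y : FullDual C := star x * x
  have hy : FiniteDimensional ℂ (twoSidedSpan y) :=
    mem_restrictedDual.1 (mul_mem (star_mem hx) hx)
  have hyy : y ∈ twoSidedSpan y := by simpa using mul_mul_mem_twoSidedSpan y 1 1
  have hstar : star y = y := by simp [y]
  let f : Polynomial ℂ →ₗ[ℂ] twoSidedSpan y :=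
    LinearMap.codRestrict _ (LinearMap.mulRight ℂ y ∘ₗ (Polynomial.aeval y).toLinearMap)
      fun q => mul_mem_twoSidedSpan _ hyy
  obtain ⟨q, hq0, hq⟩ : ∃ q, q ≠ 0 ∧ f q = 0 := by
    by_contra! hcon
    have hinj : Function.Injective f := (injective_iff_map_eq_zero f).2 fun q hq => by
      by_contra h0
      exact hcon q h0 hq
    have := Module.Finite.of_injective f hinj
    exact Polynomial.not_finite this
  have hq' : Polynomial.aeval y q * y = 0 := congrArg Subtype.val hq
  have hsym : (T y).IsSymmetric := fun v w => by rw [hT, hstar]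
  obtain ⟨K, hK, hbound⟩ := hsym.exists_bound_of_aeval_eq_zero (q := q * Polynomial.X)
    (mul_ne_zero hq0 Polynomial.X_ne_zero) (fun v => by
      rw [Polynomial.aeval_algHom_apply, map_mul, Polynomial.aeval_X, hq', map_zero]
      rfl) (fun v => by
      let ev : FullDual C →ₗ[ℂ] V := (LinearMap.applyₗ v) ∘ₗ T.toLinearMap
      -- The vector `v` is added because only products with `y`, and not the unit, need to lie in
      -- the two-sided span.
      refine ⟨Submodule.span ℂ {v} ⊔ (twoSidedSpan y).map ev, inferInstance,
        Submodule.mem_sup_left (Submodule.mem_span_singleton_self v), fun u hu => ?_⟩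
      refine Submodule.mem_sup_right ?_
      obtain ⟨u₁, h₁, u₂, ⟨z, hz, rfl⟩, rfl⟩ := Submodule.mem_sup.1 hu
      obtain ⟨r, rfl⟩ := Submodule.mem_span_singleton.1 h₁
      rw [map_add, map_smul]
      refine add_mem (Submodule.smul_mem _ _ ⟨y, hyy, rfl⟩) ⟨y * z, mul_mem_twoSidedSpan _ hz, ?_⟩
      simp [ev])
  refine ⟨Real.sqrt K, fun v => ?_⟩
  refine abs_le_of_sq_le_sq' ?_ (by positivity) |>.2
  rw [mul_pow, Real.sq_sqrt hK]
  have h1 : ((‖T x v‖ ^ 2 : ℝ) : ℂ) = inner ℂ v (T y v) := by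
    rw [map_mul, Module.End.mul_apply, hT, star_star, inner_self_eq_norm_sq_to_K,
      Complex.ofReal_pow]
    rfl
  calc ‖T x v‖ ^ 2 = ‖inner ℂ v (T y v)‖ := by
        rw [← h1, Complex.norm_real, Real.norm_of_nonneg (by positivity)]
    _ ≤ ‖v‖ * ‖T y v‖ := norm_inner_le_norm _ _
    _ ≤ ‖v‖ * (K * ‖v‖) := mul_le_mul_of_nonneg_left (hbound v) (norm_nonneg v)
    _ = K * ‖v‖ ^ 2 := by ring

end Bounded

/-! ### Local units in the restricted dual -/

namespace CQGCoidealDatum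

variable {A C : Type*} [Ring A] [HopfAlgebra ℂ A] [StarRing A] [StarModule ℂ A]
  [CQGHopfStarAlgebra A]
  [AddCommGroup C] [Module ℂ C] [Coalgebra ℂ C] [StarAddMonoid C] [StarModule ℂ C]
  [DagCoalgebra C] [Module A C] [IsScalarTower ℂ A C] [ModuleDagCoalgebra A C]
  (D : CQGCoidealDatum A C)

/-- The action `x · a = a₍₁₎ x(π_C(a₍₂₎))` of the full dual of `C` on `A`. -/
noncomputable def actA (x : FullDual C) : A →ₗ[ℂ] A :=
  sliceR (x.ofConv ∘ₗ D.proj.toLinearMap) ∘ₗ comul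

theorem actA_add (x y : FullDual C) (a : A) : D.actA (x + y) a = D.actA x a + D.actA y a := by
  change sliceR ((x.ofConv + y.ofConv) ∘ₗ D.proj.toLinearMap) (comul a) = _
  rw [LinearMap.add_comp, sliceR_add]
  rfl

theorem actA_smul (r : ℂ) (x : FullDual C) (a : A) : D.actA (r • x) a = r • D.actA x a := by
  change sliceR ((r • x.ofConv) ∘ₗ D.proj.toLinearMap) (comul a) = _
  rw [LinearMap.smul_comp, sliceR_smul]
  rfl

theorem actA_actA (x y : FullDual C) (a : A) : D.actA x (D.actA y a) = D.actA (x * y) a := by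
  refine (sliceR_coact_sliceR comul (coassoc_apply a) (toConv (x.ofConv ∘ₗ D.proj.toLinearMap))
    (toConv (y.ofConv ∘ₗ D.proj.toLinearMap))).trans ?_
  change sliceR _ _ = sliceR _ _
  congr 2
  ext a
  rw [fullDual_mul_apply]
  change _ = (x * y).ofConv (D.proj a)
  rw [fullDual_mul_apply, ← CoalgHomClass.map_comp_comul_apply D.proj a]
  exact congrArg _ (LinearMap.congr_fun (TensorProduct.map_comp _ _ _ _) _)

/-- The compatibility of `π_C` with `†` is what makes the functionals `x ∘ π_C` and `x^* ∘ π_C`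
adjoint in the sense of `haarState_adjoint`. -/
theorem haarState_mul_actA (x : FullDual C) (a b : A) :
    haarState A (star a * D.actA x b) = haarState A (star (D.actA (star x) a) * b) :=
  haarState_adjoint (fun q => by
    change (star x).ofConv (D.proj q) = star (x.ofConv (D.proj _))
    rw [D.proj_dag]; rfl) a b

theorem proj_actA (x : FullDual C) (a : A) : D.proj (D.actA x a) = actR x (D.proj a) := by
  rw [actR_apply, ← CoalgHomClass.map_comp_comul_apply D.proj a]
  exact (sliceR_map D.proj.toLinearMap D.proj.toLinearMap _ _).symm

/-- Orthogonal decomposition of an element of `A` with respect to a `*`-stable ideal `N` of the full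
dual of `C`. -/
theorem exists_actA_decomposition (N : Submodule ℂ (FullDual C))
    (hN : ∀ x y : FullDual C, y ∈ N → x * y ∈ N) (hN' : ∀ x y : FullDual C, x ∈ N → x * y ∈ N) (a : A) :
    ∃ n ∈ N, ∀ x ∈ N, D.actA x (a - D.actA n a) = 0 := by
  let ev : FullDual C →ₗ[ℂ] GNS A :=
    { toFun := fun x => gnsEquiv A (D.actA x a)
      map_add' := fun x y => by rw [actA_add, map_add]
      map_smul' := fun r x => by rw [actA_smul, map_smul]; rfl }
  have hU : FiniteDimensional ℂ (N.map ev) := by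
    obtain ⟨U, hU, h⟩ := finiteDimensional_range_sliceR (comul (R := ℂ) a)
    have : N.map ev ≤ U.map (gnsEquiv A).toLinearMap := by
      rintro _ ⟨x, hx, rfl⟩
      exact ⟨_, h _, rfl⟩
    exact Submodule.finiteDimensional_of_le this
  -- The orthogonal projection of `a` onto the finite-dimensional space `N · a` has the form `n ·
  -- a`; the remainder is orthogonal to `N · a`.
  obtain ⟨_, ⟨n, hn, rfl⟩, z, hz, hav⟩ := (N.map ev).exists_add_mem_mem_orthogonal (gnsEquiv A a)
  have hz' : z = gnsEquiv A (a - D.actA n a) := by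
    rw [map_sub, hav]
    exact (add_sub_cancel_left _ _).symm
  refine ⟨n, hn, fun x hx => ?_⟩
  apply (gnsEquiv A).injective
  rw [map_zero, ← inner_self_eq_zero (𝕜 := ℂ), inner_gnsEquiv, haarState_mul_actA]
  -- With `z = a - n · a`, the square norm of `x · z` equals `⟨x^* x · z, z⟩`, and `x^* x · z = (x^*
  -- x (1 - n)) · a` lies in `N · a` because `N` is a two-sided ideal.
  have h1 : D.actA (star x) (D.actA x (a - D.actA n a)) =
      D.actA (star x * x * (1 - n)) a := by
    simp only [map_sub, actA_actA]
    rw [mul_sub, mul_one, sub_eq_add_neg (star x * x), ← neg_one_smul ℂ, actA_add, actA_smul,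
      neg_one_smul, ← sub_eq_add_neg, mul_assoc]
  rw [h1]
  have h2 := (Submodule.mem_orthogonal _ _).1 hz (ev (star x * x * (1 - n)))
    ⟨_, hN' _ _ (hN _ _ hx), rfl⟩
  rw [hz'] at h2
  exact h2

/-- Enlarge `W` to a finite-dimensional `†`-stable subcoalgebra `E`, with annihilator `N`.
Positivity of the invariant state on `A` yields `C = E ⊕ G` with `G = N · C`, stable under both
actions. The functional `e` is the counit on `E`, extended by zero on `G`. -/
theorem exists_local_unit (D : CQGCoidealDatum A C) (W : Submodule ℂ C) [FiniteDimensional ℂ W] :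
    ∃ e ∈ restrictedDual C, ∀ c ∈ W, e.ofConv c = counit (R := ℂ) c := by
  obtain ⟨E, hE, hWE, hR, hL, hs⟩ := exists_finiteDimensional_star_stable W
  let N : Submodule ℂ (FullDual C) :=
    { carrier := {x | ∀ c ∈ E, x.ofConv c = 0}
      add_mem' := fun {x y} hx hy c hc => by
        rw [ofConv_add, LinearMap.add_apply, hx c hc, hy c hc, add_zero]
      zero_mem' := fun c _ => by simp
      smul_mem' := fun r x hx c hc => by
        rw [ofConv_smul, LinearMap.smul_apply, hx c hc, smul_zero] }
  have hN : ∀ x y : FullDual C, y ∈ N → x * y ∈ N := fun x y hy c hc => by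
    rw [← ofConv_actL]; exact hy _ (hL x c hc)
  have hN' : ∀ x y : FullDual C, x ∈ N → x * y ∈ N := fun x y hx c hc => by
    rw [← ofConv_actR]; exact hx _ (hR y c hc)
  have hNs : ∀ x ∈ N, star x ∈ N := fun x hx c hc => by
    rw [fullDual_star_apply, hx _ (hs c hc), star_zero]
  have hdec := D.exists_actA_decomposition N hN hN'
  have hNE : ∀ x ∈ N, ∀ c ∈ E, actR x c = 0 := fun x hx c hc => ext_fullDual fun z => by
    rw [ofConv_actR, map_zero]; exact hN z x hx c hc
  have hEN : ∀ c, (∀ x ∈ N, actR x c = 0) → c ∈ E := fun c hc => by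
    by_contra hn
    obtain ⟨g, hg, hU⟩ := Submodule.exists_le_ker_of_notMem hn
    have h1 := ofConv_actR 1 (toConv g) c
    rw [one_mul, hc (toConv g) fun d hd => hU hd, map_zero] at h1
    exact hg h1.symm
  let G : Submodule ℂ C := Submodule.span ℂ {d | ∃ x ∈ N, ∃ c, d = actR x c}
  let A₁ : Submodule ℂ A := Submodule.span ℂ {d | ∃ x ∈ N, ∃ a, d = D.actA x a}
  have hG : ∀ c ∈ G, ∃ a ∈ A₁, D.proj a = c := by
    intro c hc
    induction hc using Submodule.span_induction with
    | mem c h =>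
      obtain ⟨x, hx, c, rfl⟩ := h
      obtain ⟨a, rfl⟩ := D.proj_surjective c
      exact ⟨_, Submodule.subset_span ⟨x, hx, a, rfl⟩, D.proj_actA x a⟩
    | zero => exact ⟨0, zero_mem _, map_zero _⟩
    | add c d _ _ hc hd =>
      obtain ⟨a, ha, rfl⟩ := hc
      obtain ⟨b, hb, rfl⟩ := hd
      exact ⟨a + b, add_mem ha hb, map_add _ _ _⟩
    | smul r c _ hc =>
      obtain ⟨a, ha, rfl⟩ := hc
      exact ⟨r • a, Submodule.smul_mem _ r ha, map_smul _ _ _⟩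
  have hGR : ∀ y, ∀ c ∈ G, actR y c ∈ G := fun y c hc => by
    have : G ≤ G.comap (actR y) := Submodule.span_le.2 (by
      rintro _ ⟨x, hx, d, rfl⟩
      exact Submodule.subset_span ⟨y * x, hN _ _ hx, d, actR_actR _ _ _⟩)
    exact this hc
  have hGL : ∀ y, ∀ c ∈ G, actL y c ∈ G := fun y c hc => by
    have : G ≤ G.comap (actL y) := Submodule.span_le.2 (by
      rintro _ ⟨x, hx, d, rfl⟩
      exact Submodule.subset_span ⟨x, hx, actL y d, actL_actR _ _ _⟩)
    exact this hc
  have hcompl : IsCompl E G := by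
    refine IsCompl.of_le ?_ ?_
    -- Lift `c ∈ E ∩ G` to `a ∈ N · A`. Then `a - n · a` lies in `N · A` and is killed by `N`, hence
    -- is orthogonal to itself and zero. So `c = π_C(n · a) = n · c`, which vanishes because `c ∈
    -- E`.
    · rintro c ⟨hcE, hcG⟩
      obtain ⟨a, ha, rfl⟩ := hG c hcG
      obtain ⟨n, hn, hp⟩ := hdec a
      have h1 : D.proj (D.actA n a) = 0 := by rw [D.proj_actA]; exact hNE n hn _ hcE
      have h2 : a - D.actA n a ∈ A₁ := sub_mem ha (Submodule.subset_span ⟨n, hn, a, rfl⟩)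
      have h3 : ∀ s ∈ A₁, haarState A (star (a - D.actA n a) * s) = 0 := by
        intro s hs
        induction hs using Submodule.span_induction with
        | mem s h =>
          obtain ⟨x, hx, s, rfl⟩ := h
          rw [haarState_mul_actA, hp _ (hNs x hx), star_zero, zero_mul, map_zero]
        | zero => simp
        | add s t _ _ hs ht => rw [mul_add, map_add, hs, ht, add_zero]
        | smul r s _ hs => rw [mul_smul_comm, map_smul, hs, smul_zero]
      have h4 : gnsEquiv A (a - D.actA n a) = 0 := by
        rw [← inner_self_eq_zero (𝕜 := ℂ), inner_gnsEquiv]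
        exact h3 _ h2
      have h5 : a = D.actA n a := sub_eq_zero.1 ((gnsEquiv A).map_eq_zero_iff.1 h4)
      rw [h5, h1]
      exact zero_mem _
    -- For a lift `a`, the part `a - n · a` is killed by `N`, so its image lies in `E`, while the
    -- image of `n · a` lies in `G`.
    · intro c _
      obtain ⟨a, rfl⟩ := D.proj_surjective c
      obtain ⟨n, hn, hp⟩ := hdec a
      rw [← sub_add_cancel a (D.actA n a), map_add]
      refine add_mem (Submodule.mem_sup_left (hEN _ fun x hx => ?_)) (Submodule.mem_sup_right ?_)
      · rw [← D.proj_actA, hp x hx, map_zero]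
      · rw [D.proj_actA]
        exact Submodule.subset_span ⟨n, hn, _, rfl⟩
  let e : FullDual C := toConv (counit (R := ℂ) ∘ₗ E.subtype ∘ₗ E.projectionOnto G hcompl)
  have heG : ∀ c ∈ G, e.ofConv c = 0 := fun c hc => by
    simp [e, Submodule.projectionOnto_apply_eq_zero_iff hcompl |>.2 hc]
  -- The annihilator of `G` contains `z e y` for all `z` and `y`, and restriction to `E` embeds it
  -- in the dual of `E`; therefore `e` belongs to the restricted dual.
  let X : Submodule ℂ (FullDual C) :=
    { carrier := {x | ∀ c ∈ G, x.ofConv c = 0}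
      add_mem' := fun {x y} hx hy c hc => by
        rw [ofConv_add, LinearMap.add_apply, hx c hc, hy c hc, add_zero]
      zero_mem' := fun c _ => by simp
      smul_mem' := fun r x hx c hc => by
        rw [ofConv_smul, LinearMap.smul_apply, hx c hc, smul_zero] }
  have hX : FiniteDimensional ℂ X := by
    let res : X →ₗ[ℂ] Module.Dual ℂ E :=
      { toFun := fun x => x.1.ofConv ∘ₗ E.subtype
        map_add' := fun x y => rfl
        map_smul' := fun r x => rfl }
    refine Module.Finite.of_injective res ((injective_iff_map_eq_zero res).2 fun x hx => ?_)
    apply Subtype.ext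
    ext c
    obtain ⟨p, hp, q, hq, rfl⟩ := Submodule.mem_sup.1
      (hcompl.sup_eq_top.ge (Submodule.mem_top (x := c)))
    have h1 : x.1.ofConv p = 0 := LinearMap.congr_fun hx ⟨p, hp⟩
    change x.1.ofConv (p + q) = 0
    rw [map_add, h1, x.2 q hq, add_zero]
  refine ⟨e, finiteDimensional_twoSidedSpan_of_le (W := X) fun z y c hc => ?_, fun c hc => ?_⟩
  · rw [← ofConv_actR, ← ofConv_actL]
    exact heG _ (hGL z _ (hGR y c hc))
  · simp [e, Submodule.projectionOnto_apply_left hcompl ⟨c, hWE hc⟩]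

end CQGCoidealDatum

/-! ### Extension of `*`-representations to a completion -/

section Extension

variable {V H : Type*} [NormedAddCommGroup V] [InnerProductSpace ℂ V]
  [NormedAddCommGroup H] [InnerProductSpace ℂ H]

theorem ContinuousLinearMap.ext_of_denseRange {ι : V →ₗᵢ[ℂ] H} (hι : DenseRange ι)
    {S T : H →L[ℂ] H} (h : ∀ v, S (ι v) = T (ι v)) : S = T :=
  ContinuousLinearMap.ext fun k =>
    congrFun (hι.equalizer S.continuous T.continuous (funext h)) k

theorem ext_inner_denseRange {ι : V →ₗᵢ[ℂ] H} (hι : DenseRange ι) {k l : H}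
    (h : ∀ v, inner ℂ (ι v) k = inner ℂ (ι v) l) : k = l :=
  ext_inner_left ℂ fun k' => congrFun (hι.equalizer (g := fun k' => inner ℂ k' k)
    (h := fun k' => inner ℂ k' l) (by fun_prop) (by fun_prop) (funext h)) k'

variable [CompleteSpace H]

/-- A `*`-representation by bounded operators on a pre-Hilbert space extends to the completion. -/
theorem exists_nonUnitalStarAlgHom_extension {R : Type*} [NonUnitalRing R] [Module ℂ R] [Star R]
    {ι : V →ₗᵢ[ℂ] H} (hι : DenseRange ι) (Θ : R →ₙₐ[ℂ] Module.End ℂ V)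
    (hΘ : ∀ r v w, inner ℂ v (Θ r w) = inner ℂ (Θ (star r) v) w)
    (hb : ∀ r, ∃ K : ℝ, ∀ v, ‖Θ r v‖ ≤ K * ‖v‖) :
    ∃ ρ : R →⋆ₙₐ[ℂ] (H →L[ℂ] H), ∀ r v, ρ r (ι v) = ι (Θ r v) := by
  have hex : ∀ r, ∃ T : H →L[ℂ] H, ∀ v, T (ι v) = ι (Θ r v) := fun r => by
    obtain ⟨K, hK⟩ := hb r
    exact ⟨(ι.toLinearMap ∘ₗ Θ r).extendOfNorm ι.toLinearMap, fun v =>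
      LinearMap.extendOfNorm_eq (f := ι.toLinearMap ∘ₗ Θ r) (e := ι.toLinearMap) hι
        ⟨K, fun v => by simpa using! hK v⟩ v⟩
  choose F hF using hex
  refine ⟨{ toFun := F
            map_smul' := fun c r => ContinuousLinearMap.ext_of_denseRange hι fun v => by
              simp [hF]
            map_zero' := ContinuousLinearMap.ext_of_denseRange hι fun v => by simp [hF]
            map_add' := fun r s => ContinuousLinearMap.ext_of_denseRange hι fun v => by
              simp [hF]
            map_mul' := fun r s => ContinuousLinearMap.ext_of_denseRange hι fun v => by
              simp [hF]
            map_star' := fun r => ContinuousLinearMap.ext_of_denseRange hι fun v => ?_ }, hF⟩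
  refine ext_inner_denseRange hι fun w => ?_
  rw [ContinuousLinearMap.star_eq_adjoint, ContinuousLinearMap.adjoint_inner_right, hF, hF,
    LinearIsometry.inner_map_map, LinearIsometry.inner_map_map, ← inner_conj_symm, ← hΘ,
    inner_conj_symm]

end Extension

/-! ### From unitary Doi–Koppinen modules to nondegenerate `*`-representations. -/

section Modules

variable {A C : Type*} [Ring A] [HopfAlgebra ℂ A] [StarRing A] [StarModule ℂ A]
  [CQGHopfStarAlgebra A]
  [AddCommGroup C] [Module ℂ C] [Coalgebra ℂ C] [StarAddMonoid C] [StarModule ℂ C]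
  [DagCoalgebra C] [Module A C] [IsScalarTower ℂ A C] [ModuleDagCoalgebra A C]
  {D : CQGCoidealDatum A C} {V H : Type*} [NormedAddCommGroup V] [InnerProductSpace ℂ V]
  [NormedAddCommGroup H] [InnerProductSpace ℂ H] [CompleteSpace H]

theorem inner_sliceR {V C : Type*} [NormedAddCommGroup V] [InnerProductSpace ℂ V] [AddCommGroup C]
    [Module ℂ C] (f : C →ₗ[ℂ] ℂ) (v : V) (t : V ⊗[ℂ] C) :
    inner ℂ v (sliceR f t) = f (innerContract v t) := by
  induction t with
  | zero => simp
  | add s t hs ht => simp only [map_add, inner_add_right, hs, ht]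
  | tmul m n => simp [innerContract, mul_comm]

theorem sliceR_map₂_moduleMap {M : Type*} [AddCommGroup M] [Module ℂ M]
    (act : D.B →ₗ[ℂ] M →ₗ[ℂ] M) (x : FullDual C) (t : M ⊗[ℂ] C) {n : ℕ} (b₀ : Fin n → D.B)
    (b₁ : Fin n → A) :
    sliceR x.ofConv (TensorProduct.map₂ act (moduleMap A C) (∑ i, b₀ i ⊗ₜ[ℂ] b₁ i) t) =
      ∑ i, act (b₀ i) (sliceR (rightAct x (b₁ i)).ofConv t) := by
  simp only [map_sum, LinearMap.sum_apply, TensorProduct.map₂_apply_tmul, sliceR_map]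
  rfl

theorem CQGCoidealDatum.exists_starAlgHom_extension {ι : V →ₗᵢ[ℂ] H} (hι : DenseRange ι)
    (act : D.B →ₐ[ℂ] Module.End ℂ V)
    (hact : ∀ b v w, inner ℂ v (act b w) = inner ℂ (act (star b) v) w) :
    ∃ π : D.B →⋆ₐ[ℂ] (H →L[ℂ] H), ∀ b v, π b (ι v) = ι (act b v) := by
  obtain ⟨π, hπ⟩ := exists_nonUnitalStarAlgHom_extension hι (act : D.B →ₙₐ[ℂ] Module.End ℂ V)
    hact (D.exists_bound_act act hact)
  have h1 : π 1 = 1 := ContinuousLinearMap.ext_of_denseRange hι fun v => by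
    rw [hπ]
    change ι (act 1 v) = ι v
    simp
  refine ⟨{ toFun := π
            map_one' := h1
            map_mul' := map_mul π
            map_zero' := map_zero π
            map_add' := map_add π
            commutes' := fun r => by
              rw [Algebra.algebraMap_eq_smul_one, map_smul, h1, Algebra.algebraMap_eq_smul_one]
            map_star' := map_star π }, hπ⟩

namespace UnitaryDKModule

variable (M : UnitaryDKModule D V)

theorem dualAct_apply (x : FullDual C) (v : V) : M.dualAct x v = sliceR x.ofConv (M.coact v) := rfl

/-- The action of the full dual as a homomorphism of algebras. -/
noncomputable def dualActHom : FullDual C →ₐ[ℂ] Module.End ℂ V :=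
  AlgHom.ofLinearMap
    { toFun := M.dualAct
      map_add' := fun x y => LinearMap.ext fun v => sliceR_add _ _ _
      map_smul' := fun r x => LinearMap.ext fun v => sliceR_smul _ _ _ }
    (LinearMap.ext fun v => by
      change sliceR (1 : FullDual C).ofConv (M.coact v) = v
      rw [fullDual_one_ofConv]
      exact M.counital v)
    fun x y => LinearMap.ext fun v => (sliceR_coact_sliceR M.coact (M.coassoc v) x y).symm

theorem dualActHom_apply (x : FullDual C) : M.dualActHom x = M.dualAct x := rfl

theorem dualAct_mul (x y : FullDual C) (v : V) :
    M.dualAct (x * y) v = M.dualAct x (M.dualAct y v) :=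
  LinearMap.congr_fun (map_mul M.dualActHom x y) v

/-- This is the unitarity condition on the coaction with `x` applied to both sides. -/
theorem inner_dualAct (x : FullDual C) (v w : V) :
    inner ℂ v (M.dualAct x w) = inner ℂ (M.dualAct (star x) v) w := by
  rw [dualAct_apply, inner_sliceR, M.unitary, ← inner_conj_symm, dualAct_apply, inner_sliceR,
    fullDual_star_apply]
  simp

theorem dualAct_act (x : FullDual C) (b : D.B) (v : V) {n : ℕ} {b₀ : Fin n → D.B}
    {b₁ : Fin n → A} (h : D.coactB b = ∑ i, b₀ i ⊗ₜ[ℂ] b₁ i) :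
    M.dualAct x (M.act b v) = ∑ i, M.act (b₀ i) (M.dualAct (rightAct x (b₁ i)) v) := by
  rw [dualAct_apply, M.coact_act, h]
  exact sliceR_map₂_moduleMap _ _ _ _ _

/-- The action of the free algebra on `B` and the full dual of `C`. -/
noncomputable def freeAct : D.FreeDouble →ₐ[ℂ] Module.End ℂ V :=
  FreeAlgebra.lift ℂ (Sum.elim M.act M.dualActHom)

theorem freeAct_genB (b : D.B) : M.freeAct (D.genB b) = M.act b := by
  simp [freeAct, CQGCoidealDatum.genB]

theorem freeAct_genI (x : FullDual C) : M.freeAct (D.genI x) = M.dualActHom x := by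
  simp [freeAct, CQGCoidealDatum.genI]

theorem freeAct_rel {s t : D.FreeDouble} (h : D.DoubleRel s t) : M.freeAct s = M.freeAct t := by
  have inter : ∀ (x : FullDual C) (b : D.B) (n : ℕ) (b₀ : Fin n → D.B) (b₁ : Fin n → A)
      (_ : D.coactB b = ∑ i, b₀ i ⊗ₜ[ℂ] b₁ i), M.dualActHom x * M.act b =
        ∑ i, M.act (b₀ i) * M.dualActHom (rightAct x (b₁ i)) := by
    intro x b n b₀ b₁ h
    ext v
    simpa using! M.dualAct_act x b v h
  induction h with
  | B_add b b' => simp [freeAct_genB]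
  | B_smul r b => simp [freeAct_genB]
  | B_mul b b' => simp [freeAct_genB]
  | B_one => simp [freeAct_genB]
  | I_add x y => simp [freeAct_genI]
  | I_smul r x => simp [freeAct_genI]
  | I_mul x y => simp [freeAct_genI]
  | I_one => simp [freeAct_genI]
  | interchange x b n b₀ b₁ h =>
    simp only [map_mul, map_sum, freeAct_genB, freeAct_genI]
    exact inter x b n b₀ b₁ h
  | interchange_star x b n b₀ b₁ h =>
    simp only [map_mul, map_sum, freeAct_genB, freeAct_genI]
    ext v
    refine ext_inner_left ℂ fun w => ?_
    -- The adjoint relation follows from the interchange relation by moving all operators across the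
    -- inner product.
    have := congrArg (fun T : Module.End ℂ V => inner ℂ (T w) v) (inter x b n b₀ b₁ h)
    simpa [dualActHom_apply, inner_sum, sum_inner, M.inner_act, M.inner_dualAct] using this

/-- The action of `𝒟(B, 𝓘_full)` on a unitary Doi–Koppinen module. -/
noncomputable def doubleAct : D.FullDouble →ₐ[ℂ] Module.End ℂ V :=
  RingQuot.liftAlgHom ℂ ⟨M.freeAct, fun _ _ h => M.freeAct_rel h⟩

theorem doubleAct_toFullDouble (s : D.FreeDouble) :
    M.doubleAct (D.toFullDouble s) = M.freeAct s :=
  RingQuot.liftAlgHom_mkAlgHom_apply ℂ _ _ _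

theorem doubleAct_ofB (b : D.B) : M.doubleAct (D.ofB b) = M.act b := by
  rw [← D.toFullDouble_genB, doubleAct_toFullDouble, freeAct_genB]

theorem doubleAct_ofI (x : FullDual C) : M.doubleAct (D.ofI x) = M.dualAct x := by
  rw [← D.toFullDouble_genI, doubleAct_toFullDouble, freeAct_genI, dualActHom_apply]

theorem inner_doubleAct (s : D.FullDouble) (v w : V) :
    inner ℂ v (M.doubleAct s w) = inner ℂ (M.doubleAct (star s) v) w := by
  obtain ⟨s, rfl⟩ := D.toFullDouble_surjective s
  induction s using FreeAlgebra.induction generalizing v w with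
  | grade0 r =>
    rw [AlgHom.commutes, Algebra.algebraMap_eq_smul_one, star_smul, star_one, map_smul, map_smul,
      map_one]
    simp [mul_comm]
  | grade1 x =>
    rcases x with b | x
    · change inner ℂ v (M.doubleAct (D.ofB b) w) = inner ℂ (M.doubleAct (star (D.ofB b)) v) w
      rw [D.star_ofB, doubleAct_ofB, doubleAct_ofB, M.inner_act]
    · change inner ℂ v (M.doubleAct (D.ofI x) w) = inner ℂ (M.doubleAct (star (D.ofI x)) v) w
      rw [D.star_ofI, doubleAct_ofI, doubleAct_ofI, M.inner_dualAct]
  | mul s t hs ht =>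
    rw [map_mul, star_mul, map_mul, map_mul, Module.End.mul_apply, Module.End.mul_apply, hs, ht]
  | add s t hs ht =>
    rw [map_add, star_add, map_add, map_add, LinearMap.add_apply, LinearMap.add_apply,
      inner_add_right, inner_add_left, hs, ht]

theorem exists_bound_dualAct {x : FullDual C} (hx : x ∈ restrictedDual C) :
    ∃ K : ℝ, ∀ v, ‖M.dualAct x v‖ ≤ K * ‖v‖ :=
  exists_bound_of_mem_restrictedDual M.dualActHom M.inner_dualAct hx

theorem exists_bound_doubleAct {d : D.FullDouble} (hd : d ∈ D.spanBI) :
    ∃ K : ℝ, ∀ v, ‖M.doubleAct d v‖ ≤ K * ‖v‖ := by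
  induction hd using Submodule.span_induction with
  | mem d h =>
    obtain ⟨b, x, hx, rfl⟩ := h
    obtain ⟨K, hK⟩ := M.exists_bound_dualAct hx
    obtain ⟨L, hL⟩ := D.exists_bound_act M.act M.inner_act b
    refine ⟨|L| * K, fun v => ?_⟩
    rw [map_mul, doubleAct_ofB, doubleAct_ofI, Module.End.mul_apply, mul_assoc]
    refine (hL _).trans ?_
    exact (mul_le_mul_of_nonneg_right (le_abs_self L) (norm_nonneg _)).trans
      (mul_le_mul_of_nonneg_left (hK v) (abs_nonneg L))
  | zero => exact ⟨0, fun v => by simp⟩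
  | add d d' _ _ h h' =>
    obtain ⟨K, hK⟩ := h
    obtain ⟨L, hL⟩ := h'
    refine ⟨K + L, fun v => ?_⟩
    rw [map_add, LinearMap.add_apply, add_mul]
    exact (norm_add_le _ _).trans (add_le_add (hK v) (hL v))
  | smul r d _ h =>
    obtain ⟨K, hK⟩ := h
    refine ⟨‖r‖ * K, fun v => ?_⟩
    rw [map_smul, LinearMap.smul_apply, norm_smul, mul_assoc]
    exact mul_le_mul_of_nonneg_left (hK v) (norm_nonneg r)

/-- The actions of `B𝓘`, `B` and `𝓘` are bounded `*`-actions on `V`, so each extends to `H`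
separately; the factorisation of `ρ(b x)` holds on the dense range of `ι`, hence everywhere. -/
theorem exists_integrates {ι : V →ₗᵢ[ℂ] H} (hι : DenseRange ι) :
    ∃ ρ : D.double →⋆ₙₐ[ℂ] (H →L[ℂ] H), M.Integrates ι ρ := by
  obtain ⟨ρ, hρ⟩ := exists_nonUnitalStarAlgHom_extension (R := D.double) hι
    { toFun := fun d => M.doubleAct d.1
      map_smul' := fun r d => map_smul M.doubleAct r d.1
      map_zero' := map_zero M.doubleAct
      map_add' := fun d d' => map_add M.doubleAct d.1 d'.1
      map_mul' := fun d d' => map_mul M.doubleAct d.1 d'.1 }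
    (fun d v w => M.inner_doubleAct d.1 v w) fun d => M.exists_bound_doubleAct d.2
  obtain ⟨π, hπ⟩ := D.exists_starAlgHom_extension hι M.act M.inner_act
  obtain ⟨πhat, hπhat⟩ := exists_nonUnitalStarAlgHom_extension (R := restrictedDual C) hι
    { toFun := fun x => M.dualActHom x.1
      map_smul' := fun r d => map_smul M.dualActHom r d.1
      map_zero' := map_zero M.dualActHom
      map_add' := fun d d' => map_add M.dualActHom d.1 d'.1
      map_mul' := fun d d' => map_mul M.dualActHom d.1 d'.1 }
    (fun x v w => M.inner_dualAct x.1 v w) fun x => M.exists_bound_dualAct x.2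
  refine ⟨ρ, π, πhat, hπ, hπhat, fun b x => ContinuousLinearMap.ext_of_denseRange hι fun v => ?_⟩
  change ρ (D.mulBI b x) (ι v) = π b (πhat x (ι v))
  rw [hρ, hπhat, hπ]
  change ι (M.doubleAct (D.ofB b * D.ofI x) v) = ι (M.act b (M.dualAct x v))
  rw [map_mul, doubleAct_ofB, doubleAct_ofI, Module.End.mul_apply]

end UnitaryDKModule

theorem CQGCoidealDatum.mulBI_one (x : restrictedDual C) : D.mulBI 1 x = D.inclI x :=
  Subtype.ext (by simp [mulBI, inclI])

theorem CQGCoidealDatum.double_induction {p : D.double → Prop} (mulBI : ∀ b x, p (D.mulBI b x))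
    (zero : p 0) (add : ∀ d d', p d → p d' → p (d + d')) (smul : ∀ (r : ℂ) d, p d → p (r • d))
    (d : D.double) : p d := by
  obtain ⟨d, hd⟩ := d
  induction hd using Submodule.span_induction with
  | mem d hd =>
    obtain ⟨b, x, hx, rfl⟩ := hd
    exact mulBI b ⟨x, hx⟩
  | zero => exact zero
  | add d d' hd hd' h h' => exact add ⟨d, hd⟩ ⟨d', hd'⟩ h h'
  | smul r d hd h => exact smul r ⟨d, hd⟩ h

/-- Two homomorphisms on `𝓓(B, 𝓘)` agree if they agree on the products `b x`. -/
theorem CQGCoidealDatum.double_hom_ext {ρ ρ' : D.double →⋆ₙₐ[ℂ] (H →L[ℂ] H)}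
    (h : ∀ b x, ρ (D.mulBI b x) = ρ' (D.mulBI b x)) : ρ = ρ' :=
  NonUnitalStarAlgHom.ext (D.double_induction h (by simp)
    (fun d d' hd hd' => by rw [map_add, map_add, hd, hd'])
    fun r d hd => by rw [map_smul, map_smul, hd])

namespace UnitaryDKModule.Integrates

variable {M M' : UnitaryDKModule D V} {ι : V →ₗᵢ[ℂ] H} {ρ ρ' : D.double →⋆ₙₐ[ℂ] (H →L[ℂ] H)}

theorem mulBI_apply (h : M.Integrates ι ρ) (b : D.B) (x : restrictedDual C) (v : V) :
    ρ (D.mulBI b x) (ι v) = ι (M.act b (M.dualAct x v)) := by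
  obtain ⟨π, πhat, hπ, hπhat, hρ⟩ := h
  rw [hρ, mul_apply_eq_comp, hπhat, hπ]

theorem inclI_apply (h : M.Integrates ι ρ) (x : restrictedDual C) (v : V) :
    ρ (D.inclI x) (ι v) = ι (M.dualAct x v) := by
  rw [← D.mulBI_one, h.mulBI_apply, map_one, Module.End.one_apply]

theorem unique (hι : DenseRange ι) (h : M.Integrates ι ρ) (h' : M.Integrates ι ρ') : ρ = ρ' :=
  D.double_hom_ext fun b x => ContinuousLinearMap.ext_of_denseRange hι fun v => by
    rw [h.mulBI_apply, h'.mulBI_apply]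

end UnitaryDKModule.Integrates

namespace UnitaryDKModule

variable (M : UnitaryDKModule D V)

/-- The restricted dual acts on `M` with local units. -/
theorem exists_dualAct_eq (W : Submodule ℂ C) [FiniteDimensional ℂ W] :
    ∃ e ∈ restrictedDual C, ∀ v, M.coact v ∈ LinearMap.range (W.subtype.lTensor V) →
      M.dualAct e v = v := by
  obtain ⟨e, he, heW⟩ := D.exists_local_unit W
  refine ⟨e, he, fun v hv => ?_⟩
  rw [dualAct_apply, sliceR_lTensor_subtype hv heW]
  exact M.counital v

theorem exists_dualAct_eq_self (v : V) : ∃ e ∈ restrictedDual C, M.dualAct e v = v := by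
  obtain ⟨W, hW, h⟩ := finiteDimensional_range_sliceL (M.coact v)
  obtain ⟨e, he, h'⟩ := M.exists_dualAct_eq W
  exact ⟨e, he, h' v (mem_range_lTensor_of_sliceL h)⟩

end UnitaryDKModule

namespace UnitaryDKModule.Integrates

variable {M M' : UnitaryDKModule D V} {ι : V →ₗᵢ[ℂ] H} {ρ ρ' : D.double →⋆ₙₐ[ℂ] (H →L[ℂ] H)}

/-- A local unit `e` for the finitely many coefficients of `δ(v)` gives `ι v = ρ(e) (ι v)`. -/
theorem range_le_regularSpace (h : M.Integrates ι ρ) (v : V) : ι v ∈ D.regularSpace ρ := by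
  obtain ⟨e, he, hev⟩ := M.exists_dualAct_eq_self v
  refine Submodule.subset_span ⟨⟨e, he⟩, ι v, ?_⟩
  rw [h.inclI_apply]
  exact congrArg ι hev.symm

theorem isNondegenerate (hι : DenseRange ι) (h : M.Integrates ι ρ) : D.IsNondegenerate ρ := by
  refine Dense.mono ?_ hι
  rintro _ ⟨v, rfl⟩
  have : D.regularSpace ρ ≤ Submodule.span ℂ {h : H | ∃ d k, h = ρ d k} :=
    Submodule.span_mono (by rintro _ ⟨x, k, rfl⟩; exact ⟨_, k, rfl⟩)
  exact this (h.range_le_regularSpace v)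

end UnitaryDKModule.Integrates

end Modules

section Modules

/-! ### The module associated with a non-degenerate `*`-representation -/

variable {A C : Type*} [Ring A] [HopfAlgebra ℂ A] [StarRing A] [StarModule ℂ A]
  [CQGHopfStarAlgebra A]
  [AddCommGroup C] [Module ℂ C] [Coalgebra ℂ C] [StarAddMonoid C] [StarModule ℂ C]
  [DagCoalgebra C] [Module A C] [IsScalarTower ℂ A C] [ModuleDagCoalgebra A C]
  {D : CQGCoidealDatum A C}

theorem mul_mem_restrictedDual (x : FullDual C) {y : FullDual C} (hy : y ∈ restrictedDual C) :
    x * y ∈ restrictedDual C := by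
  have : FiniteDimensional ℂ (twoSidedSpan y) := hy
  exact finiteDimensional_twoSidedSpan_of_le (W := twoSidedSpan y) fun z w => by
    rw [← mul_assoc z]
    exact mul_mul_mem_twoSidedSpan y _ _

/-- For `y` in the restricted dual, left multiplication on `y` factors through finitely many
evaluations. -/
theorem exists_mul_eq_sum {y : FullDual C} (hy : y ∈ restrictedDual C) :
    ∃ (n : ℕ) (z : Fin n → FullDual C) (c : Fin n → C),
      ∀ x : FullDual C, x * y = ∑ i, x.ofConv (c i) • (z i * y) := by
  have := finiteDimensional_range_actR (mem_restrictedDual.1 hy)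
  -- Since `(x y)(d) = x(actR y d)`, expanding `actR y d` in a basis of the finite-dimensional range
  -- of `actR y` separates `x` from `d`. The `c_i` are the basis vectors and the `z_i` extend their
  -- coordinate functionals to `C`.
  let b := Module.finBasis ℂ (LinearMap.range (actR y))
  choose g hg using fun i => LinearMap.exists_extend (b.coord i)
  refine ⟨_, fun i => toConv (g i), fun i => b i, fun x => ?_⟩
  ext d
  have h1 : _ = actR y d := congrArg Subtype.val (b.sum_repr ⟨actR y d, d, rfl⟩)
  have h2 : ∀ i, (toConv (g i) * y).ofConv d = b.repr ⟨actR y d, d, rfl⟩ i := fun i => by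
    rw [← ofConv_actR]
    exact LinearMap.congr_fun (hg i) ⟨actR y d, d, rfl⟩
  rw [← ofConv_actR, ofConv_sum, LinearMap.sum_apply]
  simp only [ofConv_smul, LinearMap.smul_apply, h2]
  refine (congrArg x.ofConv h1).symm.trans ?_
  simp only [Submodule.coe_sum, Submodule.coe_smul, map_sum, map_smul, smul_eq_mul, mul_comm]

namespace CQGCoidealDatum

variable {V : Type*} [NormedAddCommGroup V] [InnerProductSpace ℂ V]

/-- A `*`-representation of `𝒟(B, 𝓘_full)` on a pre-Hilbert space in which the full dual acts
rationally comes from a unitary Doi–Koppinen module. -/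
theorem exists_dkModule_of_rational (Θ : D.FullDouble →ₐ[ℂ] Module.End ℂ V)
    (hΘ : ∀ s v w, inner ℂ v (Θ s w) = inner ℂ (Θ (star s) v) w)
    (hrat : ∀ v, ∃ t : V ⊗[ℂ] C, ∀ x : FullDual C, sliceR x.ofConv t = Θ (D.ofI x) v) :
    ∃ M : UnitaryDKModule D V, (∀ b, M.act b = Θ (D.ofB b)) ∧ ∀ x, M.dualAct x = Θ (D.ofI x) := by
  -- Slices determine tensors, so the chosen `δ` is automatically linear, and each comodule axiom is
  -- the slice form of an identity satisfied by `Θ`.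
  choose δ hδ using hrat
  let coact : V →ₗ[ℂ] V ⊗[ℂ] C :=
    { toFun := δ
      map_add' := fun v w => ext_sliceR fun f => by
        have h := fun u => hδ u (toConv f)
        simp only at h
        simp only [map_add, h]
      map_smul' := fun r v => ext_sliceR fun f => by
        have h := fun u => hδ u (toConv f)
        simp only at h
        simp only [map_smul, h, RingHom.id_apply] }
  have hc : ∀ (x : FullDual C) v, sliceR x.ofConv (coact v) = Θ (D.ofI x) v := fun x v => hδ v x
  refine ⟨⟨coact, fun v => coassoc_of_sliceR coact fun x y => ?_, fun v => ?_,
    Θ.comp D.ofB, fun b v => ext_sliceR fun f => ?_, fun b v w => ?_, fun v w => ?_⟩,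
    fun b => rfl, fun x => LinearMap.ext fun v => hc x v⟩
  · rw [hc, hc, hc, map_mul, map_mul, Module.End.mul_apply]
  · have h := hc 1 v
    rw [fullDual_one_ofConv, map_one, map_one] at h
    exact h
  · obtain ⟨n, b₀, b₁, h⟩ := D.exists_coactB_eq_sum b
    have h1 := hc (toConv f) (Θ (D.ofB b) v)
    rw [← Module.End.mul_apply, ← map_mul, D.ofI_mul_ofB _ b n b₀ b₁ h] at h1
    refine h1.trans ?_
    rw [h]
    refine Eq.trans ?_ (sliceR_map₂_moduleMap _ (toConv f) _ _ _).symm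
    simp only [map_sum, map_mul, LinearMap.sum_apply, Module.End.mul_apply, hc]
    rfl
  · change inner ℂ v (Θ (D.ofB b) w) = inner ℂ (Θ (D.ofB (star b)) v) w
    rw [hΘ, D.star_ofB]
  · refine ext_fullDual fun x => ?_
    rw [ofConv_star, ← inner_sliceR, ← inner_sliceR, hc, hc, hΘ, D.star_ofI]
    exact (inner_conj_symm _ _).symm

/-- Since `𝓘` is an ideal of the full dual and is stable under the action of `A`, `B𝓘` absorbs the
full double and not merely itself. This is what allows representations of `B𝓘` to extend. -/
theorem mul_mem_spanBI (s : D.FullDouble) {d : D.FullDouble} (hd : d ∈ D.spanBI) :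
    s * d ∈ D.spanBI := by
  obtain ⟨s, rfl⟩ := D.toFullDouble_surjective s
  induction s using FreeAlgebra.induction generalizing d with
  | grade0 r =>
    rw [AlgHom.commutes, ← Algebra.smul_def]
    exact Submodule.smul_mem _ r hd
  | grade1 x =>
    rcases x with b | x
    · exact D.ofB_mul_mem b hd
    · change D.ofI x * d ∈ D.spanBI
      induction hd using Submodule.span_induction with
      | mem d hd =>
        obtain ⟨b, y, hy, rfl⟩ := hd
        obtain ⟨n, b₀, b₁, h⟩ := D.exists_coactB_eq_sum b
        rw [← mul_assoc, D.ofI_mul_ofB x b n b₀ b₁ h, Finset.sum_mul]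
        refine Submodule.sum_mem _ fun i _ => ?_
        rw [mul_assoc, ← map_mul]
        exact D.ofB_mul_ofI_mem _ (mul_mem_restrictedDual _ hy)
      | zero => simp
      | add d d' _ _ h h' => rw [mul_add]; exact add_mem h h'
      | smul r d _ h => rw [mul_smul_comm]; exact Submodule.smul_mem _ r h
  | mul s t hs ht => rw [map_mul, mul_assoc]; exact hs (ht hd)
  | add s t hs ht => rw [map_add, add_mul]; exact add_mem (hs hd) (ht hd)

theorem mem_spanBI_mul (s : D.FullDouble) {d : D.FullDouble} (hd : d ∈ D.spanBI) :
    d * s ∈ D.spanBI := by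
  have := D.spanBI_star_mem (D.mul_mem_spanBI (star s) (D.spanBI_star_mem hd))
  rwa [star_mul, star_star, star_star] at this

/-- Left multiplication of `𝒟(B, 𝓘_full)` on its ideal `𝓓(B, 𝓘)`. -/
noncomputable def mulL (s : D.FullDouble) (d : D.double) : D.double :=
  ⟨s * d.1, D.mul_mem_spanBI s d.2⟩

/-- Right multiplication of `𝒟(B, 𝓘_full)` on its ideal `𝓓(B, 𝓘)`. -/
noncomputable def mulR (d : D.double) (s : D.FullDouble) : D.double :=
  ⟨d.1 * s, D.mem_spanBI_mul s d.2⟩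

/-- This multiplier identity `(d s) d' = d (s d')` makes the operator `ρ(d') k ↦ ρ(s d') k`
detectable through all `ρ(d)`. -/
theorem mulR_mul (d d' : D.double) (s : D.FullDouble) : D.mulR d s * d' = d * D.mulL s d' :=
  Subtype.ext (mul_assoc d.1 s d'.1)

theorem star_mulL (d : D.double) (s : D.FullDouble) :
    star (D.mulL s d) = D.mulR (star d) (star s) :=
  Subtype.ext (star_mul s d.1)

variable {H : Type*} [NormedAddCommGroup H] [InnerProductSpace ℂ H] [CompleteSpace H]

variable (D) in
/-- The linear span of the vectors `ρ(d) k`. -/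
noncomputable def essentialSpace (ρ : D.double →⋆ₙₐ[ℂ] (H →L[ℂ] H)) : Submodule ℂ H :=
  Submodule.span ℂ {h : H | ∃ d k, h = ρ d k}

variable {ρ : D.double →⋆ₙₐ[ℂ] (H →L[ℂ] H)}

theorem rep_mul_apply (d d' : D.double) (k : H) : ρ (d * d') k = ρ d (ρ d' k) := by
  rw [map_mul, mul_apply_eq_comp]

theorem inner_rep (d : D.double) (k l : H) : inner ℂ k (ρ d l) = inner ℂ (ρ (star d) k) l := by
  rw [map_star, ContinuousLinearMap.star_eq_adjoint, ContinuousLinearMap.adjoint_inner_left]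

theorem IsNondegenerate.eq_zero (hρ : D.IsNondegenerate ρ) {k : H} (h : ∀ d, ρ d k = 0) :
    k = 0 := by
  refine Dense.eq_zero_of_inner_left ℂ hρ fun v hv => ?_
  induction hv using Submodule.span_induction with
  | mem v hv =>
    obtain ⟨d, l, rfl⟩ := hv
    rw [inner_rep, h, inner_zero_left]
  | zero => simp
  | add v w _ _ hv hw => rw [inner_add_right, hv, hw, add_zero]
  | smul r v _ hv => rw [inner_smul_right, hv, mul_zero]

theorem IsNondegenerate.eq_of_forall (hρ : D.IsNondegenerate ρ) {k l : H}
    (h : ∀ d, ρ d k = ρ d l) : k = l :=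
  sub_eq_zero.1 (hρ.eq_zero fun d => by rw [map_sub, h, sub_self])

/-- `𝒟(B, 𝓘_full)` acts on the essential space of a non-degenerate `*`-representation of its ideal
`𝓓(B, 𝓘)`. -/
theorem exists_fullDouble_action (hρ : D.IsNondegenerate ρ) {S : Submodule ℂ H}
    (hS : S = D.essentialSpace ρ) : ∃ Θ : D.FullDouble →ₐ[ℂ] Module.End ℂ S,
      ∀ s (v : S) d, ρ d (Θ s v) = ρ (D.mulR d s) v := by
  -- The vector `s · v` is characterised by `ρ(d)(s · v) = ρ(d s) v` for all `d`. On `v = ρ(d) k`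
  -- the vector `ρ(s d) k` works; nondegeneracy gives uniqueness, so independence of the way `v` is
  -- written as a sum needs no separate argument.
  have hex : ∀ s (v : S), ∃ w : S, ∀ d, ρ d w = ρ (D.mulR d s) v := by
    rintro s ⟨v, hv⟩
    have hv' : v ∈ D.essentialSpace ρ := hS ▸ hv
    suffices h : ∃ w ∈ S, ∀ d, ρ d w = ρ (D.mulR d s) v by
      obtain ⟨w, hw, h⟩ := h
      exact ⟨⟨w, hw⟩, h⟩
    clear hv
    induction hv' using Submodule.span_induction with
    | mem v hv =>
      obtain ⟨d, k, rfl⟩ := hv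
      refine ⟨ρ (D.mulL s d) k, ?_, fun d' => ?_⟩
      · rw [hS]
        exact Submodule.subset_span ⟨_, _, rfl⟩
      · rw [← rep_mul_apply, ← rep_mul_apply, mulR_mul]
    | zero => exact ⟨0, zero_mem _, by simp⟩
    | add v v' _ _ h h' =>
      obtain ⟨w, hw, h⟩ := h
      obtain ⟨w', hw', h'⟩ := h'
      exact ⟨w + w', add_mem hw hw', fun d => by rw [map_add, map_add, h, h']⟩
    | smul r v _ h =>
      obtain ⟨w, hw, h⟩ := h
      exact ⟨r • w, Submodule.smul_mem _ r hw, fun d => by rw [map_smul, map_smul, h]⟩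
  choose F hF using hex
  have huniq : ∀ {v w : S}, (∀ d, ρ d v = ρ d w) → v = w := fun h => Subtype.ext (hρ.eq_of_forall h)
  refine ⟨AlgHom.ofLinearMap
    { toFun := fun s =>
        { toFun := F s
          map_add' := fun v w => huniq fun d => by simp [hF]
          map_smul' := fun r v => huniq fun d => by simp [hF] }
      map_add' := fun s t => LinearMap.ext fun v => huniq fun d => ?_
      map_smul' := fun r s => LinearMap.ext fun v => huniq fun d => ?_ }
    (LinearMap.ext fun v => huniq fun d => ?_)
    (fun s t => LinearMap.ext fun v => huniq fun d => ?_), hF⟩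
  · change ρ d (F (s + t) v : H) = ρ d ((F s v : H) + F t v)
    rw [map_add, hF, hF, hF, ← add_apply, ← map_add]
    congr 2
    exact Subtype.ext (mul_add d.1 s t)
  · change ρ d (F (r • s) v : H) = ρ d (r • (F s v : H))
    rw [map_smul, hF, hF, ← smul_apply, ← map_smul]
    congr 2
    exact Subtype.ext (mul_smul_comm r d.1 s)
  · change ρ d (F 1 v : H) = ρ d v
    rw [hF]
    congr 2
    exact Subtype.ext (mul_one d.1)
  · change ρ d (F (s * t) v : H) = ρ d (F s (F t v) : H)
    rw [hF, hF, hF]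
    congr 2
    exact Subtype.ext (mul_assoc d.1 s t).symm

section Action

variable {S : Submodule ℂ H} {Θ : D.FullDouble →ₐ[ℂ] Module.End ℂ S}

theorem action_apply_rep (hρ : D.IsNondegenerate ρ)
    (hΘ : ∀ s (v : S) d, ρ d (Θ s v) = ρ (D.mulR d s) v) (s : D.FullDouble) (d : D.double) (k : H)
    (hv : ρ d k ∈ S) : (Θ s ⟨ρ d k, hv⟩ : H) = ρ (D.mulL s d) k :=
  hρ.eq_of_forall fun d' => by
    rw [hΘ, ← rep_mul_apply, ← rep_mul_apply, mulR_mul]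

theorem inner_action (hρ : D.IsNondegenerate ρ) (hS : S = D.essentialSpace ρ)
    (hΘ : ∀ s (v : S) d, ρ d (Θ s v) = ρ (D.mulR d s) v) (s : D.FullDouble) (v w : S) :
    inner ℂ v (Θ s w) = inner ℂ (Θ (star s) v) w := by
  obtain ⟨w, hw⟩ := w
  have hw' : w ∈ D.essentialSpace ρ := hS ▸ hw
  induction hw' using Submodule.span_induction with
  | mem w h =>
    obtain ⟨d, k, rfl⟩ := h
    rw [Submodule.coe_inner, Submodule.coe_inner, action_apply_rep hρ hΘ, inner_rep, star_mulL,
      inner_rep, hΘ]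
  | zero =>
    have : (⟨0, hw⟩ : S) = 0 := rfl
    rw [this, map_zero, inner_zero_right, inner_zero_right]
  | add x y hx hy h h' =>
    have : (⟨x + y, hw⟩ : S) = ⟨x, hS ▸ hx⟩ + ⟨y, hS ▸ hy⟩ := rfl
    rw [this, map_add, inner_add_right, inner_add_right, h, h']
  | smul r x hx h =>
    have : (⟨r • x, hw⟩ : S) = r • ⟨x, hS ▸ hx⟩ := rfl
    rw [this, map_smul, inner_smul_right, inner_smul_right, h]

/-- The extension of the action of `B` on the essential space to `H`. -/
theorem exists_rep_B (hρ : D.IsNondegenerate ρ) (hS : S = D.essentialSpace ρ)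
    (hΘ : ∀ s (v : S) d, ρ d (Θ s v) = ρ (D.mulR d s) v) :
    ∃ π : D.B →⋆ₐ[ℂ] (H →L[ℂ] H), (∀ b (v : S), π b v = Θ (D.ofB b) v) ∧
      (∀ b x, ρ (D.mulBI b x) = π b * ρ (D.inclI x)) ∧
      ∀ b d, ρ (D.mulR d (D.ofB b)) = ρ d * π b := by
  have hdense : DenseRange S.subtypeₗᵢ := by
    refine Dense.denseRange_val ?_
    rw [hS]
    exact hρ
  obtain ⟨π, hπ⟩ := D.exists_starAlgHom_extension hdense (Θ.comp D.ofB) fun b v w => by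
    change inner ℂ v (Θ (D.ofB b) w) = inner ℂ (Θ (D.ofB (star b)) v) w
    rw [inner_action hρ hS hΘ, D.star_ofB]
  refine ⟨π, hπ, fun b x => ContinuousLinearMap.ext fun k => ?_,
    fun b d => ContinuousLinearMap.ext_of_denseRange hdense fun v => ?_⟩
  · have hx : ρ (D.inclI x) k ∈ S := by
      rw [hS]
      exact Submodule.subset_span ⟨_, _, rfl⟩
    rw [mul_apply_eq_comp]
    refine Eq.trans ?_ (hπ b ⟨_, hx⟩).symm
    exact (action_apply_rep hρ hΘ (D.ofB b) (D.inclI x) k hx).symm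
  · rw [mul_apply_eq_comp, hπ]
    exact (hΘ (D.ofB b) v d).symm

end Action

/-- The adjoint interchange relation writes `b x` as a sum `∑ x_i b_i` with `x_i ∈ 𝓘`. Because `B`
acts by bounded operators `π(b_i)` on all of `H`, `ρ(b x) k = ∑ ρ(x_i) π(b_i) k` lies in `ρ(𝓘) H`.
-/
theorem regularSpace_eq_essentialSpace (hρ : D.IsNondegenerate ρ) :
    D.regularSpace ρ = D.essentialSpace ρ := by
  refine le_antisymm (Submodule.span_mono (by rintro _ ⟨x, k, rfl⟩; exact ⟨_, k, rfl⟩))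
    (Submodule.span_le.2 ?_)
  obtain ⟨Θ, hΘ⟩ := exists_fullDouble_action hρ rfl
  obtain ⟨π, -, -, hπ⟩ := exists_rep_B hρ rfl hΘ
  rintro _ ⟨d, k, rfl⟩
  change ρ d k ∈ D.regularSpace ρ
  induction d using D.double_induction with
  | mulBI b x =>
    -- The relation is applied to `b^*` and `x^*`, so that its left hand side becomes `b x`.
    obtain ⟨n, b₀, b₁, h⟩ := D.exists_coactB_eq_sum (star b)
    have h1 := D.ofB_star_mul_ofI_star (star x.1) (star b) n b₀ b₁ h
    rw [star_star, star_star] at h1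
    have h2 : D.mulBI b x = ∑ i, D.mulR (D.inclI ⟨star (rightAct (star x.1) (b₁ i)),
        star_mem (rightAct_mem_restrictedDual (star_mem x.2) _)⟩) (D.ofB (star (b₀ i))) := by
      apply Subtype.ext
      refine h1.trans ?_
      rw [AddSubmonoidClass.coe_finsetSum]
      rfl
    rw [h2, map_sum, sum_apply]
    refine Submodule.sum_mem _ fun i _ => ?_
    rw [hπ, mul_apply_eq_comp]
    exact Submodule.subset_span ⟨_, _, rfl⟩
  | zero => simp
  | add d d' h h' =>
    rw [map_add, add_apply]
    exact add_mem h h'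
  | smul r d h =>
    rw [map_smul, smul_apply]
    exact Submodule.smul_mem _ r h

/-- The canonical homomorphism `𝓘 → 𝓓(B, 𝓘)`. -/
noncomputable def inclIHom (D : CQGCoidealDatum A C) : restrictedDual C →⋆ₙₐ[ℂ] D.double where
  toFun := D.inclI
  map_smul' r x := Subtype.ext (map_smul D.ofI r x.1)
  map_zero' := Subtype.ext (map_zero D.ofI)
  map_add' x y := Subtype.ext (map_add D.ofI x.1 y.1)
  map_mul' x y := Subtype.ext (map_mul D.ofI x.1 y.1)
  map_star' x := Subtype.ext (D.star_ofI x.1).symm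

/-- The action of the full double on `ρ(B𝓘)H = ρ(𝓘)H` is rational: for `y ∈ 𝓘`, `exists_mul_eq_sum`
expresses `x · ρ(y) k = ρ(x y) k` as a slice by `x` of one tensor independent of `x`. -/
theorem exists_dkModule_integrates (hρ : D.IsNondegenerate ρ) :
    ∃ M : UnitaryDKModule D (D.regularSpace ρ), M.Integrates (D.regularSpace ρ).subtypeₗᵢ ρ := by
  have hS := regularSpace_eq_essentialSpace hρ
  obtain ⟨Θ, hΘ⟩ := exists_fullDouble_action hρ hS
  obtain ⟨π, hπ, hπI, -⟩ := exists_rep_B hρ hS hΘ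
  have hI : ∀ (x : FullDual C) (y : restrictedDual C) (k : H) (hk : ρ (D.inclI y) k ∈ _),
      (Θ (D.ofI x) ⟨ρ (D.inclI y) k, hk⟩ : H) =
        ρ (D.inclI ⟨x * y.1, mul_mem_restrictedDual x y.2⟩) k := by
    intro x y k hk
    rw [action_apply_rep hρ hΘ]
    congr 2
    exact Subtype.ext (map_mul D.ofI x y.1).symm
  have hmem : ∀ y k, ρ (D.inclI y) k ∈ D.regularSpace ρ := fun y k =>
    Submodule.subset_span ⟨y, k, rfl⟩
  obtain ⟨M, hM, hM'⟩ := exists_dkModule_of_rational Θ (inner_action hρ hS hΘ) (by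
    rintro ⟨v, hv⟩
    induction hv using Submodule.span_induction with
    | mem v h =>
      obtain ⟨y, k, rfl⟩ := h
      obtain ⟨n, z, c, hz⟩ := exists_mul_eq_sum y.2
      refine ⟨∑ i, (⟨ρ (D.inclI ⟨z i * y.1, mul_mem_restrictedDual _ y.2⟩) k, hmem _ _⟩ :
        D.regularSpace ρ) ⊗ₜ c i, fun x => Subtype.ext ?_⟩
      refine Eq.trans ?_ (hI x y k (hmem y k)).symm
      rw [map_sum, Submodule.coe_sum]
      have h1 : (⟨x * y.1, mul_mem_restrictedDual x y.2⟩ : restrictedDual C) =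
          ∑ i, x.ofConv (c i) • ⟨z i * y.1, mul_mem_restrictedDual _ y.2⟩ := by
        apply Subtype.ext
        rw [AddSubmonoidClass.coe_finsetSum]
        exact hz x
      rw [h1]
      change _ = ρ (D.inclIHom _) k
      rw [map_sum, map_sum, sum_apply]
      refine Finset.sum_congr rfl fun i _ => ?_
      rw [map_smul, map_smul, sliceR_tmul]
      rfl
    | zero => exact ⟨0, fun x => by rw [map_zero]; exact (map_zero (Θ (D.ofI x))).symm⟩
    | add v w hv hw h h' =>
      obtain ⟨t, ht⟩ := h
      obtain ⟨t', ht'⟩ := h'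
      exact ⟨t + t', fun x => by
        rw [map_add, ht, ht']; exact (map_add (Θ (D.ofI x)) ⟨v, hv⟩ ⟨w, hw⟩).symm⟩
    | smul r v hv h =>
      obtain ⟨t, ht⟩ := h
      exact ⟨r • t, fun x => by
        rw [map_smul, ht]; exact (map_smul (Θ (D.ofI x)) r ⟨v, hv⟩).symm⟩)
  refine ⟨M, π, ρ.comp D.inclIHom, fun b v => ?_, fun x v => ?_, hπI⟩
  · rw [hM]
    exact hπ b v
  · rw [hM']
    -- Both vectors become `ρ(d x) v` after applying `ρ(d)`, which suffices by nondegeneracy.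
    refine hρ.eq_of_forall fun d => ?_
    change ρ d (ρ (D.inclI x) v) = ρ d (Θ (D.ofI x) v : H)
    rw [hΘ, ← rep_mul_apply]
    rfl

end CQGCoidealDatum

end Modules

section Modules

variable {A C : Type*} [Ring A] [HopfAlgebra ℂ A] [StarRing A] [StarModule ℂ A]
  [CQGHopfStarAlgebra A]
  [AddCommGroup C] [Module ℂ C] [Coalgebra ℂ C] [StarAddMonoid C] [StarModule ℂ C]
  [DagCoalgebra C] [Module A C] [IsScalarTower ℂ A C] [ModuleDagCoalgebra A C]
  {D : CQGCoidealDatum A C} {V V' H H' : Type*} [NormedAddCommGroup V] [InnerProductSpace ℂ V]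
  [NormedAddCommGroup V'] [InnerProductSpace ℂ V']
  [NormedAddCommGroup H] [InnerProductSpace ℂ H] [CompleteSpace H]
  [NormedAddCommGroup H'] [InnerProductSpace ℂ H'] [CompleteSpace H']

/-! ### Intertwiners -/

namespace UnitaryDKModule

/-- A representation of `B𝓘` only sees the operators `b x` with `x ∈ 𝓘`. A common local unit lets
the action of `b`, and of an arbitrary functional `x`, be replaced by those of `b e` and `x e` on
both vectors at once. -/
theorem exists_common_unit (M : UnitaryDKModule D V) (M' : UnitaryDKModule D V') (v : V) (v' : V') :
    ∃ e : restrictedDual C, M.dualAct e.1 v = v ∧ M'.dualAct e.1 v' = v' := by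
  obtain ⟨W, hW, h⟩ := finiteDimensional_range_sliceL (M.coact v)
  obtain ⟨W', hW', h'⟩ := finiteDimensional_range_sliceL (M'.coact v')
  obtain ⟨e, he, heW⟩ := D.exists_local_unit (W ⊔ W')
  refine ⟨⟨e, he⟩, ?_, ?_⟩
  · rw [dualAct_apply, sliceR_lTensor_subtype (mem_range_lTensor_of_sliceL h)
      fun c hc => heW c (Submodule.mem_sup_left hc)]
    exact M.counital v
  · rw [dualAct_apply, sliceR_lTensor_subtype (mem_range_lTensor_of_sliceL h')
      fun c hc => heW c (Submodule.mem_sup_right hc)]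
    exact M'.counital v'

variable {M : UnitaryDKModule D V} {M' : UnitaryDKModule D V'}

theorem IsUnitaryIntertwiner.dualAct {T : V ≃ₗᵢ[ℂ] V'} (hT : M.IsUnitaryIntertwiner M' T)
    (x : FullDual C) (v : V) : T (M.dualAct x v) = M'.dualAct x (T v) := by
  rw [dualAct_apply, dualAct_apply, ← hT.2, LinearMap.rTensor, sliceR_map]
  rfl

variable {ι : V →ₗᵢ[ℂ] H} {ι' : V' →ₗᵢ[ℂ] H'} {ρ : D.double →⋆ₙₐ[ℂ] (H →L[ℂ] H)}
  {ρ' : D.double →⋆ₙₐ[ℂ] (H' →L[ℂ] H')}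

/-- The restriction of a unitary equivalence of `*`-representations is an intertwiner. -/
theorem isUnitaryIntertwiner_of_extends (h : M.Integrates ι ρ) (h' : M'.Integrates ι' ρ')
    {T : V ≃ₗᵢ[ℂ] V'} {U : H ≃ₗᵢ[ℂ] H'} (hU : ∀ d k, U (ρ d k) = ρ' d (U k))
    (hT : ∀ v, ι' (T v) = U (ι v)) : M.IsUnitaryIntertwiner M' T := by
  refine ⟨fun b v => ?_, fun v => ext_sliceR fun f => ?_⟩
  · obtain ⟨e, he, he'⟩ := M.exists_common_unit M' v (T v)
    apply ι'.injective
    rw [hT]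
    conv_lhs => rw [← he]
    conv_rhs => rw [← he']
    rw [← h.mulBI_apply, ← h'.mulBI_apply, hU, hT]
  · obtain ⟨e, he, he'⟩ := M.exists_common_unit M' v (T v)
    let x : FullDual C := toConv f
    -- The functional `f` need not lie in `𝓘`, but its product with the local unit does and acts in
    -- the same way on both vectors.
    let y : restrictedDual C := ⟨x * e.1, mul_mem_restrictedDual x e.2⟩
    have h1 : M.dualAct x v = M.dualAct y.1 v := by rw [M.dualAct_mul, he]
    have h2 : M'.dualAct x (T v) = M'.dualAct y.1 (T v) := by rw [M'.dualAct_mul, he']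
    rw [LinearMap.rTensor, sliceR_map]
    change T (M.dualAct x v) = M'.dualAct x (T v)
    apply ι'.injective
    rw [h1, h2, hT, ← h.inclI_apply, ← h'.inclI_apply, hU, hT]

/-- The identity of `H` restricts to the identity of `V`, which is then an intertwiner between the
two structures. -/
theorem Integrates.module_unique {M' : UnitaryDKModule D V} (h : M.Integrates ι ρ)
    (h' : M'.Integrates ι ρ) : M = M' := by
  have hT := isUnitaryIntertwiner_of_extends (T := LinearIsometryEquiv.refl ℂ V)
    (U := LinearIsometryEquiv.refl ℂ H) h h' (fun _ _ => rfl) fun _ => rfl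
  refine UnitaryDKModule.ext (LinearMap.ext fun v => ?_)
    (AlgHom.ext fun b => LinearMap.ext fun v => hT.1 b v)
  refine Eq.trans ?_ (hT.2 v)
  exact (LinearMap.congr_fun (LinearMap.rTensor_id C V) (M.coact v)).symm

theorem IsUnitaryIntertwiner.exists_unitary_equiv (hι : DenseRange ι) (hι' : DenseRange ι')
    (h : M.Integrates ι ρ) (h' : M'.Integrates ι' ρ') {T : V ≃ₗᵢ[ℂ] V'}
    (hT : M.IsUnitaryIntertwiner M' T) :
    ∃ U : H ≃ₗᵢ[ℂ] H', ∀ d k, U (ρ d k) = ρ' d (U k) := by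
  let U : H ≃ₗᵢ[ℂ] H' := T.toLinearEquiv.extendOfIsometry ι.toLinearMap ι'.toLinearMap hι hι'
    fun v => by simp
  have hU : ∀ v, U (ι v) = ι' (T v) := fun v =>
    LinearEquiv.extendOfIsometry_eq T.toLinearEquiv ι.toLinearMap ι'.toLinearMap hι hι' _ v
  refine ⟨U, fun d => ?_⟩
  induction d using D.double_induction with
  | mulBI b x =>
    refine congrFun (hι.equalizer (by fun_prop) (by fun_prop) (funext fun v => ?_))
    change U (ρ (D.mulBI b x) (ι v)) = ρ' (D.mulBI b x) (U (ι v))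
    rw [h.mulBI_apply, hU, hU, h'.mulBI_apply, hT.1, hT.dualAct]
  | zero => simp
  | add d d' hd hd' => intro k; simp [hd, hd']
  | smul r d hd => intro k; simp [hd]

/-! ### Local completeness -/

/-- The subspace of `H` corresponding to the vectors `v` with `δ(v) ∈ V ⊗ E`. -/
def spectralSet (M : UnitaryDKModule D V) (E : Submodule ℂ C) : Set V :=
  {v | M.coact v ∈ LinearMap.range (E.subtype.lTensor V)}

omit [CompleteSpace H] in
theorem isComplete_image_iff_spectralSet (E : Submodule ℂ C) :
    IsComplete (ι '' M.spectralSet E) ↔ IsComplete (M.spectralSet E) :=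
  isComplete_image_iff ι.isometry.isUniformInducing

/-- For `x ∈ 𝓘` choose a finite-dimensional subcoalgebra `E` containing the range of `actR x`. Then
`x` maps `V` into the spectral subspace of `E`; this subspace is complete, hence closed in `H`, so
by density `ρ(x)` maps all of `H` into it. -/
theorem IsLocallyComplete.regularSpace_eq (hM : M.IsLocallyComplete) (hι : DenseRange ι)
    (h : M.Integrates ι ρ) : D.regularSpace ρ = LinearMap.range ι.toLinearMap := by
  refine le_antisymm (Submodule.span_le.2 ?_)
    (by rintro _ ⟨v, rfl⟩; exact h.range_le_regularSpace v)
  rintro _ ⟨x, k, rfl⟩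
  have := finiteDimensional_range_actR (mem_restrictedDual.1 x.2)
  obtain ⟨E, hE, hxE, hR, hL⟩ := exists_finiteDimensional_stable (LinearMap.range (actR x.1))
  have hclosed : IsClosed (ι '' M.spectralSet E) :=
    ((isComplete_image_iff_spectralSet E).2
      (hM E hE (isSubcoalgebra_of_actR_of_actL hR hL))).isClosed
  have hmem : ∀ k, ρ (D.inclI x) k ∈ ι '' M.spectralSet E := fun k => by
    refine hι.induction_on (p := fun k => ρ (D.inclI x) k ∈ ι '' M.spectralSet E) k
      (hclosed.preimage (ρ (D.inclI x)).continuous) fun v => ?_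
    rw [h.inclI_apply]
    refine ⟨_, mem_range_lTensor_of_sliceR_eq_zero fun f hf => ?_, rfl⟩
    -- A functional `f` vanishing on `E` satisfies `f * x = 0`, so all slices of `δ(x · v)` along
    -- such `f` vanish and `δ(x · v)` lies in `V ⊗ E`.
    have h0 : toConv f * x.1 = 0 := by
      ext c
      rw [← ofConv_actR]
      exact hf _ (hxE ⟨c, rfl⟩)
    have h1 := M.dualAct_mul (toConv f) x.1 v
    rw [h0] at h1
    refine h1.symm.trans ?_
    exact LinearMap.congr_fun (map_zero M.dualActHom) v
  obtain ⟨v, -, hv⟩ := hmem k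
  exact ⟨v, hv⟩

/-- The spectral subspace of `E` is cut out inside `H` by closed conditions: `ρ(e) k = k` for a
local unit `e` of `E`, and `ρ(x e) k = 0` for all `x` vanishing on `E`. The first condition already
places `k` in the range of `ι`. -/
theorem Integrates.isLocallyComplete (h : M.Integrates ι ρ)
    (hr : ∀ x k, ρ (D.inclI x) k ∈ Set.range ι) : M.IsLocallyComplete := by
  intro E hE _
  change IsComplete (M.spectralSet E)
  rw [← isComplete_image_iff_spectralSet (ι := ι)]
  obtain ⟨e, he, hev⟩ := M.exists_dualAct_eq E
  let y : FullDual C → restrictedDual C := fun x => ⟨x * e, mul_mem_restrictedDual x he⟩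
  have heq : ι '' M.spectralSet E = {k | ρ (D.inclI ⟨e, he⟩) k = k} ∩
      ⋂ (x : FullDual C) (_ : ∀ c ∈ E, x.ofConv c = 0), {k | ρ (D.inclI (y x)) k = 0} := by
    ext k
    simp only [Set.mem_inter_iff, Set.mem_ofPred_eq, Set.mem_iInter]
    constructor
    · rintro ⟨v, hv, rfl⟩
      have hv1 := hev v hv
      refine ⟨by rw [h.inclI_apply, hv1], fun x hx => ?_⟩
      have h2 : M.dualAct x v = 0 := by
        rw [dualAct_apply, sliceR_lTensor_subtype hv (g := 0) hx]
        simp [sliceR]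
      rw [h.inclI_apply, M.dualAct_mul, hv1, h2, map_zero]
    · rintro ⟨hk, hx⟩
      obtain ⟨v, rfl⟩ : k ∈ Set.range ι := hk ▸ hr _ _
      refine ⟨v, mem_range_lTensor_of_sliceR_eq_zero fun f hf => ?_, rfl⟩
      have h1 := hx (toConv f) hf
      rw [h.inclI_apply] at hk h1
      have hk' : M.dualAct e v = v := ι.injective hk
      rw [M.dualAct_mul, hk'] at h1
      exact ι.injective (h1.trans (map_zero ι).symm)
  rw [heq]
  refine IsClosed.isComplete (IsClosed.inter (isClosed_eq (by fun_prop) (by fun_prop)) ?_)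
  exact isClosed_iInter fun x => isClosed_iInter fun _ =>
    isClosed_eq (by fun_prop) (by fun_prop)

/-- A unitary equivalence carries `ρ(𝓘)H` onto `ρ'(𝓘)H'`; by local completeness these are the two
modules themselves, so it restricts to them. -/
theorem IsLocallyComplete.exists_intertwiner (hM : M.IsLocallyComplete)
    (hM' : M'.IsLocallyComplete) (hι : DenseRange ι) (hι' : DenseRange ι') (h : M.Integrates ι ρ)
    (h' : M'.Integrates ι' ρ') {U : H ≃ₗᵢ[ℂ] H'} (hU : ∀ d k, U (ρ d k) = ρ' d (U k)) :
    ∃ T : V ≃ₗᵢ[ℂ] V', M.IsUnitaryIntertwiner M' T := by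
  have hr := hM.regularSpace_eq hι h
  have hr' := hM'.regularSpace_eq hι' h'
  have h1 : ∀ v, ∃ v', ι' v' = U (ι v) := fun v => by
    have : D.regularSpace ρ ≤ (D.regularSpace ρ').comap U.toLinearEquiv.toLinearMap :=
      Submodule.span_le.2 (by
        rintro _ ⟨x, k, rfl⟩
        exact Submodule.subset_span ⟨x, U k, hU _ _⟩)
    have hv := this (h.range_le_regularSpace v)
    rw [hr'] at hv
    exact hv
  have h2 : ∀ v', ∃ v, U (ι v) = ι' v' := fun v' => by
    have : D.regularSpace ρ' ≤ (D.regularSpace ρ).map U.toLinearEquiv.toLinearMap :=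
      Submodule.span_le.2 (by
        rintro _ ⟨x, k, rfl⟩
        refine ⟨_, Submodule.subset_span ⟨x, U.symm k, rfl⟩, (hU _ _).trans ?_⟩
        rw [LinearIsometryEquiv.apply_symm_apply])
    obtain ⟨k, hk, hk'⟩ := this (h'.range_le_regularSpace v')
    rw [hr] at hk
    obtain ⟨v, rfl⟩ := hk
    exact ⟨v, hk'⟩
  choose f hf using h1
  let fL : V →ₗᵢ[ℂ] V' :=
    { toFun := f
      map_add' := fun v w => ι'.injective (by simp [hf])
      map_smul' := fun r v => ι'.injective (by simp [hf])
      norm_map' := fun v => by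
        change ‖f v‖ = ‖v‖
        rw [← ι'.norm_map, hf, U.norm_map, ι.norm_map] }
  have hsurj : Function.Surjective fL := fun v' => by
    obtain ⟨v, hv⟩ := h2 v'
    exact ⟨v, ι'.injective ((hf v).trans hv)⟩
  exact ⟨LinearIsometryEquiv.ofSurjective fL hsurj,
    isUnitaryIntertwiner_of_extends h h' hU fun v => hf v⟩

end UnitaryDKModule

/-! ### Locally complete modules realised as dense subspaces of a fixed Hilbert space. -/

namespace DenseLCModule

omit [CompleteSpace H] in
theorem denseRange (P : DenseLCModule D H) : DenseRange P.space.subtypeₗᵢ :=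
  P.dense_space.denseRange_val

variable {ρ : D.double →⋆ₙₐ[ℂ] (H →L[ℂ] H)}

theorem space_eq {P : DenseLCModule D H} (h : P.dkModule.Integrates P.space.subtypeₗᵢ ρ) :
    P.space = D.regularSpace ρ := by
  rw [P.isLocallyComplete.regularSpace_eq P.denseRange h]
  exact (Submodule.range_subtype P.space).symm

theorem eq_of_integrates {P Q : DenseLCModule D H}
    (hP : P.dkModule.Integrates P.space.subtypeₗᵢ ρ)
    (hQ : Q.dkModule.Integrates Q.space.subtypeₗᵢ ρ) : P = Q := by
  have h := (space_eq hP).trans (space_eq hQ).symm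
  obtain ⟨S, hS, M, hM⟩ := P
  obtain ⟨S', hS', M', hM'⟩ := Q
  -- The underlying subspaces have to be identified first, since the module structures are only
  -- comparable on the same space.
  obtain rfl : S = S' := h
  obtain rfl : M = M' := hP.module_unique hQ
  rfl

theorem exists_integrates (hρ : D.IsNondegenerate ρ) :
    ∃ P : DenseLCModule D H, P.dkModule.Integrates P.space.subtypeₗᵢ ρ := by
  obtain ⟨M, hM⟩ := CQGCoidealDatum.exists_dkModule_integrates hρ
  refine ⟨⟨D.regularSpace ρ, ?_, M, hM.isLocallyComplete fun x k => ?_⟩, hM⟩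
  · rw [CQGCoidealDatum.regularSpace_eq_essentialSpace hρ]
    exact hρ
  · exact ⟨⟨_, Submodule.subset_span ⟨x, k, rfl⟩⟩, rfl⟩

end DenseLCModule

end Modules

/-! ### Assembly of the correspondence. -/

theorem mainTheorem1 {A : Type u} {C : Type v}
    [Ring A] [HopfAlgebra ℂ A] [StarRing A] [StarModule ℂ A] [CQGHopfStarAlgebra A]
    [AddCommGroup C] [Module ℂ C] [Coalgebra ℂ C] [StarAddMonoid C] [StarModule ℂ C]
    [DagCoalgebra C] [Module A C] [IsScalarTower ℂ A C] [ModuleDagCoalgebra A C]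
    (D : CQGCoidealDatum A C) :
    -- every unitary Doi–Koppinen module completes to a unique non-degenerate `*`-representation
    (∀ (V : Type w) [NormedAddCommGroup V] [InnerProductSpace ℂ V] (M : UnitaryDKModule D V),
      ∃ ρ : D.double →⋆ₙₐ[ℂ]
          (UniformSpace.Completion V →L[ℂ] UniformSpace.Completion V),
        D.IsNondegenerate ρ ∧ M.Integrates UniformSpace.Completion.toComplₗᵢ ρ ∧
        ∀ ρ', M.Integrates UniformSpace.Completion.toComplₗᵢ ρ' → ρ' = ρ) ∧
    -- conversely, `ρ(𝓘) H` carries a unique compatible structure, for `ρ` non-degenerate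
    (∀ (H : Type w) [NormedAddCommGroup H] [InnerProductSpace ℂ H] [CompleteSpace H]
      (ρ : D.double →⋆ₙₐ[ℂ] (H →L[ℂ] H)), D.IsNondegenerate ρ →
      ∃! M : UnitaryDKModule D (D.regularSpace ρ),
        M.Integrates (D.regularSpace ρ).subtypeₗᵢ ρ) ∧
    -- for each Hilbert space `H`, these constructions are mutually inverse bijections between the
    -- locally complete modules with completion `H` and the non-degenerate `*`-representations on `H`
    (∀ (H : Type w) [NormedAddCommGroup H] [InnerProductSpace ℂ H] [CompleteSpace H],
      ∃ e : DenseLCModule D H ≃ {ρ : D.double →⋆ₙₐ[ℂ] (H →L[ℂ] H) // D.IsNondegenerate ρ},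
        (∀ P : DenseLCModule D H, P.dkModule.Integrates P.space.subtypeₗᵢ (e P).1) ∧
        ∀ ρ, (e.symm ρ).space = D.regularSpace ρ.1) ∧
    -- two locally complete modules are unitarily isomorphic if and only if the associated
    -- `*`-representations are unitarily equivalent
    (∀ (V V' H H' : Type w) [NormedAddCommGroup V] [InnerProductSpace ℂ V]
      [NormedAddCommGroup V'] [InnerProductSpace ℂ V']
      [NormedAddCommGroup H] [InnerProductSpace ℂ H] [CompleteSpace H]
      [NormedAddCommGroup H'] [InnerProductSpace ℂ H'] [CompleteSpace H']
      (M : UnitaryDKModule D V) (M' : UnitaryDKModule D V')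
      (ι : V →ₗᵢ[ℂ] H) (ι' : V' →ₗᵢ[ℂ] H')
      (ρ : D.double →⋆ₙₐ[ℂ] (H →L[ℂ] H)) (ρ' : D.double →⋆ₙₐ[ℂ] (H' →L[ℂ] H')),
      M.IsLocallyComplete → M'.IsLocallyComplete → DenseRange ι → DenseRange ι' →
      M.Integrates ι ρ → M'.Integrates ι' ρ' →
      ((∃ T : V ≃ₗᵢ[ℂ] V', M.IsUnitaryIntertwiner M' T) ↔
        ∃ U : H ≃ₗᵢ[ℂ] H', ∀ d h, U (ρ d h) = ρ' d (U h))) := by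
  refine ⟨fun V _ _ M => ?_, fun H _ _ _ ρ hρ => ?_, fun H _ _ _ => ?_,
    fun V V' H H' _ _ _ _ _ _ _ _ _ _ M M' ι ι' ρ ρ' hM hM' hι hι' h h' => ?_⟩
  · have hι : DenseRange (UniformSpace.Completion.toComplₗᵢ (𝕜 := ℂ) (E := V)) :=
      UniformSpace.Completion.denseRange_coe
    obtain ⟨ρ, h⟩ := M.exists_integrates hι
    exact ⟨ρ, h.isNondegenerate hι, h, fun ρ' h' => h'.unique hι h⟩
  · obtain ⟨M, hM⟩ := CQGCoidealDatum.exists_dkModule_integrates hρ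
    exact ⟨M, hM, fun M' hM' => hM'.module_unique hM⟩
  -- The bijection sends a module to its integrated representation. Injectivity holds because the
  -- representation determines both `ρ(𝓘)H` and the structure on it; surjectivity is the
  -- construction on `ρ(𝓘)H` together with uniqueness of the integrated representation.
  · choose F hF using fun P : DenseLCModule D H => P.dkModule.exists_integrates P.denseRange
    let G : DenseLCModule D H → {ρ : D.double →⋆ₙₐ[ℂ] (H →L[ℂ] H) // D.IsNondegenerate ρ} :=
      fun P => ⟨F P, (hF P).isNondegenerate P.denseRange⟩
    have hG : Function.Bijective G := by
      refine ⟨fun P Q hPQ => ?_, fun ρ => ?_⟩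
      · have hFPQ : F P = F Q := congrArg Subtype.val hPQ
        exact DenseLCModule.eq_of_integrates (hF P) (hFPQ ▸ hF Q)
      · obtain ⟨P, hP⟩ := DenseLCModule.exists_integrates ρ.2
        exact ⟨P, Subtype.ext ((hF P).unique P.denseRange hP)⟩
    refine ⟨Equiv.ofBijective G hG, hF, fun ρ => DenseLCModule.space_eq ?_⟩
    have h1 := hF ((Equiv.ofBijective G hG).symm ρ)
    have h2 : F ((Equiv.ofBijective G hG).symm ρ) = ρ.1 :=
      congrArg Subtype.val ((Equiv.ofBijective G hG).apply_symm_apply ρ)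
    rwa [h2] at h1
  · exact ⟨fun ⟨T, hT⟩ => hT.exists_unitary_equiv hι hι' h h',
      fun ⟨U, hU⟩ => hM.exists_intertwiner hM' hι hι' h h' hU⟩
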